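/- **Proposition 4.3 (AP property of the Aubin–Robin method in the Dirichlet limit $\varepsilon\to0$).** *Setting.* Let $\Omega\subset\mathbb R^2$ be the interior of the union of the triangles of a finite conforming triangulation, with boundary $\Gamma$ (the sides belonging to one triangle only) and outward unit normal $n$. For $P\in\mathbb N$ let $$\mathcal V_h^P=\{v\in C^0(\overline\Omega):\ v|_K \text{ is a polynomial of degree}\le P\text{ for every triangle }K\}.$$ Let $\alpha\in\mathbb R$, $\gamma>0$, $f\in L^2(\Omega)$, $u_{RD},q_{RN}\in L^2(\Gamma)$. Write $(\cdot,\cdot)_A$ for the $L^2$ scalar product over $A$, gradients of discrete functions being taken triangle by triangle, and $$\mathcal I_\Omega(u)=(\nabla u,\nabla v)_\Omega+\alpha(u,v)_\Omega,\qquad \mathcal A_\Gamma(g)=(g,v/\gamma)_\Gamma .$$ The Aubin–Robin method for $-\Delta u+\alpha u=f$ in $\Omega$, $u-u_{RD}+\varepsilon(\nabla u\cdot n-q_{RN})=0$ on $\Gamma$, is: find $u\in\mathcal V_h^P$ such that for all $v\in\mathcal V_h^P$ $$\mathcal I_\Omega(u)-(f,v)_\Omega-(\nabla u\cdot n,v)_\Gamma+\frac{\gamma}{\gamma+\varepsilon}\mathcal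 A_\Gamma(u-u_{RD})+\frac{\varepsilon\gamma}{\gamma+\varepsilon}\mathcal A_\Gamma(\nabla u\cdot n-q_{RN})=0.\tag{R}$$ For functions $u_0,u_1,\dots$ put $f_0=f$ and $f_m=0$ for $m\ge1$, and $$u_{D,0}=u_{RD},\qquad u_{D,1}=q_{RN}-\nabla u_0\cdot n,\qquad u_{D,m}=-\nabla u_{m-1}\cdot n\quad(m\ge2).$$ The *cascade* is the sequence of Aubin–Dirichlet problems, for $m\ge0$ and all $v\in\mathcal V_h^P$, $$\mathcal I_\Omega(u_m)-(f_m,v)_\Omega-(\nabla u_m\cdot n,v)_\Gamma+\mathcal A_\Gamma(u_m-u_{D,m})=\mathcal E_m,\tag{C}$$ $$\mathcal E_0=0,\qquad \mathcal E_m=-\sum_{\ell=0}^{m-1}(-\gamma)^{-(m-\ell)}\mathcal A_\Gamma(u_\ell-u_{D,\ell})\quad(m\ge1).$$ *Claim.* 1. *(Cascade.)* For $u_0,u_1,\dots\in\mathcal V_h^P$, the ansatz $\sum_m\varepsilon^mu_m$ satisfies (R) to all orders as $\varepsilon\to0^+$ (for every $v\in\mathcal V_h^P$ and every $N$, the left-hand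 side of (R) at $\sum_{m\le N}\varepsilon^mu_m$ is $O(\varepsilon^{N+1})$) if and only if (C) holds for all $m$. In particular, if $U_\varepsilon\in\mathcal V_h^P$ solves (R) for all small $\varepsilon>0$ and $\|U_\varepsilon-\sum_{m\le N}\varepsilon^mu_m\|_{H^1(\Omega)}=O(\varepsilon^{N+1})$ for every $N$, then (C) holds for all $m$. 2. *(Consistency.)* If $u_m\in C^2(\Omega)\cap C^1(\overline\Omega)$ are the exact modes, i.e. $-\Delta u_m+\alpha u_m=f_m$ in $\Omega$ and $u_m=u_{D,m}$ almost everywhere on $\Gamma$ for all $m\ge0$, then they satisfy (C) for all $m$ and all $v\in\mathcal V_h^P$, with $\mathcal E_m=0$. 3. *(Coercivity.)* Let $a(u,v)=\mathcal I_\Omega(u)-(\nabla u\cdot n,v)_\Gamma+\mathcal A_\Gamma(u)$ be the Aubin–Dirichlet bilinear form, common to all the problems (C). For every $\sigma>0$ there are $C_\gamma,c>0$ depending only on $P,\sigma$, and for every $D>0$ a $\kappa>0$ depending only on $P,\sigma,D$, such that the following holds. If every triangle $K$ contains a disc of radius $h_K/\sigma$, where $h_K=\operatorname{diam}K$, if $\operatorname{diam}\Omega\le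 D$, $\alpha\ge0$, and $0<\gamma\le C_\gamma h_K$ for every triangle $K$ with a side on $\Gamma$, then for all $v\in\mathcal V_h^P$ $$a(v,v)\ \ge\ c\left(\|\nabla v\|_{\Omega}^2+\alpha\|v\|_{\Omega}^2+\gamma^{-1}\|v\|_{\Gamma}^2\right),\qquad a(v,v)\ \ge\ \kappa\,\|v\|_{H^1(\Omega)}^2 .$$ Under these conditions, given $u_0,\dots,u_{m-1}\in\mathcal V_h^P$, problem (C) of order $m$ has exactly one solution $u_m\in\mathcal V_h^P$; problem (R) has exactly one solution $U_\varepsilon\in\mathcal V_h^P$ for every $\varepsilon>0$; and if $u_0,u_1,\dots\in\mathcal V_h^P$ solve (C) for all $m$, then $\|U_\varepsilon-\sum_{m\le N}\varepsilon^mu_m\|_{H^1(\Omega)}=O(\varepsilon^{N+1})$ as $\varepsilon\to0^+$, for every $N$. -/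

import Mathlib

open MeasureTheory Filter Topology Asymptotics
open scoped ENNReal

noncomputable section

/-- The Euclidean plane. -/
abbrev Plane : Type := EuclideanSpace ℝ (Fin 2)

/-- A conforming mesh of the plane: finitely many nondegenerate triangles, no two with the same
vertices, such that two distinct triangles meet at most in the convex hull of their common vertices
(that is, in nothing, a common vertex, or a common edge). -/
structure TriMesh where
  numCells : ℕ
  cell : Fin numCells → Affine.Triangle ℝ Plane
  distinct : Function.Injective (fun K => Set.range (cell K).points)
  conforming : ∀ K L, K ≠ L →
    convexHull ℝ (Set.range (cell K).points) ∩ convexHull ℝ (Set.range (cell L).points) ⊆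
      convexHull ℝ (Set.range (cell K).points ∩ Set.range (cell L).points)

namespace TriMesh

variable (M : TriMesh)

/-- The closed triangle with index `K`. -/
def elem (K : Fin M.numCells) : Set Plane := convexHull ℝ (Set.range (M.cell K).points)

/-- The closed meshed region; the domain `Ω` is its interior. -/
def region : Set Plane := ⋃ K, M.elem K

/-- The mesh size of a single triangle (its diameter). -/
def size (K : Fin M.numCells) : ℝ := Metric.diam (M.elem K)

/-- Every triangle `K` contains a disc of radius `h_K / σ`. -/
def ShapeRegular (σ : ℝ) : Prop :=
  ∀ K, ∃ z : Plane, Metric.closedBall z (M.size K / σ) ⊆ M.elem K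

/-- A side of a triangle, given by the triangle and the vertex opposite to the side. -/
abbrev Side : Type := Fin M.numCells × Fin 3

/-- The two end points of a side. -/
def endA (F : M.Side) : Plane := (M.cell F.1).points (F.2 + 1)

def endB (F : M.Side) : Plane := (M.cell F.1).points (F.2 + 2)

open Classical in
/-- The sides making up the boundary `Γ`: those that are not a side of another triangle. -/
def bdry : Finset M.Side :=
  Finset.univ.filter fun F =>
    ∀ L, L ≠ F.1 → ¬ ({M.endA F, M.endB F} : Set Plane) ⊆ Set.range (M.cell L).points

/-- The outward unit normal on a side: the direction from the opposite vertex to the foot of the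
altitude dropped from it. -/
def normal (F : M.Side) : Plane :=
  ((M.cell F.1).height F.2)⁻¹ •
    ((M.cell F.1).altitudeFoot F.2 - (M.cell F.1).points F.2)

/-- Arc length on a side, through the affine parametrization over `[0, 1]`. -/
def arc (F : M.Side) : Measure Plane :=
  ENNReal.ofReal (dist (M.endA F) (M.endB F)) •
    ((volume.restrict (Set.Icc (0 : ℝ) 1)).map (fun t => AffineMap.lineMap (M.endA F) (M.endB F) t))

/-- The finite element space: functions continuous on the closed region whose restriction to every
triangle is a polynomial of total degree at most `P`. Functions on the region are represented by
their extension by zero. -/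
def feSpace (P : ℕ) : Submodule ℝ (Plane → ℝ) where
  carrier := {v | ContinuousOn v M.region ∧
    (∀ K, ∃ p : MvPolynomial (Fin 2) ℝ, p.totalDegree ≤ P ∧
      ∀ x ∈ M.elem K, v x = MvPolynomial.eval (fun i => x i) p) ∧
    ∀ x ∉ M.region, v x = 0}
  zero_mem' := ⟨continuousOn_const, fun _ => ⟨0, by simp, by simp⟩, fun _ _ => rfl⟩
  add_mem' := by
    rintro v w ⟨hv, hv', hv0⟩ ⟨hw, hw', hw0⟩
    refine ⟨hv.add hw, fun K => ?_, fun x hx => by simp [hv0 x hx, hw0 x hx]⟩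
    obtain ⟨p, hp, hpv⟩ := hv' K
    obtain ⟨q, hq, hqw⟩ := hw' K
    exact ⟨p + q, (MvPolynomial.totalDegree_add p q).trans (max_le hp hq),
      fun x hx => by simp [hpv x hx, hqw x hx]⟩
  smul_mem' := by
    rintro a v ⟨hv, hv', hv0⟩
    refine ⟨hv.const_smul a, fun K => ?_, fun x hx => by simp [hv0 x hx]⟩
    obtain ⟨p, hp, hpv⟩ := hv' K
    exact ⟨a • p, (MvPolynomial.totalDegree_smul_le a p).trans hp,
      fun x hx => by simp [hpv x hx, MvPolynomial.smul_eval]⟩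

/-- The gradient of `w` on the closed triangle `K`, one-sided at the boundary of `K`. -/
def grad (K : Fin M.numCells) (w : Plane → ℝ) (x : Plane) : Plane :=
  gradientWithin w (M.elem K) x

/-- The normal derivative `∇w · n` on a side, taken from the triangle of the side. -/
def normalDeriv (w : Plane → ℝ) (F : M.Side) (x : Plane) : ℝ :=
  inner ℝ (M.grad F.1 w x) (M.normal F)

/-- `(f, g)_Ω`. -/
def innerDomain (f g : Plane → ℝ) : ℝ := ∫ x in M.region, f x * g x

/-- `(∇u, ∇v)_Ω`, the gradients being taken triangle by triangle. -/
def innerGrad (u v : Plane → ℝ) : ℝ :=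
  ∑ K, ∫ x in M.elem K, inner ℝ (M.grad K u x) (M.grad K v x)

/-- `(g, v)_Γ`, for a function `g` given on each boundary side (it may be two-valued at
corners). -/
def innerBdry (g : M.Side → Plane → ℝ) (v : Plane → ℝ) : ℝ :=
  ∑ F ∈ M.bdry, ∫ x, g F x * v x ∂(M.arc F)

/-- The norm of `H¹(Ω)`. -/
def h1Norm (w : Plane → ℝ) : ℝ := √(M.innerDomain w w + M.innerGrad w w)

/-- The square of the norm of `L²(Γ)`. -/
def bdryNormSq (w : Plane → ℝ) : ℝ := M.innerBdry (fun _ => w) w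

/-- `𝓘_Ω(u) = (∇u, ∇v)_Ω + α (u, v)_Ω`. -/
def formI (α : ℝ) (u v : Plane → ℝ) : ℝ := M.innerGrad u v + α * M.innerDomain u v

/-- The Aubin penalty `𝓐_Γ(g) = (g, v / γ)_Γ`. -/
def penalty (γ : ℝ) (g : M.Side → Plane → ℝ) (v : Plane → ℝ) : ℝ :=
  M.innerBdry g (fun x => v x / γ)

/-- The bilinear form of the classical Aubin–Dirichlet method,
`𝓘_Ω(u) - (∇u · n, v)_Γ + 𝓐_Γ(u)`. -/
def dirichletForm (α γ : ℝ) (u v : Plane → ℝ) : ℝ :=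
  M.formI α u v - M.innerBdry (M.normalDeriv u) v + M.penalty γ (fun _ => u) v

end TriMesh

/-- The data of the Robin problem `-Δu + α u = f` in `Ω`,
`u - u_RD + ε (∇u · n - q_RN) = 0` on `Γ`. -/
structure RobinData where
  α : ℝ
  f : Plane → ℝ
  uRD : Plane → ℝ
  qRN : Plane → ℝ

namespace RobinData

variable (d : RobinData) (M : TriMesh)

/-- `f ∈ L²(Ω)` and `u_RD, q_RN ∈ L²(Γ)`. -/
def SquareIntegrable : Prop :=
  MemLp d.f 2 (volume.restrict M.region) ∧
    ∀ F ∈ M.bdry, MemLp d.uRD 2 (M.arc F) ∧ MemLp d.qRN 2 (M.arc F)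

/-- The left-hand side of the Aubin–Robin method with parameter `ε`, tested with `v`. -/
def robinResidual (γ ε : ℝ) (u v : Plane → ℝ) : ℝ :=
  M.formI d.α u v - M.innerDomain d.f v - M.innerBdry (M.normalDeriv u) v
    + γ / (γ + ε) * M.penalty γ (fun _ x => u x - d.uRD x) v
    + ε * γ / (γ + ε) * M.penalty γ (fun F x => M.normalDeriv u F x - d.qRN x) v

/-- `u` solves the discrete Aubin–Robin problem in the finite element space. -/
def IsRobinSolution (P : ℕ) (γ ε : ℝ) (u : Plane → ℝ) : Prop :=
  u ∈ M.feSpace P ∧ ∀ v ∈ M.feSpace P, d.robinResidual M γ ε u v = 0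

/-- `f_0 = f`, and `f_m = 0` for `m ≥ 1`. -/
def source (m : ℕ) (x : Plane) : ℝ := if m = 0 then d.f x else 0

/-- The Dirichlet data of the modes: `u_{D,0} = u_RD`, `u_{D,1} = q_RN - ∇u_0 · n`, and
`u_{D,m} = -∇u_{m-1} · n` for `m ≥ 2`. -/
def modeData (u : ℕ → Plane → ℝ) : ℕ → M.Side → Plane → ℝ
  | 0, _, x => d.uRD x
  | 1, F, x => d.qRN x - M.normalDeriv (u 0) F x
  | m + 2, F, x => - M.normalDeriv (u (m + 1)) F x

/-- `𝓐_Γ(u_m - u_{D,m})`. -/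
def modePenalty (γ : ℝ) (u : ℕ → Plane → ℝ) (m : ℕ) (v : Plane → ℝ) : ℝ :=
  M.penalty γ (fun F x => u m x - d.modeData M u m F x) v

/-- The error term `𝓔_m = -∑_{ℓ < m} (-γ)^{-(m-ℓ)} 𝓐_Γ(u_ℓ - u_{D,ℓ})`; in particular `𝓔_0 = 0`. -/
def errorTerm (γ : ℝ) (u : ℕ → Plane → ℝ) (m : ℕ) (v : Plane → ℝ) : ℝ :=
  - ∑ l ∈ Finset.range m, (-γ) ^ (-((m : ℤ) - (l : ℤ))) * d.modePenalty M γ u l v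

/-- The Aubin–Dirichlet problem of order `m`, tested with `v`. -/
def ModeEquation (γ : ℝ) (u : ℕ → Plane → ℝ) (m : ℕ) (v : Plane → ℝ) : Prop :=
  M.formI d.α (u m) v - M.innerDomain (d.source m) v - M.innerBdry (M.normalDeriv (u m)) v
    + d.modePenalty M γ u m v = d.errorTerm M γ u m v

/-- All modes solve their Aubin–Dirichlet problem in the finite element space. -/
def SolvesCascade (P : ℕ) (γ : ℝ) (u : ℕ → Plane → ℝ) : Prop :=
  ∀ m, ∀ v ∈ M.feSpace P, d.ModeEquation M γ u m v

/-- The partial sum `∑_{m ≤ N} ε^m u_m`. -/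
def _root_.partialExpansion (u : ℕ → Plane → ℝ) (N : ℕ) (ε : ℝ) (x : Plane) : ℝ :=
  ∑ m ∈ Finset.range (N + 1), ε ^ m * u m x

/-- The ansatz `∑ ε^m u_m` satisfies the discrete Aubin–Robin problem to all orders in `ε`: the
residual of the partial sum of order `N` is `O(ε^{N+1})`, for every test function. -/
def IsFormalSolution (P : ℕ) (γ : ℝ) (u : ℕ → Plane → ℝ) : Prop :=
  ∀ v ∈ M.feSpace P, ∀ N : ℕ,
    (fun ε : ℝ => d.robinResidual M γ ε (partialExpansion u N ε) v)
      =O[𝓝[>] 0] (fun ε : ℝ => ε ^ (N + 1))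

/-- The functions `u_m` are the modes of the asymptotic expansion `U_ε ∼ ∑ ε^m u_m` in `H¹(Ω)`,
as `ε → 0⁺`. -/
def _root_.IsAsymptoticExpansion (M : TriMesh) (U : ℝ → Plane → ℝ) (u : ℕ → Plane → ℝ) : Prop :=
  ∀ N : ℕ, (fun ε : ℝ => M.h1Norm (fun x => U ε x - partialExpansion u N ε x))
    =O[𝓝[>] 0] (fun ε : ℝ => ε ^ (N + 1))

/-- The exact modes: classical solutions, in `C²(Ω) ∩ C¹(Ω̄)`, of the Dirichlet problems
`-Δu_m + α u_m = f_m` in `Ω`, `u_m = u_{D,m}` on `Γ` (up to a set of zero length, such as the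
corners). -/
def IsExactModes (u : ℕ → Plane → ℝ) : Prop :=
  ∀ m, ContDiffOn ℝ 1 (u m) M.region ∧ ContDiffOn ℝ 2 (u m) (interior M.region) ∧
    (∀ x ∈ interior M.region, - Laplacian.laplacian (u m) x + d.α * u m x = d.source m x) ∧
    ∀ F ∈ M.bdry, ∀ᵐ x ∂(M.arc F), u m x = d.modeData M u m F x

end RobinData

end

noncomputable section

/-! Cascade. Let `B_m = 𝓘_Ω(u_m) - (f_m, v)_Ω - (∇u_m · n, v)_Γ` and `A_m = 𝓐_Γ(u_m - u_{D,m})` for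
a fixed test function `v`. The Dirichlet data are chosen so that the flux term of order `m` in the
Robin residual supplies the data of order `m + 1`. Hence `γ + ε` times the residual of a partial sum
is a polynomial in `ε` with coefficients `γ (B_m + A_m) + B_{m-1}`, plus one remainder at order `N +
1` (`robinResidual_eq_coefficient`). Being `O(ε^{N+1})` for every `N` means that all these
coefficients vanish (`isBigO_expansion_iff`). This is (C): the error terms satisfy `𝓔_{m+1} = -γ⁻¹
(𝓔_m - A_m)`, and (C) at order `m` says `𝓔_m - A_m = B_m` (`forall_coefficient_eq_zero_iff`). An
expansion in `H¹` gives small residuals because, for fixed `v`, the Robin forms are bounded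
uniformly in `ε`.

Consistency. Exact modes have zero penalty, hence zero error terms, and what remains is Green's
formula (`green_formula`). It comes from the divergence theorem on each triangle, obtained by
pulling back to a square (`divergence_triangle`); the contributions of interior sides cancel because
conforming neighbours lie on opposite sides of their common side (`normal_eq_neg`,
`sum_sides_eq_sum_bdry`).

Coercivity. Young's inequality splits the flux term into `γ ‖∇v · n‖²_Γ` and `γ⁻¹ ‖v‖²_Γ`. The
former is absorbed by `‖∇v‖²_Ω` for small `γ / h`, through an inverse trace inequality whose
constant comes from compactness on a reference triangle (`exists_trace_le`). A Friedrichs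
inequality, obtained by integrating the divergence of `v² (x - x₀)`, gives control in `H¹`
(`innerDomain_self_le`). Solvability is then finite-dimensional linear algebra. The Robin form is a
convex combination of the Dirichlet form and of `𝓘_Ω ≥ 0`, so it is coercive too; testing the
equation of the error with the error itself bounds it by `ε^{N+1}`. -/

/-! ### Quadratic forms on finite-dimensional spaces -/

/-- A quadratic form on a finite-dimensional space is bounded by any positive definite one. -/
theorem exists_quadratic_le_mul_posDef {V : Type*} [AddCommGroup V] [Module ℝ V]
    [FiniteDimensional ℝ V] (B₁ B₂ : V →ₗ[ℝ] V →ₗ[ℝ] ℝ) (h₂ : ∀ v, v ≠ 0 → 0 < B₂ v v) :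
    ∃ C : ℝ, 0 < C ∧ ∀ v, B₁ v v ≤ C * B₂ v v := by
  -- `V` carries no topology, so compactness of the unit sphere is used on a Euclidean space of the
  -- same dimension.
  let φ : EuclideanSpace ℝ (Fin (Module.finrank ℝ V)) ≃ₗ[ℝ] V :=
    LinearEquiv.ofFinrankEq _ _ (by simp)
  have hcont : ∀ B : V →ₗ[ℝ] V →ₗ[ℝ] ℝ, Continuous fun x => B (φ x) (φ x) := by
    intro B
    have h1 : Continuous (LinearMap.toContinuousLinearMap.toLinearMap ∘ₗ
        (B.compl₁₂ φ.toLinearMap φ.toLinearMap)) := LinearMap.continuous_of_finiteDimensional _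
    exact h1.clm_apply continuous_id
  -- The sphere is empty only when `V` is trivial.
  obtain hE | hE :=
    (Metric.sphere (0 : EuclideanSpace ℝ (Fin (Module.finrank ℝ V))) 1).eq_empty_or_nonempty
  · refine ⟨1, one_pos, fun v => ?_⟩
    have hv : φ.symm v = 0 := by
      by_contra h
      have : (‖φ.symm v‖⁻¹ • φ.symm v) ∈
          Metric.sphere (0 : EuclideanSpace ℝ (Fin (Module.finrank ℝ V))) 1 := by
        simp [norm_smul, inv_mul_cancel₀ (norm_ne_zero_iff.2 h)]
      simp [hE] at this
    have : v = 0 := by simpa using hv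
    simp [this]
  · have hK := isCompact_sphere (0 : EuclideanSpace ℝ (Fin (Module.finrank ℝ V))) 1
    obtain ⟨x, hx, hmin⟩ := hK.exists_isMinOn hE (hcont B₂).continuousOn
    obtain ⟨y, hy, hmax⟩ := hK.exists_isMaxOn hE (hcont B₁).continuousOn
    have hx0 : 0 < B₂ (φ x) (φ x) := by
      refine h₂ _ fun h => ?_
      have : x = 0 := by simpa using h
      simp [this] at hx
    set m := B₂ (φ x) (φ x)
    set M := B₁ (φ y) (φ y)
    -- The maximum `M` of the first form may be negative or zero; the absolute value and the `+ 1`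
    -- keep the constant positive.
    refine ⟨|M| / m + 1, by positivity, fun v => ?_⟩
    obtain ⟨z, rfl⟩ := φ.surjective v
    by_cases hz : z = 0
    · simp [hz]
    have hn : 0 < ‖z‖ := norm_pos_iff.2 hz
    have hw : (‖z‖⁻¹ • z) ∈ Metric.sphere (0 : EuclideanSpace ℝ (Fin (Module.finrank ℝ V))) 1 := by
      simp [norm_smul, inv_mul_cancel₀ hn.ne']
    have e1 : B₁ (φ (‖z‖⁻¹ • z)) (φ (‖z‖⁻¹ • z)) ≤ M := hmax hw
    have e2 : m ≤ B₂ (φ (‖z‖⁻¹ • z)) (φ (‖z‖⁻¹ • z)) := hmin hw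
    have e3 : B₁ (φ (‖z‖⁻¹ • z)) (φ (‖z‖⁻¹ • z)) ≤
        (|M| / m + 1) * B₂ (φ (‖z‖⁻¹ • z)) (φ (‖z‖⁻¹ • z)) :=
      calc _ ≤ |M| := e1.trans (le_abs_self _)
        _ = |M| / m * m := by field_simp
        _ ≤ (|M| / m + 1) * m := by nlinarith
        _ ≤ _ := by gcongr
    simp only [map_smul, LinearMap.smul_apply, smul_eq_mul] at e3
    have h4 : 0 < ‖z‖⁻¹ * ‖z‖⁻¹ := by positivity
    refine le_of_mul_le_mul_left ?_ h4
    linarith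

/-! ### Polynomial functions on the plane -/

open MvPolynomial in
theorem MvPolynomial.totalDegree_pderiv_le_self {σ : Type*} (i : σ) (p : MvPolynomial σ ℝ) :
    (pderiv i p).totalDegree ≤ p.totalDegree := by
  conv_lhs => rw [p.as_sum, map_sum]
  refine totalDegree_finsetSum_le fun s hs => ?_
  rw [pderiv_monomial]
  refine (totalDegree_monomial_le _ _).trans (le_trans ?_ (le_totalDegree hs))
  have h : s - Finsupp.single i 1 ≤ s := tsub_le_self
  exact Finsupp.degree_mono h

open MvPolynomial in
theorem MvPolynomial.totalDegree_bind₁_le_of_le_one {σ τ : Type*} (f : σ → MvPolynomial τ ℝ)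
    (hf : ∀ i, (f i).totalDegree ≤ 1) (p : MvPolynomial σ ℝ) :
    (bind₁ f p).totalDegree ≤ p.totalDegree := by
  classical
  conv_lhs => rw [p.as_sum, map_sum]
  refine totalDegree_finsetSum_le fun s hs => ?_
  rw [bind₁_monomial]
  refine (totalDegree_mul _ _).trans ?_
  rw [totalDegree_C, zero_add]
  refine le_trans ?_ (le_totalDegree hs)
  refine (totalDegree_finsetProd _ _).trans ?_
  rw [Finsupp.sum]
  refine Finset.sum_le_sum fun i _ => (totalDegree_pow _ _).trans ?_
  nlinarith [hf i]

/-- The gradient of a polynomial, as a vector field on the plane. -/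
def MvPolynomial.planeGrad (p : MvPolynomial (Fin 2) ℝ) (x : Plane) : Plane :=
  WithLp.toLp 2 fun i => eval (fun j => x j) (pderiv i p)

/-- The function on the plane defined by a polynomial. -/
def MvPolynomial.planeEval (p : MvPolynomial (Fin 2) ℝ) (x : Plane) : ℝ := eval (fun j => x j) p

namespace MvPolynomial

@[simp] theorem planeGrad_apply (p : MvPolynomial (Fin 2) ℝ) (x : Plane) (i : Fin 2) :
    p.planeGrad x i = (pderiv i p).planeEval x := rfl

theorem hasFDerivAt_planeEval (p : MvPolynomial (Fin 2) ℝ) (x : Plane) :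
    HasFDerivAt p.planeEval (innerSL ℝ (p.planeGrad x)) x := by
  induction p using MvPolynomial.induction_on with
  | C a =>
    have : (C a : MvPolynomial (Fin 2) ℝ).planeGrad x = 0 := by ext i; simp [planeEval]
    rw [this, map_zero]
    have h2 : (C a : MvPolynomial (Fin 2) ℝ).planeEval = fun _ => a := by ext; simp [planeEval]
    rw [h2]
    exact hasFDerivAt_const _ _
  | add p q hp hq =>
    have : (p + q).planeGrad x = p.planeGrad x + q.planeGrad x := by ext i; simp [planeEval]
    rw [this, map_add]
    have h2 : (p + q).planeEval = fun y => p.planeEval y + q.planeEval y := by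
      ext; simp [planeEval]
    rw [h2]
    exact hp.add hq
  | mul_X p i hp =>
    have h2 : (p * X i).planeEval = fun y => p.planeEval y * y i := by
      ext; simp [planeEval]
    have h3 : HasFDerivAt (fun y : Plane => y i) (EuclideanSpace.proj i : Plane →L[ℝ] ℝ) x :=
      (EuclideanSpace.proj i : Plane →L[ℝ] ℝ).hasFDerivAt
    rw [h2]
    refine (hp.mul h3).congr_fderiv ?_
    ext w
    simp only [add_apply, smul_apply,
      innerSL_apply_apply, PiLp.inner_apply, planeGrad_apply, Fin.sum_univ_two, planeEval,
      Derivation.leibniz, pderiv_X, smul_eq_mul, map_add, map_mul, eval_X, PiLp.proj_apply]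
    fin_cases i <;> simp <;> ring

theorem continuous_planeEval (p : MvPolynomial (Fin 2) ℝ) : Continuous p.planeEval :=
  continuous_iff_continuousAt.2 fun x => (p.hasFDerivAt_planeEval x).continuousAt

theorem continuous_planeGrad (p : MvPolynomial (Fin 2) ℝ) : Continuous p.planeGrad := by
  refine (PiLp.continuous_toLp 2 _).comp (continuous_pi fun i => ?_)
  exact continuous_planeEval (pderiv i p)

/-- The space of polynomial functions is stable under affine maps of the plane. -/
theorem exists_planeEval_comp_affine (p : MvPolynomial (Fin 2) ℝ) (o e f : Plane) :
    ∃ q : MvPolynomial (Fin 2) ℝ, q.totalDegree ≤ p.totalDegree ∧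
      ∀ x : Plane, q.planeEval x = p.planeEval (o + x 0 • e + x 1 • f) := by
  refine ⟨bind₁ (fun i => C (o i) + C (e i) * X 0 + C (f i) * X 1) p,
    totalDegree_bind₁_le_of_le_one _ (fun i => ?_) _, fun x => ?_⟩
  · refine (totalDegree_add _ _).trans (max_le ((totalDegree_add _ _).trans (max_le ?_ ?_)) ?_)
    · simp
    · exact (totalDegree_mul _ _).trans (by simp)
    · exact (totalDegree_mul _ _).trans (by simp)
  · simp only [planeEval, eval, eval₂Hom_bind₁]
    congr 2
    ext i
    simp
    ring

/-- A polynomial vanishing on a nonempty open set vanishes. -/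
theorem eq_zero_of_planeEval_eq_zero {p : MvPolynomial (Fin 2) ℝ} {U : Set Plane} (hU : IsOpen U)
    (hne : U.Nonempty) (h : ∀ x ∈ U, p.planeEval x = 0) : p = 0 := by
  obtain ⟨x, hx⟩ := hne
  have hV : IsOpen ((WithLp.toLp 2 : (Fin 2 → ℝ) → Plane) ⁻¹' U) :=
    hU.preimage (PiLp.continuous_toLp 2 _)
  have hxV : WithLp.ofLp x ∈ ((WithLp.toLp 2 : (Fin 2 → ℝ) → Plane) ⁻¹' U) := by simpa using hx
  -- An open set contains a box with infinite sides, and a polynomial vanishing on a product of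
  -- infinite sets is zero.
  obtain ⟨s, hs, hsV⟩ := isOpen_pi_iff'.1 hV _ hxV
  refine funext_set s (fun i => ?_) fun y hy => ?_
  · exact infinite_of_mem_nhds _ ((hs i).1.mem_nhds (hs i).2)
  · simpa [planeEval] using h _ (hsV hy)

end MvPolynomial

/-- Polynomial functions of total degree at most `P` on the plane. -/
def polyFun (P : ℕ) : Submodule ℝ (Plane → ℝ) where
  carrier := {g | ∃ p : MvPolynomial (Fin 2) ℝ, p.totalDegree ≤ P ∧ g = p.planeEval}
  zero_mem' := ⟨0, by simp, by ext; simp [MvPolynomial.planeEval]⟩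
  add_mem' := by
    rintro _ _ ⟨p, hp, rfl⟩ ⟨q, hq, rfl⟩
    exact ⟨p + q, (MvPolynomial.totalDegree_add p q).trans (max_le hp hq),
      by ext; simp [MvPolynomial.planeEval]⟩
  smul_mem' := by
    rintro a _ ⟨p, hp, rfl⟩
    exact ⟨a • p, (MvPolynomial.totalDegree_smul_le a p).trans hp,
      by ext; simp [MvPolynomial.planeEval, MvPolynomial.smul_eval]⟩

instance (P : ℕ) : FiniteDimensional ℝ (polyFun P) := by
  let L : MvPolynomial (Fin 2) ℝ →ₗ[ℝ] (Plane → ℝ) :=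
    { toFun := MvPolynomial.planeEval
      map_add' := fun p q => by ext; simp [MvPolynomial.planeEval]
      map_smul' := fun a p => by ext; simp [MvPolynomial.planeEval, MvPolynomial.smul_eval] }
  have h : polyFun P = (MvPolynomial.restrictTotalDegree (Fin 2) ℝ P).map L := by
    ext g
    simp only [Submodule.mem_map, MvPolynomial.mem_restrictTotalDegree]
    constructor
    · rintro ⟨p, hp, rfl⟩; exact ⟨p, hp, rfl⟩
    · rintro ⟨p, hp, rfl⟩; exact ⟨p, hp, rfl⟩
  rw [h]
  infer_instance

/-! ### The divergence theorem on a triangle -/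

/-- The determinant of two vectors of the plane. -/
def cross (x y : Plane) : ℝ := x 0 * y 1 - x 1 * y 0

/-- The Duffy map from the unit square to the triangle `o a b`, which collapses a side to `o`. -/
def duffy (o a b : Plane) (z : ℝ × ℝ) : Plane := o + z.1 • (a - o) + (z.1 * z.2) • (b - a)

/-- The measurable identification of the plane with pairs of reals. -/
def planeEquiv : Plane ≃ᵐ ℝ × ℝ :=
  (MeasurableEquiv.toLp 2 (Fin 2 → ℝ)).symm.trans MeasurableEquiv.finTwoArrow

theorem measurePreserving_planeEquiv : MeasurePreserving planeEquiv volume volume :=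
  (volume_preserving_finTwoArrow ℝ).comp
    (EuclideanSpace.volume_preserving_symm_measurableEquiv_toLp (Fin 2))

/-- The open unit square. -/
abbrev openSquare : Set (ℝ × ℝ) := Set.Ioo 0 1 ×ˢ Set.Ioo 0 1

theorem continuous_duffy (o a b : Plane) : Continuous (duffy o a b) := by
  unfold duffy; fun_prop

theorem hasFDerivAt_duffy (o a b : Plane) (z : ℝ × ℝ) :
    HasFDerivAt (duffy o a b)
      ((ContinuousLinearMap.fst ℝ ℝ ℝ).smulRight (a - o + z.2 • (b - a)) +
        (ContinuousLinearMap.snd ℝ ℝ ℝ).smulRight (z.1 • (b - a))) z := by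
  have h1 : HasFDerivAt (fun z : ℝ × ℝ => z.1 • (a - o)) _ z :=
    (hasFDerivAt_fst (𝕜 := ℝ) (p := z)).smul_const (a - o)
  have h2 : HasFDerivAt (fun z : ℝ × ℝ => (z.1 * z.2) • (b - a)) _ z :=
    ((hasFDerivAt_fst (𝕜 := ℝ) (p := z)).mul hasFDerivAt_snd).smul_const (b - a)
  refine ((h1.const_add o).add h2).congr_fderiv ?_
  ext w <;> simp

/-- The triangle is the join of `o` with the segment `a b`: the second parameter picks a point of
the segment, the first the fraction of the way to it. -/
theorem convexHull_eq_image_duffy (o a b : Plane) :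
    convexHull ℝ {o, a, b} = duffy o a b '' (Set.Icc 0 1 ×ˢ Set.Icc 0 1) := by
  rw [convexHull_insert ⟨a, by simp⟩, convexHull_pair]
  ext x
  simp only [convexJoin_singleton_left, Set.mem_iUnion, segment_eq_image', Set.mem_image,
    Set.mem_prod, Prod.exists, duffy, exists_prop]
  constructor
  · rintro ⟨_, ⟨t, ht, rfl⟩, s, hs, rfl⟩
    exact ⟨s, t, ⟨hs, ht⟩, by module⟩
  · rintro ⟨s, t, ⟨hs, ht⟩, rfl⟩
    exact ⟨_, ⟨t, ht, rfl⟩, s, hs, by module⟩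

theorem plane_ext {x y : Plane} (h0 : x 0 = y 0) (h1 : x 1 = y 1) : x = y := by
  ext i; fin_cases i <;> assumption

section

variable {o a b : Plane}

/-- This determinant and the next one recover `z.1` and `z.1 * z.2`, and so invert the Duffy map
away from `o`. -/
theorem cross_duffy_left (z : ℝ × ℝ) :
    cross (duffy o a b z - o) (b - a) = z.1 * cross (a - o) (b - a) := by
  simp [cross, duffy]; ring

theorem cross_duffy_right (z : ℝ × ℝ) :
    cross (a - o) (duffy o a b z - o) = z.1 * z.2 * cross (a - o) (b - a) := by
  simp [cross, duffy]; ring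

/-- In the affine coordinates `l = s` and `m = s t` the open square becomes `0 < m < l < 1`.
Openness and convexity of the image follow from this description. -/
theorem image_duffy_openSquare (hD : cross (a - o) (b - a) ≠ 0) :
    duffy o a b '' openSquare =
      {x | 0 < cross (a - o) (x - o) / cross (a - o) (b - a) ∧
        cross (a - o) (x - o) / cross (a - o) (b - a) <
          cross (x - o) (b - a) / cross (a - o) (b - a) ∧
        cross (x - o) (b - a) / cross (a - o) (b - a) < 1} := by
  ext x
  simp only [Set.mem_image, Set.mem_prod, Set.mem_Ioo, Set.mem_ofPred_eq]
  constructor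
  · rintro ⟨z, ⟨⟨h1, h2⟩, h3, h4⟩, rfl⟩
    rw [cross_duffy_left, cross_duffy_right, mul_div_cancel_right₀ _ hD,
      mul_div_cancel_right₀ _ hD]
    exact ⟨by positivity, by nlinarith, h2⟩
  · rintro ⟨h1, h2, h3⟩
    set l := cross (x - o) (b - a) / cross (a - o) (b - a) with hl
    set m := cross (a - o) (x - o) / cross (a - o) (b - a) with hm
    have hl0 : 0 < l := h1.trans h2
    refine ⟨(l, m / l), ⟨⟨hl0, h3⟩, by positivity, by simpa [div_lt_one hl0] using h2⟩, ?_⟩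
    have e1 : l * cross (a - o) (b - a) = cross (x - o) (b - a) := div_mul_cancel₀ _ hD
    have e2 : m * cross (a - o) (b - a) = cross (a - o) (x - o) := div_mul_cancel₀ _ hD
    have e3 : l * (m / l) = m := by field_simp
    have : duffy o a b (l, m / l) = o + l • (a - o) + m • (b - a) := by
      simp only [duffy, e3]
    rw [this]
    simp only [cross, PiLp.sub_apply] at e1 e2 hD
    clear_value l m
    -- Cramer's rule, coordinate by coordinate.
    apply plane_ext
    · simp only [PiLp.add_apply, PiLp.smul_apply, PiLp.sub_apply, smul_eq_mul]
      apply mul_right_cancel₀ hD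
      linear_combination (a 0 - o 0) * e1 + (b 0 - a 0) * e2
    · simp only [PiLp.add_apply, PiLp.smul_apply, PiLp.sub_apply, smul_eq_mul]
      apply mul_right_cancel₀ hD
      linear_combination (a 1 - o 1) * e1 + (b 1 - a 1) * e2

theorem isOpen_image_duffy (hD : cross (a - o) (b - a) ≠ 0) :
    IsOpen (duffy o a b '' openSquare) := by
  rw [image_duffy_openSquare hD]
  have h1 : Continuous fun x : Plane => cross (a - o) (x - o) / cross (a - o) (b - a) := by
    simp only [cross, PiLp.sub_apply]; fun_prop
  have h2 : Continuous fun x : Plane => cross (x - o) (b - a) / cross (a - o) (b - a) := by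
    simp only [cross, PiLp.sub_apply]; fun_prop
  exact (isOpen_lt continuous_const h1).inter
    ((isOpen_lt h1 h2).inter (isOpen_lt h2 continuous_const))

theorem image_duffy_subset_convexHull :
    duffy o a b '' openSquare ⊆ convexHull ℝ {o, a, b} := by
  rw [convexHull_eq_image_duffy]
  exact Set.image_mono (Set.prod_mono Set.Ioo_subset_Icc_self Set.Ioo_subset_Icc_self)

theorem image_duffy_subset_interior (hD : cross (a - o) (b - a) ≠ 0) :
    duffy o a b '' openSquare ⊆ interior (convexHull ℝ {o, a, b}) :=
  interior_maximal image_duffy_subset_convexHull (isOpen_image_duffy hD)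

theorem convex_image_duffy (hD : cross (a - o) (b - a) ≠ 0) :
    Convex ℝ (duffy o a b '' openSquare) := by
  rw [image_duffy_openSquare hD]
  have h1 : ∀ (p q : ℝ) (x y : Plane), p + q = 1 →
      cross (a - o) (p • x + q • y - o) / cross (a - o) (b - a) =
        p * (cross (a - o) (x - o) / cross (a - o) (b - a)) +
          q * (cross (a - o) (y - o) / cross (a - o) (b - a)) := by
    intro p q x y h
    obtain rfl : q = 1 - p := by linarith
    simp only [cross, PiLp.sub_apply, PiLp.add_apply, PiLp.smul_apply, smul_eq_mul]
    ring
  have h2 : ∀ (p q : ℝ) (x y : Plane), p + q = 1 →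
      cross (p • x + q • y - o) (b - a) / cross (a - o) (b - a) =
        p * (cross (x - o) (b - a) / cross (a - o) (b - a)) +
          q * (cross (y - o) (b - a) / cross (a - o) (b - a)) := by
    intro p q x y h
    obtain rfl : q = 1 - p := by linarith
    simp only [cross, PiLp.sub_apply, PiLp.add_apply, PiLp.smul_apply, smul_eq_mul]
    ring
  rw [convex_iff_forall_pos]
  rintro x ⟨hx1, hx2, hx3⟩ y ⟨hy1, hy2, hy3⟩ p q hp hq hpq
  simp only [Set.mem_ofPred_eq]
  rw [h1 p q x y hpq, h2 p q x y hpq]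
  refine ⟨by positivity, by nlinarith, by nlinarith⟩

theorem convexHull_subset_closure_image_duffy :
    convexHull ℝ {o, a, b} ⊆ closure (duffy o a b '' openSquare) := by
  rw [convexHull_eq_image_duffy]
  refine subset_trans ?_ (image_closure_subset_closure_image (continuous_duffy o a b))
  rw [closure_prod_eq, closure_Ioo zero_ne_one]

/-- The closed triangle lies in the closure of the open one, so the difference is contained in the
frontier of a convex set, which is null. -/
theorem ae_eq_image_duffy (hD : cross (a - o) (b - a) ≠ 0) :
    (convexHull ℝ {o, a, b} : Set Plane) =ᵐ[volume] duffy o a b '' openSquare := by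
  refine Filter.EventuallyLE.antisymm ?_ image_duffy_subset_convexHull.eventuallyLE
  rw [ae_le_set]
  refine measure_mono_null ?_ ((convex_image_duffy hD).addHaar_frontier volume)
  rw [(isOpen_image_duffy hD).frontier_eq]
  exact Set.sdiff_subset_sdiff_left convexHull_subset_closure_image_duffy

theorem injOn_duffy (hD : cross (a - o) (b - a) ≠ 0) : Set.InjOn (duffy o a b) openSquare := by
  rintro ⟨s, t⟩ ⟨⟨hs, -⟩, -⟩ ⟨s', t'⟩ ⟨⟨hs', -⟩, -⟩ h
  have h1 := cross_duffy_left (o := o) (a := a) (b := b) (s, t)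
  have h2 := cross_duffy_right (o := o) (a := a) (b := b) (s, t)
  rw [h, cross_duffy_left] at h1
  rw [h, cross_duffy_right] at h2
  have e1 : s' = s := mul_right_cancel₀ hD h1
  have e2 : s' * t' = s * t := mul_right_cancel₀ hD h2
  subst e1
  have hs0 : s' ≠ 0 := ne_of_gt hs
  rw [mul_left_cancel₀ hs0 e2]

/-- The derivative of the Duffy map, read in coordinates. -/
def fderivDuffy (o a b : Plane) (z : ℝ × ℝ) : ℝ × ℝ →L[ℝ] ℝ × ℝ :=
  (Matrix.toLin (.finTwoProd ℝ) (.finTwoProd ℝ)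
    !![a 0 - o 0 + z.2 * (b 0 - a 0), z.1 * (b 0 - a 0);
      a 1 - o 1 + z.2 * (b 1 - a 1), z.1 * (b 1 - a 1)]).toContinuousLinearMap

theorem det_fderivDuffy (z : ℝ × ℝ) :
    (fderivDuffy o a b z).det = z.1 * cross (a - o) (b - a) := by
  unfold fderivDuffy
  simp only [LinearMap.det_toContinuousLinearMap, LinearMap.det_toLin,
    Matrix.det_fin_two_of, cross, PiLp.sub_apply]
  ring

theorem hasFDerivAt_planeEquiv_duffy (z : ℝ × ℝ) :
    HasFDerivAt (planeEquiv ∘ duffy o a b) (fderivDuffy o a b z) z := by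
  have h := fun i : Fin 2 =>
    (EuclideanSpace.proj i : Plane →L[ℝ] ℝ).hasFDerivAt.comp z (hasFDerivAt_duffy o a b z)
  unfold fderivDuffy
  rw [Matrix.toLin_finTwoProd_toContinuousLinearMap]
  refine ((h 0).prodMk (h 1)).congr_fderiv ?_
  ext <;> simp [mul_comm]

theorem setIntegral_image_planeEquiv (g : Plane → ℝ) (s : Set Plane) :
    ∫ x in s, g x = ∫ y in planeEquiv '' s, g (planeEquiv.symm y) := by
  have := measurePreserving_planeEquiv.setIntegral_image_emb planeEquiv.measurableEmbedding
    (fun y => g (planeEquiv.symm y)) s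
  simpa using this.symm

theorem integrableOn_image_planeEquiv (g : Plane → ℝ) (s : Set Plane) :
    IntegrableOn g s ↔ IntegrableOn (fun y => g (planeEquiv.symm y)) (planeEquiv '' s) := by
  have := measurePreserving_planeEquiv.integrableOn_image planeEquiv.measurableEmbedding
    (f := fun y => g (planeEquiv.symm y)) (s := s)
  rw [this]
  simp [Function.comp_def]

/-- Change of variables: the Duffy map is injective on the open square, with Jacobian determinant
`z.1` times that of the triangle, and the part of the triangle that it misses is null. -/
theorem setIntegral_triangle (hD : cross (a - o) (b - a) ≠ 0) (g : Plane → ℝ) :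
    ∫ x in convexHull ℝ {o, a, b}, g x =
      |cross (a - o) (b - a)| * ∫ z in openSquare, z.1 * g (duffy o a b z) := by
  rw [setIntegral_congr_set (ae_eq_image_duffy hD), setIntegral_image_planeEquiv, ← Set.image_comp,
    integral_image_eq_integral_abs_det_fderiv_smul volume
      (measurableSet_Ioo.prod measurableSet_Ioo)
      (fun z _ => (hasFDerivAt_planeEquiv_duffy z).hasFDerivWithinAt)
      (planeEquiv.injective.comp_injOn (injOn_duffy hD)), ← integral_const_mul]
  refine setIntegral_congr_fun (measurableSet_Ioo.prod measurableSet_Ioo) fun z hz => ?_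
  simp only [det_fderivDuffy, abs_mul, abs_of_pos hz.1.1, smul_eq_mul, Function.comp_apply,
    MeasurableEquiv.symm_apply_apply]
  ring

theorem integrableOn_triangle_iff (hD : cross (a - o) (b - a) ≠ 0) (g : Plane → ℝ) :
    IntegrableOn g (convexHull ℝ {o, a, b}) ↔
      IntegrableOn (fun z => z.1 * g (duffy o a b z)) openSquare := by
  rw [integrableOn_congr_set_ae (ae_eq_image_duffy hD), integrableOn_image_planeEquiv,
    ← Set.image_comp,
    integrableOn_image_iff_integrableOn_abs_det_fderiv_smul volume
      (measurableSet_Ioo.prod measurableSet_Ioo)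
      (fun z _ => (hasFDerivAt_planeEquiv_duffy z).hasFDerivWithinAt)
      (planeEquiv.injective.comp_injOn (injOn_duffy hD))]
  have : IntegrableOn (fun z => z.1 * g (duffy o a b z)) openSquare ↔
      IntegrableOn (fun z => |cross (a - o) (b - a)| * (z.1 * g (duffy o a b z))) openSquare :=
    (integrable_const_mul_iff (abs_ne_zero.2 hD).isUnit _).symm
  rw [this]
  refine integrableOn_congr_fun (fun z hz => ?_) (measurableSet_Ioo.prod measurableSet_Ioo)
  simp only [det_fderivDuffy, abs_mul, abs_of_pos hz.1.1, smul_eq_mul, Function.comp_apply,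
    MeasurableEquiv.symm_apply_apply]
  ring

end

/-- The divergence read off a derivative. -/
def divergence (A : Plane →L[ℝ] Plane) : ℝ :=
  A (EuclideanSpace.single 0 1) 0 + A (EuclideanSpace.single 1 1) 1

/-- The derivative of the determinant along a linear map is its trace. -/
theorem cross_add_cross_eq_divergence (A : Plane →L[ℝ] Plane) (v w : Plane) :
    cross (A v) w + cross v (A w) = divergence A * cross v w := by
  have h : ∀ v : Plane, A v = v 0 • A (EuclideanSpace.single 0 1) +
      v 1 • A (EuclideanSpace.single 1 1) := by
    intro v
    conv_lhs => rw [show v = v 0 • EuclideanSpace.single 0 1 + v 1 • EuclideanSpace.single 1 1 by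
      apply plane_ext <;> simp]
    simp only [map_add, map_smul]
  rw [h v, h w]
  simp only [cross, divergence, PiLp.add_apply, PiLp.smul_apply, smul_eq_mul]
  ring

theorem HasFDerivAt.cross {E : Type*} [NormedAddCommGroup E] [NormedSpace ℝ E]
    {f g : E → Plane} {f' g' : E →L[ℝ] Plane} {z : E}
    (hf : HasFDerivAt f f' z) (hg : HasFDerivAt g g' z) :
    ∃ L : E →L[ℝ] ℝ, HasFDerivAt (fun y => _root_.cross (f y) (g y)) L z ∧
      ∀ v, L v = _root_.cross (f' v) (g z) + _root_.cross (f z) (g' v) := by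
  have hp := fun i : Fin 2 => (EuclideanSpace.proj i : Plane →L[ℝ] ℝ).hasFDerivAt.comp z hf
  have hq := fun i : Fin 2 => (EuclideanSpace.proj i : Plane →L[ℝ] ℝ).hasFDerivAt.comp z hg
  refine ⟨_, ((hp 0).mul (hq 1)).sub ((hp 1).mul (hq 0)), fun v => ?_⟩
  simp [_root_.cross]
  ring

theorem ContinuousOn.cross {E : Type*} [TopologicalSpace E] {f g : E → Plane} {s : Set E}
    (hf : ContinuousOn f s) (hg : ContinuousOn g s) :
    ContinuousOn (fun y => _root_.cross (f y) (g y)) s := by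
  have hp := fun i : Fin 2 => (EuclideanSpace.proj i : Plane →L[ℝ] ℝ).continuous.comp_continuousOn hf
  have hq := fun i : Fin 2 => (EuclideanSpace.proj i : Plane →L[ℝ] ℝ).continuous.comp_continuousOn hg
  exact ((hp 0).mul (hq 1)).sub ((hp 1).mul (hq 0))

/-- The flux through the oriented segment from `p` to `q`, towards its right. -/
def segFlux (X : Plane → Plane) (p q : Plane) : ℝ :=
  ∫ t in (0 : ℝ)..1, cross (X (AffineMap.lineMap p q t)) (q - p)

theorem segFlux_swap (X : Plane → Plane) (p q : Plane) : segFlux X p q = - segFlux X q p := by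
  have h := intervalIntegral.integral_comp_sub_left (a := 0) (b := 1)
    (fun t => cross (X (AffineMap.lineMap p q t)) (q - p)) (1 : ℝ)
  simp only [sub_zero, sub_self, AffineMap.lineMap_apply_one_sub] at h
  unfold segFlux
  rw [← h, ← intervalIntegral.integral_neg]
  congr 1
  ext t
  simp only [cross, PiLp.sub_apply]
  ring

-- With `T` the Duffy map, the field with components `f = cross (X ∘ T) (∂₂T)` and `g = cross (∂₁T)
-- (X ∘ T)` on the square has divergence equal to the Jacobian times that of `X`: the terms with the
-- mixed derivative of `T` cancel. The divergence theorem on the square then applies. Three sides of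
-- the square become the sides of the triangle, the fourth collapses to `o`. The determinant and its
-- absolute value are both kept as factors, so that no orientation is assumed. Continuity up to the
-- boundary, differentiability inside and integrability of the divergence suffice.
set_option maxHeartbeats 1000000 in
theorem divergence_triangle {o a b : Plane} (hD : cross (a - o) (b - a) ≠ 0) {X : Plane → Plane}
    {X' : Plane → Plane →L[ℝ] Plane} (hX : ContinuousOn X (convexHull ℝ {o, a, b}))
    (hX' : ∀ x ∈ interior (convexHull ℝ {o, a, b}), HasFDerivAt X (X' x) x)
    (hi : IntegrableOn (fun x => divergence (X' x)) (convexHull ℝ {o, a, b})) :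
    cross (a - o) (b - a) * ∫ x in convexHull ℝ {o, a, b}, divergence (X' x) =
      |cross (a - o) (b - a)| * (segFlux X o a + segFlux X a b + segFlux X b o) := by
  set D := cross (a - o) (b - a) with hDdef
  have hmaps : ∀ z ∈ (Set.Icc 0 1 ×ˢ Set.Icc 0 1 : Set (ℝ × ℝ)),
      duffy o a b z ∈ convexHull ℝ {o, a, b} := fun z hz => by
    rw [convexHull_eq_image_duffy]; exact ⟨z, hz, rfl⟩
  have hXc : ContinuousOn (fun z => X (duffy o a b z)) (Set.Icc 0 1 ×ˢ Set.Icc 0 1) :=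
    hX.comp (continuous_duffy o a b).continuousOn hmaps
  let f : ℝ × ℝ → ℝ := fun z => cross (X (duffy o a b z)) (z.1 • (b - a))
  let g : ℝ × ℝ → ℝ := fun z => cross (a - o + z.2 • (b - a)) (X (duffy o a b z))
  have hXd : ∀ z ∈ openSquare, HasFDerivAt (fun z => X (duffy o a b z))
      ((X' (duffy o a b z)).comp
        ((ContinuousLinearMap.fst ℝ ℝ ℝ).smulRight (a - o + z.2 • (b - a)) +
          (ContinuousLinearMap.snd ℝ ℝ ℝ).smulRight (z.1 • (b - a)))) z := fun z hz =>
    (hX' _ (image_duffy_subset_interior hD ⟨z, hz, rfl⟩)).comp z (hasFDerivAt_duffy o a b z)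
  have h1 : ∀ z : ℝ × ℝ, HasFDerivAt (fun z : ℝ × ℝ => z.1 • (b - a))
      ((ContinuousLinearMap.fst ℝ ℝ ℝ).smulRight (b - a)) z := fun z =>
    (hasFDerivAt_fst (𝕜 := ℝ) (p := z)).smul_const (b - a)
  have h2 : ∀ z : ℝ × ℝ, HasFDerivAt (fun z : ℝ × ℝ => a - o + z.2 • (b - a))
      ((ContinuousLinearMap.snd ℝ ℝ ℝ).smulRight (b - a)) z := fun z =>
    ((hasFDerivAt_snd (𝕜 := ℝ) (p := z)).smul_const (b - a)).const_add _
  -- The membership is placed under the quantifier so that `choose` gives total functions; off the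
  -- open square the derivative is a default `0` that is never used.
  have hf : ∀ z, ∃ L : ℝ × ℝ →L[ℝ] ℝ, z ∈ openSquare → HasFDerivAt f L z ∧
      L (1, 0) = cross (X' (duffy o a b z) (a - o + z.2 • (b - a))) (z.1 • (b - a)) +
        cross (X (duffy o a b z)) (b - a) := by
    intro z
    by_cases hz : z ∈ openSquare
    · obtain ⟨L, hL, hL'⟩ := (hXd z hz).cross (h1 z)
      exact ⟨L, fun _ => ⟨hL, by rw [hL']; simp⟩⟩
    · exact ⟨0, fun h => absurd h hz⟩
  have hg : ∀ z, ∃ L : ℝ × ℝ →L[ℝ] ℝ, z ∈ openSquare → HasFDerivAt g L z ∧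
      L (0, 1) = cross (a - o + z.2 • (b - a)) (X' (duffy o a b z) (z.1 • (b - a))) -
        cross (X (duffy o a b z)) (b - a) := by
    intro z
    by_cases hz : z ∈ openSquare
    · obtain ⟨L, hL, hL'⟩ := (h2 z).cross (hXd z hz)
      refine ⟨L, fun _ => ⟨hL, ?_⟩⟩
      rw [hL']
      simp [cross]
      ring
    · exact ⟨0, fun h => absurd h hz⟩
  choose f' hf' using hf
  choose g' hg' using hg
  have hsum : ∀ z ∈ openSquare, f' z (1, 0) + g' z (0, 1) =
      D * (z.1 * divergence (X' (duffy o a b z))) := by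
    intro z hz
    rw [(hf' z hz).2, (hg' z hz).2]
    have := cross_add_cross_eq_divergence (X' (duffy o a b z)) (a - o + z.2 • (b - a))
      (z.1 • (b - a))
    rw [add_add_sub_cancel, this, hDdef]
    simp [cross]
    ring
  have hae : (Set.Icc 0 1 ×ˢ Set.Icc 0 1 : Set (ℝ × ℝ)) =ᵐ[volume] openSquare :=
    (Measure.set_prod_ae_eq Ioo_ae_eq_Icc Ioo_ae_eq_Icc).symm
  have hint : IntegrableOn (fun z => f' z (1, 0) + g' z (0, 1)) (Set.Icc 0 1 ×ˢ Set.Icc 0 1) := by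
    rw [integrableOn_congr_set_ae hae]
    refine IntegrableOn.congr_fun (((integrableOn_triangle_iff hD _).1 hi).const_mul D)
      (fun z hz => (hsum z hz).symm) (measurableSet_Ioo.prod measurableSet_Ioo)
  have key := integral2_divergence_prod_of_hasFDerivAt_off_countable f g f' g' 0 0 1 1 ∅
    Set.countable_empty
    (by
      simp only [Set.uIcc_of_le zero_le_one]
      exact hXc.cross (continuous_fst.smul continuous_const).continuousOn)
    (by
      simp only [Set.uIcc_of_le zero_le_one]
      exact ContinuousOn.cross (continuous_const.add
        (continuous_snd.smul continuous_const)).continuousOn hXc)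
    (fun z hz => (hf' z (by simpa [openSquare] using hz)).1)
    (fun z hz => (hg' z (by simpa [openSquare] using hz)).1)
    (by simpa only [Set.uIcc_of_le zero_le_one] using hint)
  have hL : ∫ (x : ℝ) in (0)..1, ∫ (y : ℝ) in (0)..1, (f' (x, y)) (1, 0) + (g' (x, y)) (0, 1) =
      D * ∫ z in openSquare, z.1 * divergence (X' (duffy o a b z)) := by
    rw [← integral_const_mul, ← setIntegral_congr_fun (measurableSet_Ioo.prod measurableSet_Ioo)
      hsum, ← setIntegral_congr_set hae, Measure.volume_eq_prod, setIntegral_prod _ hint]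
    simp only [intervalIntegral.integral_of_le zero_le_one, integral_Icc_eq_integral_Ioc]
  rw [setIntegral_triangle hD, ← mul_assoc, mul_comm D, mul_assoc, ← hL, key]
  congr 1
  have hfb : ∫ y in (0 : ℝ)..1, f (1, y) = segFlux X a b := by
    unfold segFlux
    congr 1; ext t
    simp only [f, one_smul, duffy, AffineMap.lineMap_apply_module']
    congr 2
    module
  -- The collapsed side: `∂₂T` vanishes there.
  have hfa : ∫ y in (0 : ℝ)..1, f (0, y) = 0 := by simp [f, cross]
  have hgb : ∫ x in (0 : ℝ)..1, g (x, 1) = segFlux X b o := by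
    rw [segFlux_swap]
    unfold segFlux
    rw [← intervalIntegral.integral_neg]
    congr 1; ext t
    have e1 : duffy o a b (t, 1) = AffineMap.lineMap o b t := by
      simp only [duffy, AffineMap.lineMap_apply_module']; module
    simp only [g, e1]
    simp [cross]
    ring
  have hga : ∫ x in (0 : ℝ)..1, g (x, 0) = - segFlux X o a := by
    unfold segFlux
    rw [← intervalIntegral.integral_neg]
    congr 1; ext t
    have e1 : duffy o a b (t, 0) = AffineMap.lineMap o a t := by
      simp only [duffy, AffineMap.lineMap_apply_module']; module
    simp only [g, e1]
    simp [cross]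
    ring
  rw [hfb, hfa, hgb, hga]
  ring

/-! ### The sides of the triangles of a mesh -/

namespace TriMesh

variable (M : TriMesh)

/-- The vertex opposite to a side. -/
def apex (F : M.Side) : Plane := (M.cell F.1).points F.2

/-- Twice the signed area of the triangle of a side. -/
def detSide (F : M.Side) : ℝ := cross (M.endA F - M.apex F) (M.endB F - M.endA F)

variable {M}

theorem range_points_eq (F : M.Side) :
    Set.range (M.cell F.1).points = {M.apex F, M.endA F, M.endB F} := by
  obtain ⟨K, i⟩ := F
  ext x
  simp only [Set.mem_range, Fin.exists_fin_succ, Fin.succ_zero_eq_one, Fin.succ_one_eq_two,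
    IsEmpty.exists_iff, or_false, apex, endA, endB, Set.mem_insert_iff, Set.mem_singleton_iff]
  fin_cases i <;> simp <;> grind

theorem elem_eq_convexHull (F : M.Side) :
    M.elem F.1 = convexHull ℝ {M.apex F, M.endA F, M.endB F} := by
  rw [elem, range_points_eq]

theorem endA_ne_endB (F : M.Side) : M.endA F ≠ M.endB F := by
  intro h
  have := (M.cell F.1).independent.injective h
  obtain ⟨K, i⟩ := F
  fin_cases i <;> simp at this

theorem apex_ne_endA (F : M.Side) : M.apex F ≠ M.endA F := by
  intro h
  have := (M.cell F.1).independent.injective h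
  obtain ⟨K, i⟩ := F
  fin_cases i <;> simp at this

theorem apex_ne_endB (F : M.Side) : M.apex F ≠ M.endB F := by
  intro h
  have := (M.cell F.1).independent.injective h
  obtain ⟨K, i⟩ := F
  fin_cases i <;> simp at this

theorem norm_normal (F : M.Side) : ‖M.normal F‖ = 1 := by
  have h := (M.cell F.1).height_pos F.2
  rw [normal, norm_smul, norm_inv, Real.norm_of_nonneg h.le, ← dist_eq_norm, dist_comm]
  exact inv_mul_cancel₀ h.ne'

/-- Both end points of the side are at distance one height from the apex in the normal direction.
Orthogonality of the normal to the side follows by subtraction. -/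
theorem inner_normal_of_ne {F : M.Side} {j : Fin 3} (hj : F.2 ≠ j) :
    inner ℝ (M.normal F) ((M.cell F.1).points j - M.apex F) = (M.cell F.1).height F.2 := by
  have h := (M.cell F.1).height_pos F.2
  have := (M.cell F.1).inner_vsub_vsub_altitudeFoot_eq_height_sq hj
  rw [normal, inner_smul_left, real_inner_comm, apex, ← neg_sub, ← neg_sub ((M.cell F.1).points F.2),
    inner_neg_neg]
  simp only [vsub_eq_sub] at this
  rw [this]
  simp only [map_inv₀, conj_trivial]
  field_simp

theorem inner_normal_endA (F : M.Side) :
    inner ℝ (M.normal F) (M.endA F - M.apex F) = (M.cell F.1).height F.2 := by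
  apply inner_normal_of_ne
  obtain ⟨K, i⟩ := F
  fin_cases i <;> simp

theorem inner_normal_endB (F : M.Side) :
    inner ℝ (M.normal F) (M.endB F - M.apex F) = (M.cell F.1).height F.2 := by
  apply inner_normal_of_ne
  obtain ⟨K, i⟩ := F
  fin_cases i <;> simp

theorem inner_normal_edge (F : M.Side) : inner ℝ (M.normal F) (M.endB F - M.endA F) = 0 := by
  have : M.endB F - M.endA F = (M.endB F - M.apex F) - (M.endA F - M.apex F) := by abel
  rw [this, inner_sub_right, inner_normal_endA, inner_normal_endB, sub_self]

/-- Being orthogonal to the side, the normal is a multiple `k` of the side vector turned by a right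
angle. Unit length fixes `|k|`, and pointing away from the apex gives `k` the sign of the
determinant. -/
theorem exists_normal_eq (F : M.Side) : ∃ k : ℝ, M.normal F 0 = k * (M.endB F - M.endA F) 1 ∧
    M.normal F 1 = - k * (M.endB F - M.endA F) 0 ∧ 0 < k * M.detSide F ∧
    |k| * dist (M.endA F) (M.endB F) = 1 := by
  have h0 := inner_normal_edge F
  have h1 := inner_normal_endA F
  have h2 := (M.cell F.1).height_pos F.2
  have h3 := norm_normal F
  have h4 : M.endB F - M.endA F ≠ 0 := sub_ne_zero.2 (endA_ne_endB F).symm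
  rw [dist_comm, dist_eq_norm]
  rw [← h1] at h2
  clear h1
  unfold detSide
  generalize M.endB F - M.endA F = f at *
  generalize M.endA F - M.apex F = e at *
  generalize M.normal F = n at *
  simp only [PiLp.inner_apply, Fin.sum_univ_two, RCLike.inner_apply, conj_trivial] at h0 h2
  have hf : 0 < f 0 ^ 2 + f 1 ^ 2 := by
    have : 0 < ‖f‖ ^ 2 := by positivity
    rwa [EuclideanSpace.norm_sq_eq, Fin.sum_univ_two, Real.norm_eq_abs, Real.norm_eq_abs, sq_abs,
      sq_abs] at this
  have hn : n 0 ^ 2 + n 1 ^ 2 = 1 := by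
    have : ‖n‖ ^ 2 = 1 := by rw [h3]; norm_num
    rwa [EuclideanSpace.norm_sq_eq, Fin.sum_univ_two, Real.norm_eq_abs, Real.norm_eq_abs, sq_abs,
      sq_abs] at this
  set k := (n 0 * f 1 - n 1 * f 0) / (f 0 ^ 2 + f 1 ^ 2) with hk
  have hk' : k * (f 0 ^ 2 + f 1 ^ 2) = n 0 * f 1 - n 1 * f 0 := div_mul_cancel₀ _ hf.ne'
  clear_value k
  have e0 : n 0 = k * f 1 := by
    apply mul_right_cancel₀ hf.ne'
    linear_combination f 0 * h0 - f 1 * hk'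
  have e1 : n 1 = - k * f 0 := by
    apply mul_right_cancel₀ hf.ne'
    linear_combination f 1 * h0 + f 0 * hk'
  refine ⟨k, e0, e1, ?_, ?_⟩
  · rw [e0, e1] at h2
    simp only [cross]
    linarith
  · have hs : (|k| * ‖f‖) ^ 2 = 1 := by
      rw [mul_pow, sq_abs, EuclideanSpace.norm_sq_eq, Fin.sum_univ_two, Real.norm_eq_abs,
        Real.norm_eq_abs, sq_abs, sq_abs]
      rw [e0, e1] at hn
      linarith
    have hp : 0 ≤ |k| * ‖f‖ := by positivity
    nlinarith

theorem detSide_ne_zero (F : M.Side) : M.detSide F ≠ 0 := by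
  obtain ⟨k, -, -, h, -⟩ := exists_normal_eq F
  exact right_ne_zero_of_mul h.ne'

theorem detSide_eq (K : Fin M.numCells) (i : Fin 3) : M.detSide (K, i) = M.detSide (K, 0) := by
  simp only [detSide, cross, endA, endB, apex, PiLp.sub_apply]
  fin_cases i <;> simp <;> ring

/-- Links the geometric flux `X · n` with the oriented flux of `segFlux`; the factors `detSide` and
its absolute value encode the orientation of the triangle without a case distinction. -/
theorem detSide_mul_inner_normal (F : M.Side) (X : Plane) :
    M.detSide F * (dist (M.endA F) (M.endB F) * inner ℝ X (M.normal F)) =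
      |M.detSide F| * cross X (M.endB F - M.endA F) := by
  obtain ⟨k, h0, h1, h2, h3⟩ := exists_normal_eq F
  have e : inner ℝ X (M.normal F) = k * cross X (M.endB F - M.endA F) := by
    simp only [PiLp.inner_apply, Fin.sum_univ_two, RCLike.inner_apply, conj_trivial, h0, h1, cross]
    ring
  have e2 : M.detSide F * k = |M.detSide F| * |k| := by
    rw [← abs_mul, mul_comm (M.detSide F), abs_of_pos h2]
  rw [e]
  calc _ = M.detSide F * k * (dist (M.endA F) (M.endB F) * cross X (M.endB F - M.endA F)) := by ring
    _ = |M.detSide F| * (|k| * dist (M.endA F) (M.endB F)) * cross X (M.endB F - M.endA F) := by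
      rw [e2]; ring
    _ = _ := by rw [h3, mul_one]

/-! ### Arc length -/

theorem measurableEmbedding_lineMap {p q : Plane} (h : p ≠ q) :
    MeasurableEmbedding (fun t : ℝ => (AffineMap.lineMap p q t : Plane)) := by
  have hc : Continuous (fun t : ℝ => (AffineMap.lineMap p q t : Plane)) :=
    AffineMap.lineMap_continuous
  exact hc.measurableEmbedding (AffineMap.lineMap_injective ℝ h)

theorem integral_arc (F : M.Side) (g : Plane → ℝ) :
    ∫ x, g x ∂(M.arc F) = dist (M.endA F) (M.endB F) *
      ∫ t in (0 : ℝ)..1, g (AffineMap.lineMap (M.endA F) (M.endB F) t) := by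
  rw [arc, integral_smul_measure, ENNReal.toReal_ofReal dist_nonneg,
    (measurableEmbedding_lineMap (endA_ne_endB F)).integral_map, smul_eq_mul,
    intervalIntegral.integral_of_le zero_le_one, integral_Icc_eq_integral_Ioc]

instance (F : M.Side) : IsFiniteMeasure (M.arc F) := by
  exact Measure.smul_finite _ ENNReal.ofReal_ne_top

theorem segment_subset_elem (F : M.Side) : segment ℝ (M.endA F) (M.endB F) ⊆ M.elem F.1 := by
  rw [elem_eq_convexHull, ← convexHull_pair]
  exact convexHull_mono (by simp)

theorem ae_arc_mem_segment (F : M.Side) :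
    ∀ᵐ x ∂(M.arc F), x ∈ segment ℝ (M.endA F) (M.endB F) := by
  have hc := measurableEmbedding_lineMap (endA_ne_endB F)
  rw [arc]
  refine Measure.ae_smul_measure ?_ _
  rw [hc.ae_map_iff]
  filter_upwards [ae_restrict_mem measurableSet_Icc] with t ht
  rw [segment_eq_image_lineMap]
  exact ⟨t, ht, rfl⟩

theorem isCompact_segment (p q : Plane) : IsCompact (segment ℝ p q) := by
  rw [segment_eq_image_lineMap]
  exact isCompact_Icc.image AffineMap.lineMap_continuous

theorem arc_restrict_segment (F : M.Side) :
    (M.arc F).restrict (segment ℝ (M.endA F) (M.endB F)) = M.arc F :=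
  Measure.restrict_eq_self_of_ae_mem (ae_arc_mem_segment F)

theorem integrable_arc_of_continuousOn {F : M.Side} {g : Plane → ℝ}
    (hg : ContinuousOn g (segment ℝ (M.endA F) (M.endB F))) : Integrable g (M.arc F) := by
  rw [← arc_restrict_segment]
  exact hg.integrableOn_compact (isCompact_segment _ _)

theorem integral_inner_normal_arc (F : M.Side) (X : Plane → Plane) :
    M.detSide F * ∫ x, inner ℝ (X x) (M.normal F) ∂(M.arc F) =
      |M.detSide F| * segFlux X (M.endA F) (M.endB F) := by
  rw [integral_arc, segFlux, ← intervalIntegral.integral_const_mul,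
    ← intervalIntegral.integral_const_mul, ← intervalIntegral.integral_const_mul]
  congr 1
  ext t
  exact detSide_mul_inner_normal F _

/-! ### The divergence theorem on a cell -/

/-- The three sides of a cell have the same signed determinant, so it can be cancelled from the
oriented identity. -/
theorem divergence_elem (K : Fin M.numCells) {X : Plane → Plane} {X' : Plane → Plane →L[ℝ] Plane}
    (hX : ContinuousOn X (M.elem K)) (hX' : ∀ x ∈ interior (M.elem K), HasFDerivAt X (X' x) x)
    (hi : IntegrableOn (fun x => divergence (X' x)) (M.elem K)) :
    ∫ x in M.elem K, divergence (X' x) =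
      ∑ i, ∫ x, inner ℝ (X x) (M.normal (K, i)) ∂(M.arc (K, i)) := by
  have hD := detSide_ne_zero ((K, 0) : M.Side)
  have he := elem_eq_convexHull ((K, 0) : M.Side)
  simp only at he
  rw [he] at hX hX' hi
  have h := divergence_triangle hD hX hX' hi
  rw [← he] at h
  refine mul_left_cancel₀ hD (h.trans ?_)
  rw [Finset.mul_sum, Finset.sum_congr rfl fun i _ => by
    rw [← detSide_eq K i, integral_inner_normal_arc, detSide_eq], ← Finset.mul_sum,
    Fin.sum_univ_three]
  congr 1
  simp only [endA, endB, apex, zero_add]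
  have e1 : (1 : Fin 3) + 1 = 2 := rfl
  have e2 : (1 : Fin 3) + 2 = 0 := rfl
  have e3 : (2 : Fin 3) + 1 = 0 := rfl
  have e4 : (2 : Fin 3) + 2 = 1 := rfl
  rw [e1, e2, e3, e4]
  ring

theorem convex_elem (K : Fin M.numCells) : Convex ℝ (M.elem K) := convex_convexHull _ _

theorem isCompact_elem (K : Fin M.numCells) : IsCompact (M.elem K) :=
  (Set.finite_range _).isCompact_convexHull ℝ

theorem interior_elem_nonempty (K : Fin M.numCells) : (interior (M.elem K)).Nonempty := by
  have h := image_duffy_subset_interior (detSide_ne_zero ((K, 0) : M.Side))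
  rw [← elem_eq_convexHull ((K, 0) : M.Side)] at h
  exact ⟨_, h ⟨(1 / 2, 1 / 2), by norm_num, rfl⟩⟩

theorem uniqueDiffOn_elem (K : Fin M.numCells) : UniqueDiffOn ℝ (M.elem K) :=
  uniqueDiffOn_convex (convex_elem K) (interior_elem_nonempty K)

theorem isCompact_region : IsCompact M.region := isCompact_iUnion isCompact_elem

theorem elem_subset_region (K : Fin M.numCells) : M.elem K ⊆ M.region := Set.subset_iUnion _ K

theorem uniqueDiffOn_region : UniqueDiffOn ℝ M.region := by
  intro x hx
  obtain ⟨K, hK⟩ := Set.mem_iUnion.1 hx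
  exact (uniqueDiffOn_elem K x hK).mono (elem_subset_region K)

end TriMesh

/-! ### Interior sides cancel -/

/-- In the plane the orthogonal complement of a nonzero vector is a line. -/
theorem exists_eq_smul_of_inner_eq_zero {n f w : Plane} (hn : n ≠ 0) (hf : f ≠ 0)
    (h1 : inner ℝ n f = 0) (h2 : inner ℝ n w = 0) : ∃ t : ℝ, w = t • f := by
  simp only [PiLp.inner_apply, Fin.sum_univ_two, RCLike.inner_apply, conj_trivial] at h1 h2
  have hf' : 0 < f 0 ^ 2 + f 1 ^ 2 := by
    have : 0 < ‖f‖ ^ 2 := by positivity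
    rwa [EuclideanSpace.norm_sq_eq, Fin.sum_univ_two, Real.norm_eq_abs, Real.norm_eq_abs, sq_abs,
      sq_abs] at this
  have hc : f 0 * w 1 - f 1 * w 0 = 0 := by
    by_contra hc
    refine hn (plane_ext ?_ ?_)
    · apply mul_right_cancel₀ hc
      simp only [PiLp.zero_apply]
      linear_combination w 1 * h1 - f 1 * h2
    · apply mul_right_cancel₀ hc
      simp only [PiLp.zero_apply]
      linear_combination f 0 * h2 - w 0 * h1
  refine ⟨(w 0 * f 0 + w 1 * f 1) / (f 0 ^ 2 + f 1 ^ 2), plane_ext ?_ ?_⟩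
  · simp only [PiLp.smul_apply, smul_eq_mul]
    field_simp
    linear_combination - f 1 * hc
  · simp only [PiLp.smul_apply, smul_eq_mul]
    field_simp
    linear_combination f 0 * hc

theorem combination_mem_convexHull {o a b : Plane} {p q r : ℝ} (hp : 0 ≤ p) (hq : 0 ≤ q)
    (hr : 0 ≤ r) (h : p + q + r = 1) : p • o + q • a + r • b ∈ convexHull ℝ {o, a, b} := by
  have := (convex_convexHull ℝ ({o, a, b} : Set Plane)).sum_mem (t := Finset.univ)
    (w := ![p, q, r]) (z := ![o, a, b]) (by intro i _; fin_cases i <;> simpa)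
    (by simpa [Fin.sum_univ_three] using h)
    (by intro i _; apply subset_convexHull; fin_cases i <;> simp)
  simpa [Fin.sum_univ_three] using this

namespace TriMesh

variable {M : TriMesh}

/-- The two end points of a side. -/
def ends (F : M.Side) : Set Plane := {M.endA F, M.endB F}

theorem mem_bdry_iff (F : M.Side) :
    F ∈ M.bdry ↔ ∀ L, L ≠ F.1 → ¬ ends F ⊆ Set.range (M.cell L).points := by
  simp [bdry, ends]

theorem exists_side_ends_eq {F : M.Side} {L : Fin M.numCells}
    (h : ends F ⊆ Set.range (M.cell L).points) : ∃ j : Fin 3, ends (M := M) (L, j) = ends F := by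
  obtain ⟨i, hi⟩ := h (show M.endA F ∈ ends F by simp [ends])
  obtain ⟨j, hj⟩ := h (show M.endB F ∈ ends F by simp [ends])
  have hij : i ≠ j := by
    rintro rfl
    exact endA_ne_endB F (hi.symm.trans hj)
  have : ∃ k : Fin 3, (k + 1 = i ∧ k + 2 = j) ∨ (k + 1 = j ∧ k + 2 = i) := by
    revert hij; clear hi hj; revert i j; decide
  obtain ⟨k, ⟨h1, h2⟩ | ⟨h1, h2⟩⟩ := this
  · exact ⟨k, by simp only [ends, endA, endB, h1, h2] at *; rw [hi, hj]⟩
  · exact ⟨k, by simp only [ends, endA, endB, h1, h2] at *; rw [hi, hj, Set.pair_comm]⟩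

theorem apex_notMem_ends (F : M.Side) : M.apex F ∉ ends F := by
  simp [ends, apex_ne_endA, apex_ne_endB]

theorem mem_ends_of_ne {K : Fin M.numCells} {i j : Fin 3} (h : i ≠ j) :
    (M.cell K).points i ∈ ends (M := M) (K, j) := by
  simp only [ends, endA, endB]
  have : i = j + 1 ∨ i = j + 2 := by revert i j; decide
  rcases this with rfl | rfl <;> simp

theorem eq_of_ends_eq {F F' : M.Side} (h1 : F.1 = F'.1) (h2 : ends F = ends F') : F = F' := by
  obtain ⟨K, i⟩ := F
  obtain ⟨L, j⟩ := F'
  obtain rfl : K = L := h1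
  by_contra hne
  have hij : i ≠ j := by rintro rfl; exact hne rfl
  exact apex_notMem_ends (M := M) (K, i) (h2 ▸ mem_ends_of_ne hij)

theorem ends_cases {F F' : M.Side} (h : ends F = ends F') :
    (M.endA F = M.endA F' ∧ M.endB F = M.endB F') ∨
      (M.endA F = M.endB F' ∧ M.endB F = M.endA F') := by
  simpa [ends, Set.pair_eq_pair_iff] using h

/-- If the two apexes coincided, the triangles would have the same vertices, which the mesh
excludes. -/
theorem common_vertices_subset_ends {F F' : M.Side} (h1 : F.1 ≠ F'.1) (h2 : ends F = ends F') :
    Set.range (M.cell F.1).points ∩ Set.range (M.cell F'.1).points ⊆ ends F := by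
  rintro x ⟨hx, hx'⟩
  have hr : Set.range (M.cell F.1).points = insert (M.apex F) (ends F) := range_points_eq F
  have hr' : Set.range (M.cell F'.1).points = insert (M.apex F') (ends F') := range_points_eq F'
  rw [hr] at hx
  rw [hr'] at hx'
  rcases hx with rfl | hx
  · rcases hx' with hx' | hx'
    · exact absurd (M.distinct (by simp only [hr, hr', hx', h2])) h1
    · exact h2 ▸ hx'
  · exact hx

theorem inner_normal_of_mem_segment {F : M.Side} {x : Plane}
    (hx : x ∈ segment ℝ (M.endA F) (M.endB F)) : inner ℝ (M.normal F) (x - M.endA F) = 0 := by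
  rw [segment_eq_image'] at hx
  obtain ⟨t, -, rfl⟩ := hx
  simp only
  rw [add_sub_cancel_left, inner_smul_right, inner_normal_edge, mul_zero]

theorem inter_elem_subset_segment {F F' : M.Side} (h1 : F.1 ≠ F'.1) (h2 : ends F = ends F') :
    M.elem F.1 ∩ M.elem F'.1 ⊆ segment ℝ (M.endA F) (M.endB F) := by
  refine (M.conforming _ _ h1).trans ?_
  rw [← convexHull_pair]
  exact convexHull_mono (common_vertices_subset_ends h1 h2)

/-- Two triangles with a common side lie on opposite sides of it. -/
theorem normal_eq_neg {F F' : M.Side} (h1 : F.1 ≠ F'.1) (h2 : ends F = ends F') :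
    M.normal F' = - M.normal F := by
  have hn := norm_normal F
  have hn' := norm_normal F'
  have hf : M.endB F - M.endA F ≠ 0 := sub_ne_zero.2 (endA_ne_endB F).symm
  have ho := inner_normal_edge F
  have hA : inner ℝ (M.normal F') (M.endA F - M.apex F') = (M.cell F'.1).height F'.2 := by
    rcases ends_cases h2 with ⟨h, -⟩ | ⟨h, -⟩
    · rw [h, inner_normal_endA]
    · rw [h, inner_normal_endB]
  have ho' : inner ℝ (M.normal F') (M.endB F - M.endA F) = 0 := by
    have : inner ℝ (M.normal F') (M.endB F - M.apex F') = (M.cell F'.1).height F'.2 := by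
      rcases ends_cases h2 with ⟨-, h⟩ | ⟨-, h⟩
      · rw [h, inner_normal_endB]
      · rw [h, inner_normal_endA]
    rw [← sub_sub_sub_cancel_right _ _ (M.apex F'), inner_sub_right, this, hA, sub_self]
  have hn0 : M.normal F ≠ 0 := by rw [← norm_ne_zero_iff, hn]; exact one_ne_zero
  -- Two unit vectors orthogonal to the same side agree up to sign; only equality has to be
  -- excluded.
  obtain ⟨t, ht⟩ := exists_eq_smul_of_inner_eq_zero hf hn0
    (by rwa [real_inner_comm]) (by rwa [real_inner_comm])
  have ht1 : |t| = 1 := by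
    rw [ht, norm_smul, hn, mul_one] at hn'
    exact hn'
  rcases eq_or_eq_neg_of_abs_eq ht1 with rfl | rfl
  swap
  · simpa using ht
  -- With equal normals both apexes lie on the same side of the common line. A point close to the
  -- middle of the common side, but off it, then belongs to both triangles, against conformity.
  exfalso
  rw [one_smul] at ht
  rw [ht] at hA
  have hB := inner_normal_endA F
  have hpos := (M.cell F.1).height_pos F.2
  have hpos' := (M.cell F'.1).height_pos F'.2
  set h := (M.cell F.1).height F.2
  set h' := (M.cell F'.1).height F'.2
  set s := h' / h with hs
  have hs0 : 0 < s := by positivity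
  have hsh : s * h = h' := by rw [hs]; field_simp
  -- After scaling by the ratio `s` of the heights, the two apexes differ by a multiple `t` of the
  -- side vector.
  obtain ⟨t, htt⟩ := exists_eq_smul_of_inner_eq_zero hn0 hf ho
    (show inner ℝ (M.normal F) ((M.apex F' - M.endA F) - s • (M.apex F - M.endA F)) = 0 by
      rw [inner_sub_right, inner_smul_right, ← neg_sub (M.endA F), ← neg_sub (M.endA F) (M.apex F),
        inner_neg_right, inner_neg_right, hA, hB]
      linarith)
  have habs : 0 ≤ |t| := abs_nonneg t
  -- Small enough for all barycentric coordinates of the common point, in both triangles, to be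
  -- nonnegative.
  set r := 1 / (2 * (1 + |t| + s)) with hr
  have hr0 : 0 < r := by positivity
  have hr1 : r * (1 + |t| + s) = 1 / 2 := by rw [hr]; field_simp
  have ht1 : r * t ≤ r * |t| := by gcongr; exact le_abs_self t
  have ht2 : - (r * t) ≤ r * |t| := by rw [← mul_neg]; gcongr; exact neg_le_abs t
  have hrs : 0 < r * s := by positivity
  have hrt : 0 ≤ r * |t| := by positivity
  have e1 : (r * s) • M.apex F + (1 / 2 - r * s) • M.endA F + (1 / 2 : ℝ) • M.endB F ∈
      M.elem F.1 := by
    rw [elem_eq_convexHull]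
    exact combination_mem_convexHull hrs.le (by nlinarith) (by norm_num) (by ring)
  have e2 : r • M.apex F' + (1 / 2 - r + r * t) • M.endA F + (1 / 2 - r * t) • M.endB F ∈
      M.elem F'.1 := by
    have : M.elem F'.1 = convexHull ℝ {M.apex F', M.endA F, M.endB F} := by
      rw [elem_eq_convexHull]
      congr 2
      exact h2.symm
    rw [this]
    exact combination_mem_convexHull hr0.le (by nlinarith) (by nlinarith) (by ring)
  have e3 : r • M.apex F' + (1 / 2 - r + r * t) • M.endA F + (1 / 2 - r * t) • M.endB F =
      (r * s) • M.apex F + (1 / 2 - r * s) • M.endA F + (1 / 2 : ℝ) • M.endB F := by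
    have : M.apex F' = M.endA F + s • (M.apex F - M.endA F) + t • (M.endB F - M.endA F) := by
      rw [← htt]; abel
    rw [this]
    module
  rw [e3] at e2
  -- Conformity puts the common point on the side, yet its distance to the line of the side is `r *
  -- s * h > 0`.
  have e4 := inner_normal_of_mem_segment (inter_elem_subset_segment h1 h2 ⟨e1, e2⟩)
  have e5 : (r * s) • M.apex F + (1 / 2 - r * s) • M.endA F + (1 / 2 : ℝ) • M.endB F - M.endA F =
      (1 / 2 : ℝ) • (M.endB F - M.endA F) - (r * s) • (M.endA F - M.apex F) := by module
  rw [e5, inner_sub_right, inner_smul_right, inner_smul_right, ho, hB] at e4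
  have : 0 < r * s * h := by positivity
  linarith

/-- A side has at most one neighbour across it: three distinct triangles on one side would have
pairwise opposite unit normals. -/
theorem eq_of_ends_eq_of_ne {F F' F'' : M.Side} (h1 : F.1 ≠ F'.1) (h2 : ends F = ends F')
    (h3 : F'.1 ≠ F''.1) (h4 : ends F' = ends F'') : F'' = F := by
  by_contra hne
  have h5 : F.1 ≠ F''.1 := fun h => hne (eq_of_ends_eq h (h2.trans h4)).symm
  have e1 := normal_eq_neg h1 h2
  have e2 := normal_eq_neg h3 h4
  have e3 := normal_eq_neg h5 (h2.trans h4)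
  rw [e2, e1, neg_neg] at e3
  have h := congrArg (fun y => inner ℝ y (M.normal F)) e3
  simp only [inner_neg_left, real_inner_self_eq_norm_sq, norm_normal] at h
  norm_num at h

/-- A quantity on the sides which cancels on the sides common to two triangles. -/
theorem sum_sides_eq_sum_bdry (φ : M.Side → ℝ)
    (h : ∀ F F' : M.Side, F.1 ≠ F'.1 → ends F = ends F' → φ F + φ F' = 0) :
    ∑ F, φ F = ∑ F ∈ M.bdry, φ F := by
  classical
  rw [← Finset.sum_add_sum_compl M.bdry φ, add_eq_left]
  have hex : ∀ F ∈ M.bdryᶜ, ∃ F' : M.Side, F.1 ≠ F'.1 ∧ ends F = ends F' := by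
    intro F hF
    rw [Finset.mem_compl, mem_bdry_iff] at hF
    push Not at hF
    obtain ⟨L, hL, hF⟩ := hF
    obtain ⟨j, hj⟩ := exists_side_ends_eq hF
    exact ⟨(L, j), hL.symm, hj.symm⟩
  choose! g hg1 hg2 using hex
  have hmem : ∀ F ∈ M.bdryᶜ, g F ∈ M.bdryᶜ := by
    intro F hF
    rw [Finset.mem_compl, mem_bdry_iff]
    intro hc
    refine hc F.1 (hg1 F hF) ?_
    rw [← hg2 F hF, range_points_eq]
    exact Set.subset_insert _ _
  -- Each interior side is paired with its twin in the neighbouring triangle. Uniqueness of the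
  -- neighbour makes the pairing an involution, and it changes the triangle, so it has no fixed
  -- point.
  refine Finset.sum_involution (fun F _ => g F) (fun F hF => h _ _ (hg1 F hF) (hg2 F hF))
    (fun F hF _ hc => hg1 F hF (by rw [hc])) hmem fun F hF => ?_
  exact eq_of_ends_eq_of_ne (hg1 F hF) (hg2 F hF) (hg1 _ (hmem F hF)) (hg2 _ (hmem F hF))

theorem integral_arc_congr {F F' : M.Side} (h : ends F = ends F') (g : Plane → ℝ) :
    ∫ x, g x ∂(M.arc F) = ∫ x, g x ∂(M.arc F') := by
  rw [integral_arc, integral_arc]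
  rcases ends_cases h with ⟨h1, h2⟩ | ⟨h1, h2⟩
  · rw [h1, h2]
  · rw [h1, h2, dist_comm]
    congr 1
    have := intervalIntegral.integral_comp_sub_left (a := 0) (b := 1)
      (fun t => g (AffineMap.lineMap (M.endA F') (M.endB F') t)) (1 : ℝ)
    simpa only [sub_zero, sub_self, AffineMap.lineMap_apply_one_sub] using this

/-- The divergence theorem on the meshed region. -/
theorem divergence_region {X : Plane → Plane} (hX : ContinuousOn X M.region)
    (hd : ∀ K, ∀ x ∈ interior (M.elem K), DifferentiableAt ℝ X x)
    (hi : ∀ K, IntegrableOn (fun x => divergence (fderiv ℝ X x)) (M.elem K)) :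
    ∑ K, ∫ x in M.elem K, divergence (fderiv ℝ X x) =
      ∑ F ∈ M.bdry, ∫ x, inner ℝ (X x) (M.normal F) ∂(M.arc F) := by
  rw [Finset.sum_congr rfl fun K _ => divergence_elem K (hX.mono (elem_subset_region K))
    (fun x hx => (hd K x hx).hasFDerivAt) (hi K), ← Fintype.sum_prod_type',
    ← sum_sides_eq_sum_bdry fun F => ∫ x, inner ℝ (X x) (M.normal F) ∂(M.arc F)]
  intro F F' h1 h2
  rw [integral_arc_congr h2, normal_eq_neg h1 h2]
  simp only [inner_neg_right, integral_neg, add_neg_cancel]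

/-! ### Integrals over the region -/

/-- The line through the side is a proper affine subspace, since it misses the apex. -/
theorem volume_segment (F : M.Side) : volume (segment ℝ (M.endA F) (M.endB F)) = 0 := by
  let S : AffineSubspace ℝ Plane :=
    AffineSubspace.mk' (M.endA F) (LinearMap.ker (innerSL ℝ (M.normal F)).toLinearMap)
  refine measure_mono_null (t := (S : Set Plane)) (fun x hx => ?_)
    (Measure.addHaar_affineSubspace volume S fun h => ?_)
  · simpa [S, AffineSubspace.mem_mk'] using inner_normal_of_mem_segment hx
  · have : M.apex F ∈ S := by rw [h]; trivial
    simp only [S, AffineSubspace.mem_mk', vsub_eq_sub, LinearMap.mem_ker,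
      ContinuousLinearMap.coe_coe, innerSL_apply_apply] at this
    rw [← neg_sub, inner_neg_right, inner_normal_endA] at this
    have hpos := (M.cell F.1).height_pos F.2
    linarith

/-- Some vertex of `K` is not a vertex of `L`, so all common vertices lie on the side of `K`
opposite to it. By conformity the intersection lies in that side, a null set. -/
theorem aedisjoint_elem {K L : Fin M.numCells} (h : K ≠ L) :
    AEDisjoint volume (M.elem K) (M.elem L) := by
  have hex : ∃ i, (M.cell K).points i ∉ Set.range (M.cell L).points := by
    by_contra hc
    push Not at hc
    have hsub : Set.range (M.cell K).points ⊆ Set.range (M.cell L).points := by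
      rintro _ ⟨i, rfl⟩; exact hc i
    refine h (M.distinct (Set.eq_of_subset_of_ncard_le hsub ?_ (Set.finite_range _)))
    rw [Set.ncard_range_of_injective (M.cell K).independent.injective,
      Set.ncard_range_of_injective (M.cell L).independent.injective]
  obtain ⟨i, hi⟩ := hex
  refine measure_mono_null ((M.conforming K L h).trans ?_) (volume_segment (M := M) (K, i))
  rw [← convexHull_pair]
  refine convexHull_mono ?_
  rintro x ⟨⟨j, rfl⟩, hx⟩
  exact mem_ends_of_ne (fun hj => hi (hj ▸ hx))

theorem setIntegral_region {g : Plane → ℝ} (hg : ∀ K, IntegrableOn g (M.elem K)) :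
    ∫ x in M.region, g x = ∑ K, ∫ x in M.elem K, g x := by
  have h : IntegrableOn g (⋃ K, M.elem K) := by
    rwa [integrableOn_finite_iUnion]
  rw [region, integral_iUnion_ae (fun K => (isCompact_elem K).measurableSet.nullMeasurableSet)
    (fun K L h => aedisjoint_elem h) h, tsum_fintype]

end TriMesh

/-! ### The finite element space -/

theorem gradientWithin_eq_of_hasFDerivWithinAt {v : Plane → ℝ} {s : Set Plane} {x g : Plane}
    (h : HasFDerivWithinAt v (innerSL ℝ g) s x) (hs : UniqueDiffWithinAt ℝ s x) :
    gradientWithin v s x = g := by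
  rw [gradientWithin, h.fderivWithin hs, LinearIsometryEquiv.symm_apply_eq]
  ext w
  simp

namespace TriMesh

variable {M : TriMesh} {P : ℕ} {u v w : Plane → ℝ}

/-- Derivatives within a triangle are unique up to its boundary, so the one-sided gradient is that
of the polynomial on the whole closed cell. -/
theorem exists_polynomial (hv : v ∈ M.feSpace P) (K : Fin M.numCells) :
    ∃ p : MvPolynomial (Fin 2) ℝ, p.totalDegree ≤ P ∧ (∀ x ∈ M.elem K, v x = p.planeEval x) ∧
      ∀ x ∈ M.elem K, M.grad K v x = p.planeGrad x := by
  obtain ⟨p, hp, hpv⟩ := hv.2.1 K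
  refine ⟨p, hp, hpv, fun x hx => ?_⟩
  refine gradientWithin_eq_of_hasFDerivWithinAt ?_ (uniqueDiffOn_elem K x hx)
  exact (p.hasFDerivAt_planeEval x).hasFDerivWithinAt.congr hpv (hpv x hx)

theorem continuousOn_elem (hv : v ∈ M.feSpace P) (K : Fin M.numCells) :
    ContinuousOn v (M.elem K) := hv.1.mono (elem_subset_region K)

theorem continuousOn_side (hv : v ∈ M.feSpace P) (F : M.Side) :
    ContinuousOn v (segment ℝ (M.endA F) (M.endB F)) :=
  (continuousOn_elem hv F.1).mono (segment_subset_elem F)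

theorem continuousOn_grad (hv : v ∈ M.feSpace P) (K : Fin M.numCells) :
    ContinuousOn (M.grad K v) (M.elem K) := by
  obtain ⟨p, -, -, hp⟩ := exists_polynomial hv K
  exact p.continuous_planeGrad.continuousOn.congr hp

theorem grad_add (hu : u ∈ M.feSpace P) (hv : v ∈ M.feSpace P) {K : Fin M.numCells} {x : Plane}
    (hx : x ∈ M.elem K) : M.grad K (u + v) x = M.grad K u x + M.grad K v x := by
  obtain ⟨p, -, h1, h2⟩ := exists_polynomial hu K
  obtain ⟨q, -, h3, h4⟩ := exists_polynomial hv K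
  rw [h2 x hx, h4 x hx]
  refine gradientWithin_eq_of_hasFDerivWithinAt ?_ (uniqueDiffOn_elem K x hx)
  rw [map_add]
  exact ((p.hasFDerivAt_planeEval x).hasFDerivWithinAt.congr h1 (h1 x hx)).add
    ((q.hasFDerivAt_planeEval x).hasFDerivWithinAt.congr h3 (h3 x hx))

theorem grad_smul (c : ℝ) (hu : u ∈ M.feSpace P) {K : Fin M.numCells} {x : Plane}
    (hx : x ∈ M.elem K) : M.grad K (c • u) x = c • M.grad K u x := by
  obtain ⟨p, -, h1, h2⟩ := exists_polynomial hu K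
  rw [h2 x hx]
  refine gradientWithin_eq_of_hasFDerivWithinAt ?_ (uniqueDiffOn_elem K x hx)
  rw [map_smul]
  exact ((p.hasFDerivAt_planeEval x).hasFDerivWithinAt.congr h1 (h1 x hx)).const_smul c

theorem mem_elem_of_mem_segment {F : M.Side} {x : Plane}
    (hx : x ∈ segment ℝ (M.endA F) (M.endB F)) : x ∈ M.elem F.1 := segment_subset_elem F hx

theorem normalDeriv_add (hu : u ∈ M.feSpace P) (hv : v ∈ M.feSpace P) {F : M.Side} {x : Plane}
    (hx : x ∈ segment ℝ (M.endA F) (M.endB F)) :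
    M.normalDeriv (u + v) F x = M.normalDeriv u F x + M.normalDeriv v F x := by
  rw [normalDeriv, grad_add hu hv (mem_elem_of_mem_segment hx), inner_add_left]; rfl

theorem normalDeriv_smul (c : ℝ) (hu : u ∈ M.feSpace P) {F : M.Side} {x : Plane}
    (hx : x ∈ segment ℝ (M.endA F) (M.endB F)) :
    M.normalDeriv (c • u) F x = c * M.normalDeriv u F x := by
  rw [normalDeriv, grad_smul c hu (mem_elem_of_mem_segment hx), real_inner_smul_left]; rfl

/-! ### Linearity of the forms -/

/-- Boundary data integrable on every side. -/
def BdryIntegrable (M : TriMesh) (g : M.Side → Plane → ℝ) : Prop :=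
  ∀ F ∈ M.bdry, Integrable (g F) (M.arc F)

theorem BdryIntegrable.sub {g g' : M.Side → Plane → ℝ} (h : M.BdryIntegrable g)
    (h' : M.BdryIntegrable g') : M.BdryIntegrable fun F x => g F x - g' F x :=
  fun F hF => (h F hF).sub (h' F hF)

theorem bdryIntegrable_trace (hv : v ∈ M.feSpace P) : M.BdryIntegrable fun _ => v :=
  fun F _ => integrable_arc_of_continuousOn (continuousOn_side hv F)

theorem continuousOn_normalDeriv (hv : v ∈ M.feSpace P) (F : M.Side) :
    ContinuousOn (M.normalDeriv v F) (segment ℝ (M.endA F) (M.endB F)) :=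
  ((continuousOn_grad hv F.1).mono (segment_subset_elem F)).inner continuousOn_const

theorem bdryIntegrable_normalDeriv (hv : v ∈ M.feSpace P) : M.BdryIntegrable (M.normalDeriv v) :=
  fun F _ => integrable_arc_of_continuousOn (continuousOn_normalDeriv hv F)

theorem integrable_arc_mul {F : M.Side} {g : Plane → ℝ} (hg : Integrable g (M.arc F))
    (hv : v ∈ M.feSpace P) : Integrable (fun x => g x * v x) (M.arc F) := by
  rw [← arc_restrict_segment] at hg ⊢
  exact IntegrableOn.mul_continuousOn hg (continuousOn_side hv F) (isCompact_segment _ _)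

theorem integrableOn_region_mul {g : Plane → ℝ} (hg : IntegrableOn g M.region)
    (hv : v ∈ M.feSpace P) : IntegrableOn (fun x => g x * v x) M.region :=
  IntegrableOn.mul_continuousOn hg hv.1 isCompact_region

theorem integrableOn_region (hv : v ∈ M.feSpace P) : IntegrableOn v M.region :=
  hv.1.integrableOn_compact isCompact_region

theorem integrableOn_inner_grad (hu : u ∈ M.feSpace P) (hv : v ∈ M.feSpace P)
    (K : Fin M.numCells) :
    IntegrableOn (fun x => inner ℝ (M.grad K u x) (M.grad K v x)) (M.elem K) :=
  ((continuousOn_grad hu K).inner (continuousOn_grad hv K)).integrableOn_compact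
    (isCompact_elem K)

theorem measurableSet_elem (K : Fin M.numCells) : MeasurableSet (M.elem K) :=
  (isCompact_elem K).measurableSet

theorem innerDomain_comm (f g : Plane → ℝ) : M.innerDomain f g = M.innerDomain g f := by
  simp only [innerDomain, mul_comm]

theorem innerGrad_comm (f g : Plane → ℝ) : M.innerGrad f g = M.innerGrad g f := by
  simp only [innerGrad, real_inner_comm]

theorem innerDomain_add_right {f : Plane → ℝ} (hf : IntegrableOn f M.region)
    (hu : u ∈ M.feSpace P) (hv : v ∈ M.feSpace P) :
    M.innerDomain f (u + v) = M.innerDomain f u + M.innerDomain f v := by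
  simp only [innerDomain, Pi.add_apply, mul_add]
  exact integral_add (integrableOn_region_mul hf hu) (integrableOn_region_mul hf hv)

theorem innerDomain_smul_right (c : ℝ) (f u : Plane → ℝ) :
    M.innerDomain f (c • u) = c * M.innerDomain f u := by
  simp only [innerDomain, Pi.smul_apply, smul_eq_mul, ← integral_const_mul]
  congr 1; ext x; ring

theorem innerGrad_add_right (hw : w ∈ M.feSpace P) (hu : u ∈ M.feSpace P)
    (hv : v ∈ M.feSpace P) : M.innerGrad w (u + v) = M.innerGrad w u + M.innerGrad w v := by
  simp only [innerGrad, ← Finset.sum_add_distrib]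
  refine Finset.sum_congr rfl fun K _ => ?_
  rw [← integral_add (integrableOn_inner_grad hw hu K) (integrableOn_inner_grad hw hv K)]
  refine setIntegral_congr_fun (measurableSet_elem K) fun x hx => ?_
  simp only [grad_add hu hv hx, inner_add_right]

theorem innerGrad_smul_right (c : ℝ) (w : Plane → ℝ) (hu : u ∈ M.feSpace P) :
    M.innerGrad w (c • u) = c * M.innerGrad w u := by
  simp only [innerGrad, Finset.mul_sum]
  refine Finset.sum_congr rfl fun K _ => ?_
  rw [← integral_const_mul]
  refine setIntegral_congr_fun (measurableSet_elem K) fun x hx => ?_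
  simp only [grad_smul c hu hx, real_inner_smul_right]

theorem innerBdry_add_right {g : M.Side → Plane → ℝ} (hg : M.BdryIntegrable g)
    (hu : u ∈ M.feSpace P) (hv : v ∈ M.feSpace P) :
    M.innerBdry g (u + v) = M.innerBdry g u + M.innerBdry g v := by
  simp only [innerBdry, ← Finset.sum_add_distrib]
  refine Finset.sum_congr rfl fun F hF => ?_
  rw [← integral_add (integrable_arc_mul (hg F hF) hu) (integrable_arc_mul (hg F hF) hv)]
  simp only [Pi.add_apply, mul_add]

theorem innerBdry_smul_right (c : ℝ) (g : M.Side → Plane → ℝ) (u : Plane → ℝ) :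
    M.innerBdry g (c • u) = c * M.innerBdry g u := by
  simp only [innerBdry, Finset.mul_sum]
  refine Finset.sum_congr rfl fun F _ => ?_
  rw [← integral_const_mul]
  congr 1; ext x; simp only [Pi.smul_apply, smul_eq_mul]; ring

theorem innerBdry_add_left {g g' : M.Side → Plane → ℝ} (hg : M.BdryIntegrable g)
    (hg' : M.BdryIntegrable g') (hv : v ∈ M.feSpace P) :
    M.innerBdry (fun F x => g F x + g' F x) v = M.innerBdry g v + M.innerBdry g' v := by
  simp only [innerBdry, ← Finset.sum_add_distrib]
  refine Finset.sum_congr rfl fun F hF => ?_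
  rw [← integral_add (integrable_arc_mul (hg F hF) hv) (integrable_arc_mul (hg' F hF) hv)]
  simp only [add_mul]

theorem innerBdry_smul_left (c : ℝ) (g : M.Side → Plane → ℝ) (v : Plane → ℝ) :
    M.innerBdry (fun F x => c * g F x) v = c * M.innerBdry g v := by
  simp only [innerBdry, Finset.mul_sum]
  refine Finset.sum_congr rfl fun F _ => ?_
  rw [← integral_const_mul]
  congr 1; ext x; ring

theorem innerBdry_sub_left {g g' : M.Side → Plane → ℝ} (hg : M.BdryIntegrable g)
    (hg' : M.BdryIntegrable g') (hv : v ∈ M.feSpace P) :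
    M.innerBdry (fun F x => g F x - g' F x) v = M.innerBdry g v - M.innerBdry g' v := by
  simp only [innerBdry, ← Finset.sum_sub_distrib]
  refine Finset.sum_congr rfl fun F hF => ?_
  rw [← integral_sub (integrable_arc_mul (hg F hF) hv) (integrable_arc_mul (hg' F hF) hv)]
  simp only [sub_mul]

theorem innerBdry_congr_left {g g' : M.Side → Plane → ℝ}
    (h : ∀ F ∈ M.bdry, ∀ᵐ x ∂(M.arc F), g F x = g' F x) (v : Plane → ℝ) :
    M.innerBdry g v = M.innerBdry g' v := by
  refine Finset.sum_congr rfl fun F hF => integral_congr_ae ?_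
  filter_upwards [h F hF] with x hx
  rw [hx]

theorem innerBdry_normalDeriv_add (hu : u ∈ M.feSpace P) (hv : v ∈ M.feSpace P)
    (hw : w ∈ M.feSpace P) : M.innerBdry (M.normalDeriv (u + v)) w =
      M.innerBdry (M.normalDeriv u) w + M.innerBdry (M.normalDeriv v) w := by
  rw [← innerBdry_add_left (bdryIntegrable_normalDeriv hu) (bdryIntegrable_normalDeriv hv) hw]
  refine innerBdry_congr_left (fun F _ => ?_) _
  filter_upwards [ae_arc_mem_segment F] with x hx
  exact normalDeriv_add hu hv hx

theorem innerBdry_normalDeriv_smul (c : ℝ) (hu : u ∈ M.feSpace P) (w : Plane → ℝ) :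
    M.innerBdry (M.normalDeriv (c • u)) w = c * M.innerBdry (M.normalDeriv u) w := by
  rw [← innerBdry_smul_left]
  refine innerBdry_congr_left (fun F _ => ?_) _
  filter_upwards [ae_arc_mem_segment F] with x hx
  exact normalDeriv_smul c hu hx

theorem penalty_eq (γ : ℝ) (g : M.Side → Plane → ℝ) (v : Plane → ℝ) :
    M.penalty γ g v = γ⁻¹ * M.innerBdry g v := by
  rw [penalty, ← innerBdry_smul_right]
  congr 1; ext x; simp [div_eq_inv_mul]

/-- `(u, v) ↦ (u, v)_Ω` on the finite element space. -/
def domainForm (M : TriMesh) (P : ℕ) : M.feSpace P →ₗ[ℝ] M.feSpace P →ₗ[ℝ] ℝ :=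
  LinearMap.mk₂ ℝ (fun u v => M.innerDomain u v)
    (fun u v w => by
      simp only [innerDomain_comm _ (w : Plane → ℝ)]
      exact innerDomain_add_right (integrableOn_region w.2) u.2 v.2)
    (fun c u w => by
      simp only [innerDomain_comm _ (w : Plane → ℝ)]
      exact innerDomain_smul_right c w u)
    (fun u v w => innerDomain_add_right (integrableOn_region u.2) v.2 w.2)
    (fun c u w => innerDomain_smul_right c u w)

/-- `(u, v) ↦ (∇u, ∇v)_Ω` on the finite element space. -/
def gradForm (M : TriMesh) (P : ℕ) : M.feSpace P →ₗ[ℝ] M.feSpace P →ₗ[ℝ] ℝ :=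
  LinearMap.mk₂ ℝ (fun u v => M.innerGrad u v)
    (fun u v w => by
      simp only [innerGrad_comm _ (w : Plane → ℝ)]
      exact innerGrad_add_right w.2 u.2 v.2)
    (fun c u w => by
      simp only [innerGrad_comm _ (w : Plane → ℝ)]
      exact innerGrad_smul_right c w u.2)
    (fun u v w => innerGrad_add_right u.2 v.2 w.2)
    (fun c u w => innerGrad_smul_right c u w.2)

/-- `(u, v) ↦ (u, v)_Γ` on the finite element space. -/
def traceForm (M : TriMesh) (P : ℕ) : M.feSpace P →ₗ[ℝ] M.feSpace P →ₗ[ℝ] ℝ :=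
  LinearMap.mk₂ ℝ (fun u v => M.innerBdry (fun _ => u) v)
    (fun u v w => innerBdry_add_left (bdryIntegrable_trace u.2) (bdryIntegrable_trace v.2) w.2)
    (fun c u w => innerBdry_smul_left c (fun _ => u) w)
    (fun u v w => innerBdry_add_right (bdryIntegrable_trace u.2) v.2 w.2)
    (fun c _ w => innerBdry_smul_right c _ w)

/-- `(u, v) ↦ (∇u · n, v)_Γ` on the finite element space. -/
def fluxForm (M : TriMesh) (P : ℕ) : M.feSpace P →ₗ[ℝ] M.feSpace P →ₗ[ℝ] ℝ :=
  LinearMap.mk₂ ℝ (fun u v => M.innerBdry (M.normalDeriv u) v)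
    (fun u v w => innerBdry_normalDeriv_add u.2 v.2 w.2)
    (fun c u w => innerBdry_normalDeriv_smul c u.2 w)
    (fun u v w => innerBdry_add_right (bdryIntegrable_normalDeriv u.2) v.2 w.2)
    (fun c _ w => innerBdry_smul_right c _ w)

/-- `v ↦ (f, v)_Ω` on the finite element space. -/
def sourceFunctional (P : ℕ) {f : Plane → ℝ} (hf : IntegrableOn f M.region) :
    M.feSpace P →ₗ[ℝ] ℝ where
  toFun v := M.innerDomain f v
  map_add' v w := innerDomain_add_right hf v.2 w.2
  map_smul' c v := innerDomain_smul_right c f v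

/-- `v ↦ (g, v)_Γ` on the finite element space. -/
def bdryFunctional (P : ℕ) {g : M.Side → Plane → ℝ} (hg : M.BdryIntegrable g) :
    M.feSpace P →ₗ[ℝ] ℝ where
  toFun v := M.innerBdry g v
  map_add' v w := innerBdry_add_right hg v.2 w.2
  map_smul' c v := innerBdry_smul_right c g v

/-- A finite element function vanishes off the region, hence is determined by its restrictions to
the finitely many cells, each of which lies in the image of a finite-dimensional space of
polynomials. -/
instance (M : TriMesh) (P : ℕ) : FiniteDimensional ℝ (M.feSpace P) := by
  let R : (K : Fin M.numCells) → (Plane → ℝ) →ₗ[ℝ] (M.elem K → ℝ) := fun K =>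
    LinearMap.funLeft ℝ ℝ Subtype.val
  let L : M.feSpace P →ₗ[ℝ] (∀ K, (polyFun P).map (R K)) :=
    LinearMap.pi fun K => ((R K).domRestrict (M.feSpace P)).codRestrict _ fun v => by
      obtain ⟨p, hp, h, -⟩ := exists_polynomial v.2 K
      exact ⟨p.planeEval, ⟨p, hp, rfl⟩, by ext x; exact (h x x.2).symm⟩
  refine FiniteDimensional.of_injective L fun u v h => ?_
  ext x
  by_cases hx : x ∈ M.region
  · obtain ⟨K, hK⟩ := Set.mem_iUnion.1 hx
    have := congrArg (fun z => (z K : M.elem K → ℝ) ⟨x, hK⟩) h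
    exact this
  · rw [u.2.2.2 x hx, v.2.2.2 x hx]

/-- A continuous function that is zero almost everywhere is zero on the interior of each cell, hence
on the closed cell by density; off the region it is zero by convention. -/
theorem eq_zero_of_innerDomain_self (hv : v ∈ M.feSpace P) (h : M.innerDomain v v = 0) :
    v = 0 := by
  have hvv : IntegrableOn (fun x => v x * v x) M.region :=
    integrableOn_region_mul (integrableOn_region hv) hv
  have h0 := (setIntegral_eq_zero_iff_of_nonneg_ae
    (Eventually.of_forall fun x => mul_self_nonneg (v x)) hvv).1 h
  have hint : ∀ K, ∀ x ∈ interior (M.elem K), v x = 0 := by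
    intro K
    have h1 : (fun x => v x) =ᵐ[volume.restrict (interior (M.elem K))] fun _ => 0 := by
      filter_upwards [ae_restrict_of_ae_restrict_of_subset
        (interior_subset.trans (elem_subset_region K)) h0] with x hx
      exact mul_self_eq_zero.1 hx
    exact Measure.eqOn_open_of_ae_eq h1 isOpen_interior
      ((continuousOn_elem hv K).mono interior_subset) continuousOn_const
  ext x
  by_cases hx : x ∈ M.region
  · obtain ⟨K, hK⟩ := Set.mem_iUnion.1 hx
    have hcl : M.elem K ⊆ closure (interior (M.elem K)) := by
      rw [(convex_elem K).closure_interior_eq_closure_of_nonempty_interior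
        (interior_elem_nonempty K)]
      exact subset_closure
    have : Set.EqOn v (fun _ => 0) (M.elem K) :=
      Set.EqOn.of_subset_closure (hint K) (continuousOn_elem hv K) continuousOn_const
        interior_subset hcl
    exact this hK
  · exact hv.2.2 x hx

/-! ### The norm of `H¹` on the finite element space -/

theorem innerDomain_self_nonneg (v : Plane → ℝ) : 0 ≤ M.innerDomain v v :=
  integral_nonneg fun x => mul_self_nonneg (v x)

theorem innerGrad_self_nonneg (v : Plane → ℝ) : 0 ≤ M.innerGrad v v :=
  Finset.sum_nonneg fun _ _ => integral_nonneg fun _ => real_inner_self_nonneg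

theorem bdryNormSq_nonneg (v : Plane → ℝ) : 0 ≤ M.bdryNormSq v :=
  Finset.sum_nonneg fun _ _ => integral_nonneg fun x => mul_self_nonneg (v x)

theorem h1Norm_sq (v : Plane → ℝ) : M.h1Norm v ^ 2 = M.innerDomain v v + M.innerGrad v v :=
  Real.sq_sqrt (add_nonneg (innerDomain_self_nonneg v) (innerGrad_self_nonneg v))

theorem h1Norm_nonneg (v : Plane → ℝ) : 0 ≤ M.h1Norm v := Real.sqrt_nonneg _

theorem h1Norm_sq_pos (hv : v ∈ M.feSpace P) (h : v ≠ 0) : 0 < M.h1Norm v ^ 2 := by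
  rw [h1Norm_sq]
  have h1 := innerDomain_self_nonneg (M := M) v
  have h2 := innerGrad_self_nonneg (M := M) v
  have h3 : M.innerDomain v v ≠ 0 := fun h0 => h (eq_zero_of_innerDomain_self hv h0)
  have h4 := h1.lt_of_ne h3.symm
  linarith

/-- Linear functionals on the finite element space are bounded in the norm of `H¹`. -/
theorem exists_abs_le_h1Norm (ℓ : M.feSpace P →ₗ[ℝ] ℝ) :
    ∃ C : ℝ, 0 < C ∧ ∀ v : M.feSpace P, |ℓ v| ≤ C * M.h1Norm v := by
  -- Compares the quadratic form `ℓ(v)²` with the squared norm of `H¹`, which is positive definite.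
  obtain ⟨C, hC, h⟩ := exists_quadratic_le_mul_posDef
    (LinearMap.mk₂ ℝ (fun u v => ℓ u * ℓ v) (by intros; simp [add_mul])
      (by intros; simp [mul_assoc]) (by intros; simp [mul_add])
      (by intros; simp; ring))
    (domainForm M P + gradForm M P)
    (fun v hv => by
      have := h1Norm_sq_pos v.2 (fun h => hv (Subtype.ext h))
      rwa [h1Norm_sq] at this)
  refine ⟨√C, Real.sqrt_pos.2 hC, fun v => ?_⟩
  have h1 : ℓ v * ℓ v ≤ C * M.h1Norm v ^ 2 := by
    rw [h1Norm_sq]; exact h v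
  refine abs_le_of_sq_le_sq ?_ (mul_nonneg (Real.sqrt_nonneg _) (h1Norm_nonneg _))
  rw [mul_pow, Real.sq_sqrt hC.le, sq]
  exact h1

end TriMesh

/-! ### The inverse trace inequality -/

/-- The Duffy map onto the reference triangle with vertices `(0, 0)`, `(1, 0)`, `(1, 1)`. -/
abbrev refDuffy : ℝ × ℝ → Plane :=
  duffy 0 (EuclideanSpace.single 0 1) (EuclideanSpace.single 0 1 + EuclideanSpace.single 1 1)

theorem refDuffy_zero (z : ℝ × ℝ) : refDuffy z 0 = z.1 := by simp [duffy]

theorem refDuffy_one (z : ℝ × ℝ) : refDuffy z 1 = z.1 * z.2 := by simp [duffy]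

theorem cross_ref : cross (EuclideanSpace.single 0 1 - 0)
    (EuclideanSpace.single 0 1 + EuclideanSpace.single 1 1 - EuclideanSpace.single 0 1) = 1 := by
  simp [cross]

theorem continuous_of_mem_polyFun {P : ℕ} {g : Plane → ℝ} (hg : g ∈ polyFun P) :
    Continuous g := by
  obtain ⟨p, -, rfl⟩ := hg
  exact p.continuous_planeEval

theorem integrableOn_openSquare_refDuffy {g : Plane → ℝ} (hg : Continuous g) :
    IntegrableOn (fun z => z.1 * g (refDuffy z)) openSquare := by
  have h : Continuous fun z => z.1 * g (refDuffy z) :=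
    continuous_fst.mul (hg.comp (continuous_duffy _ _ _))
  exact (h.continuousOn.integrableOn_compact (isCompact_Icc.prod isCompact_Icc)).mono_set
    (Set.prod_mono Set.Ioo_subset_Icc_self Set.Ioo_subset_Icc_self)

/-- Both integrals are quadratic forms on the finite-dimensional space of polynomial functions, and
the one over the triangle is positive definite. The weight `z.1` is the Jacobian of the Duffy map,
and `z.1 = 1` is the side opposite to its collapsed vertex. -/
theorem exists_trace_le_reference (P : ℕ) : ∃ C : ℝ, 0 < C ∧ ∀ g ∈ polyFun P,
    ∫ t in (0 : ℝ)..1, g (refDuffy (1, t)) * g (refDuffy (1, t)) ≤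
      C * ∫ z in openSquare, z.1 * (g (refDuffy z) * g (refDuffy z)) := by
  have hc : ∀ g : polyFun P, Continuous (g : Plane → ℝ) := fun g => continuous_of_mem_polyFun g.2
  have hd : Continuous fun t : ℝ => refDuffy (1, t) :=
    (continuous_duffy _ _ _).comp (by fun_prop)
  have hi : ∀ g h : polyFun P, IntervalIntegrable
      (fun t : ℝ => (g : Plane → ℝ) (refDuffy (1, t)) * (h : Plane → ℝ) (refDuffy (1, t)))
      volume 0 1 := fun g h =>
    (((hc g).comp hd).mul ((hc h).comp hd)).intervalIntegrable 0 1
  have hi2 : ∀ g h : polyFun P, IntegrableOn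
      (fun z => z.1 * ((g : Plane → ℝ) (refDuffy z) * (h : Plane → ℝ) (refDuffy z)))
      openSquare := fun g h => integrableOn_openSquare_refDuffy ((hc g).mul (hc h))
  obtain ⟨C, hC, h⟩ := exists_quadratic_le_mul_posDef (V := polyFun P)
    (LinearMap.mk₂ ℝ (fun g h => ∫ t in (0 : ℝ)..1,
        (g : Plane → ℝ) (refDuffy (1, t)) * (h : Plane → ℝ) (refDuffy (1, t)))
      (fun g g' h => by
        rw [← intervalIntegral.integral_add (hi g h) (hi g' h)]
        congr 1; ext t; exact add_mul _ _ _)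
      (fun c g h => by
        rw [smul_eq_mul, ← intervalIntegral.integral_const_mul]
        congr 1; ext t; exact mul_assoc _ _ _)
      (fun g h h' => by
        rw [← intervalIntegral.integral_add (hi g h) (hi g h')]
        congr 1; ext t; exact mul_add _ _ _)
      (fun c g h => by
        rw [smul_eq_mul, ← intervalIntegral.integral_const_mul]
        congr 1; ext t; exact mul_left_comm _ _ _))
    (LinearMap.mk₂ ℝ (fun g h => ∫ z in openSquare, z.1 *
        ((g : Plane → ℝ) (refDuffy z) * (h : Plane → ℝ) (refDuffy z)))
      (fun g g' h => by
        rw [← integral_add (hi2 g h) (hi2 g' h)]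
        congr 1; ext z; simp only [Submodule.coe_add, Pi.add_apply]; ring)
      (fun c g h => by
        rw [smul_eq_mul, ← integral_const_mul]
        congr 1; ext z; simp only [Submodule.coe_smul, Pi.smul_apply, smul_eq_mul]; ring)
      (fun g h h' => by
        rw [← integral_add (hi2 g h) (hi2 g h')]
        congr 1; ext z; simp only [Submodule.coe_add, Pi.add_apply]; ring)
      (fun c g h => by
        rw [smul_eq_mul, ← integral_const_mul]
        congr 1; ext z; simp only [Submodule.coe_smul, Pi.smul_apply, smul_eq_mul]; ring))
    (fun g hg => by
      simp only [LinearMap.mk₂_apply]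
      have hnn : ∀ z ∈ openSquare, 0 ≤ z.1 * ((g : Plane → ℝ) (refDuffy z) *
          (g : Plane → ℝ) (refDuffy z)) := fun z hz =>
        mul_nonneg hz.1.1.le (mul_self_nonneg _)
      have hms : MeasurableSet openSquare := measurableSet_Ioo.prod measurableSet_Ioo
      refine (setIntegral_nonneg hms hnn).lt_of_ne fun h0 => hg ?_
      have h1 := (setIntegral_eq_zero_iff_of_nonneg_ae
        ((ae_restrict_iff' hms).2 (Eventually.of_forall hnn)) (hi2 g g)).1 h0.symm
      have h2 : Set.EqOn (fun z => z.1 * ((g : Plane → ℝ) (refDuffy z) *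
          (g : Plane → ℝ) (refDuffy z))) (fun _ => 0) openSquare :=
        Measure.eqOn_open_of_ae_eq h1 (isOpen_Ioo.prod isOpen_Ioo)
          (continuous_fst.mul (((hc g).mul (hc g)).comp (continuous_duffy _ _ _))).continuousOn
          continuousOn_const
      obtain ⟨p, -, hp⟩ := g.2
      have hp0 : p = 0 := by
        refine MvPolynomial.eq_zero_of_planeEval_eq_zero
          (isOpen_image_duffy (by rw [cross_ref]; exact one_ne_zero))
          (⟨_, ⟨(1 / 2, 1 / 2), by norm_num, rfl⟩⟩ : (refDuffy '' openSquare).Nonempty) ?_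
        rintro _ ⟨z, hz, rfl⟩
        have h3 := h2 hz
        simp only [mul_eq_zero, or_self] at h3
        rw [← hp]
        exact h3.resolve_left hz.1.1.ne'
      ext x
      rw [hp, hp0]
      simp [MvPolynomial.planeEval])
  exact ⟨C, hC, fun g hg => h ⟨g, hg⟩⟩

namespace TriMesh

variable {M : TriMesh} {P : ℕ} {u v w : Plane → ℝ}

theorem setIntegral_elem (F : M.Side) (g : Plane → ℝ) :
    ∫ x in M.elem F.1, g x = |M.detSide F| *
      ∫ z in openSquare, z.1 * g (duffy (M.apex F) (M.endA F) (M.endB F) z) := by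
  rw [elem_eq_convexHull]
  exact setIntegral_triangle (detSide_ne_zero F) g

/-- The exact value is half of the bound; the factor is not needed. -/
theorem volume_real_elem_le (F : M.Side) : volume.real (M.elem F.1) ≤ |M.detSide F| := by
  have h := setIntegral_elem F (fun _ => 1)
  rw [setIntegral_const, smul_eq_mul, mul_one] at h
  rw [h]
  refine mul_le_of_le_one_right (abs_nonneg _) ?_
  have hms : MeasurableSet openSquare := measurableSet_Ioo.prod measurableSet_Ioo
  have hi : IntegrableOn (fun z : ℝ × ℝ => z.1 * 1) openSquare :=
    integrableOn_openSquare_refDuffy (g := fun _ => 1) continuous_const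
  have hv : volume openSquare = 1 := by
    rw [Measure.volume_eq_prod, Measure.prod_prod]; simp
  calc ∫ z in openSquare, z.1 * 1 ≤ ∫ z in openSquare, 1 :=
        setIntegral_mono_on hi (by simp [integrableOn_const_iff, hv]) hms
          (fun z hz => by linarith [hz.1.2])
    _ = 1 := by rw [setIntegral_const, Measure.real, hv]; simp

theorem dist_le_size (F : M.Side) : dist (M.endA F) (M.endB F) ≤ M.size F.1 :=
  Metric.dist_le_diam_of_mem (isCompact_elem _).isBounded
    (segment_subset_elem F (left_mem_segment ℝ _ _))
    (segment_subset_elem F (right_mem_segment ℝ _ _))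

theorem size_pos (K : Fin M.numCells) : 0 < M.size K :=
  (dist_pos.2 (endA_ne_endB ((K, 0) : M.Side))).trans_le (dist_le_size (M := M) (K, 0))

/-- The area of the disc contained in the triangle bounds the area of the triangle from below. -/
theorem ShapeRegular.le_abs_detSide {σ : ℝ} (hσ : 0 < σ) (hM : M.ShapeRegular σ) (F : M.Side) :
    Real.pi * (M.size F.1 / σ) ^ 2 ≤ |M.detSide F| := by
  obtain ⟨z, hz⟩ := hM F.1
  refine le_trans ?_ (volume_real_elem_le F)
  have h : volume.real (Metric.ball z (M.size F.1 / σ)) = Real.pi * (M.size F.1 / σ) ^ 2 := by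
    have hp : 0 ≤ M.size F.1 / σ := (div_pos (size_pos F.1) hσ).le
    rw [Measure.real, EuclideanSpace.volume_ball_fin_two, ENNReal.toReal_mul, ENNReal.toReal_pow,
      ENNReal.toReal_ofReal hp, ENNReal.toReal_ofReal Real.pi_pos.le, mul_comm]
  rw [← h]
  exact measureReal_mono (Metric.ball_subset_closedBall.trans hz)
    (isCompact_elem F.1).measure_lt_top.ne

/-- The inverse trace inequality for polynomials on shape regular triangles. -/
theorem exists_trace_le (P : ℕ) : ∃ C : ℝ, 0 < C ∧ ∀ (M : TriMesh) (σ : ℝ), 0 < σ →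
    M.ShapeRegular σ → ∀ (F : M.Side) (p : MvPolynomial (Fin 2) ℝ), p.totalDegree ≤ P →
      ∫ x, p.planeEval x * p.planeEval x ∂(M.arc F) ≤
        C * σ ^ 2 / M.size F.1 * ∫ x in M.elem F.1, p.planeEval x * p.planeEval x := by
  obtain ⟨C, hC, h⟩ := exists_trace_le_reference P
  refine ⟨C, hC, fun M σ hσ hM F p hp => ?_⟩
  -- The affine pullback to the reference triangle does not raise the degree, so the reference
  -- constant applies to it.
  obtain ⟨q, hq, hqp⟩ := p.exists_planeEval_comp_affine (M.apex F) (M.endA F - M.apex F)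
    (M.endB F - M.endA F)
  have hqd : ∀ z, p.planeEval (duffy (M.apex F) (M.endA F) (M.endB F) z) =
      q.planeEval (refDuffy z) := fun z => by
    rw [hqp, refDuffy_zero, refDuffy_one]; rfl
  have hside : ∀ t : ℝ, (AffineMap.lineMap (M.endA F) (M.endB F) t : Plane) =
      duffy (M.apex F) (M.endA F) (M.endB F) (1, t) := fun t => by
    simp only [duffy, AffineMap.lineMap_apply_module']; module
  have hD : 0 < |M.detSide F| := abs_pos.2 (detSide_ne_zero F)
  have hs := size_pos F.1
  have hI := h q.planeEval ⟨q, hq.trans hp, rfl⟩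
  rw [integral_arc, setIntegral_elem]
  simp only [hside, hqd]
  set I := ∫ z in openSquare, z.1 * (q.planeEval (refDuffy z) * q.planeEval (refDuffy z))
  have hI0 : 0 ≤ I := setIntegral_nonneg (measurableSet_Ioo.prod measurableSet_Ioo)
    fun z hz => mul_nonneg hz.1.1.le (mul_self_nonneg _)
  -- The ratio of the scaling factors of side and triangle: `h² ≤ σ² |det|` comes from the area of
  -- the disc, with `π` replaced by `1`.
  have h1 : M.size F.1 ≤ σ ^ 2 / M.size F.1 * |M.detSide F| := by
    have h2 := hM.le_abs_detSide hσ F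
    have h3 : M.size F.1 * M.size F.1 ≤ σ ^ 2 * |M.detSide F| := by
      have h4 : (M.size F.1 / σ) ^ 2 ≤ |M.detSide F| :=
        le_trans (le_mul_of_one_le_left (sq_nonneg _) (by linarith [Real.pi_gt_three])) h2
      rw [div_pow, div_le_iff₀ (by positivity)] at h4
      nlinarith
    rw [div_mul_eq_mul_div, le_div_iff₀ hs]
    exact h3
  calc _ ≤ M.size F.1 * (C * I) := by
        refine mul_le_mul (dist_le_size F) hI ?_ hs.le
        exact intervalIntegral.integral_nonneg zero_le_one fun t _ => mul_self_nonneg _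
    _ ≤ σ ^ 2 / M.size F.1 * |M.detSide F| * (C * I) := by gcongr
    _ = _ := by ring

/-- The normal has unit length, so `(∇v · n)² ≤ |∇v|²`, and the trace inequality applies to the two
partial derivatives, polynomials of degree at most `P`. -/
theorem exists_normalDeriv_le (P : ℕ) : ∃ C : ℝ, 0 < C ∧ ∀ (M : TriMesh) (σ : ℝ), 0 < σ →
    M.ShapeRegular σ → ∀ (F : M.Side), ∀ v ∈ M.feSpace P,
      ∫ x, M.normalDeriv v F x * M.normalDeriv v F x ∂(M.arc F) ≤
        C * σ ^ 2 / M.size F.1 *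
          ∫ x in M.elem F.1, inner ℝ (M.grad F.1 v x) (M.grad F.1 v x) := by
  obtain ⟨C, hC, h⟩ := exists_trace_le P
  refine ⟨C, hC, fun M σ hσ hM F v hv => ?_⟩
  obtain ⟨p, hp, -, hg⟩ := exists_polynomial hv F.1
  have hd : ∀ i, (MvPolynomial.pderiv i p).totalDegree ≤ P := fun i =>
    (MvPolynomial.totalDegree_pderiv_le_self i p).trans hp
  have hc : ∀ i, Continuous fun x => (MvPolynomial.pderiv i p).planeEval x *
      (MvPolynomial.pderiv i p).planeEval x := fun i =>
    (MvPolynomial.continuous_planeEval _).mul (MvPolynomial.continuous_planeEval _)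
  have hin : ∀ x, inner ℝ (p.planeGrad x) (p.planeGrad x) =
      (MvPolynomial.pderiv 0 p).planeEval x * (MvPolynomial.pderiv 0 p).planeEval x +
      (MvPolynomial.pderiv 1 p).planeEval x * (MvPolynomial.pderiv 1 p).planeEval x := by
    intro x
    simp only [PiLp.inner_apply, Fin.sum_univ_two, RCLike.inner_apply, conj_trivial,
      MvPolynomial.planeGrad_apply]
  have hK : ∫ x in M.elem F.1, inner ℝ (M.grad F.1 v x) (M.grad F.1 v x) =
      (∫ x in M.elem F.1, (MvPolynomial.pderiv 0 p).planeEval x *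
        (MvPolynomial.pderiv 0 p).planeEval x) +
      ∫ x in M.elem F.1, (MvPolynomial.pderiv 1 p).planeEval x *
        (MvPolynomial.pderiv 1 p).planeEval x := by
    rw [← integral_add ((hc 0).continuousOn.integrableOn_compact (isCompact_elem _))
      ((hc 1).continuousOn.integrableOn_compact (isCompact_elem _))]
    refine setIntegral_congr_fun (measurableSet_elem _) fun x hx => ?_
    simp only [hg x hx, hin]
  have hF : ∫ x, M.normalDeriv v F x * M.normalDeriv v F x ∂(M.arc F) ≤
      (∫ x, (MvPolynomial.pderiv 0 p).planeEval x *
        (MvPolynomial.pderiv 0 p).planeEval x ∂(M.arc F)) +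
      ∫ x, (MvPolynomial.pderiv 1 p).planeEval x *
        (MvPolynomial.pderiv 1 p).planeEval x ∂(M.arc F) := by
    have hi := fun i => integrable_arc_of_continuousOn (F := F) (hc i).continuousOn
    rw [← integral_add (hi 0) (hi 1)]
    refine integral_mono_ae (integrable_arc_of_continuousOn
      ((continuousOn_normalDeriv hv F).mul (continuousOn_normalDeriv hv F))) ((hi 0).add (hi 1)) ?_
    filter_upwards [ae_arc_mem_segment F] with x hx
    rw [← hin, normalDeriv, hg x (mem_elem_of_mem_segment hx)]
    refine (real_inner_mul_inner_self_le _ _).trans ?_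
    rw [real_inner_self_eq_norm_sq (M.normal F), norm_normal]
    simp
  rw [hK, mul_add]
  exact hF.trans (add_le_add (h M σ hσ hM F _ (hd 0)) (h M σ hσ hM F _ (hd 1)))

end TriMesh

/-! ### Green's formula and the Friedrichs inequality -/

theorem divergence_fderiv_smul {φ : Plane → ℝ} {Y : Plane → Plane} {g x : Plane}
    (hφ : HasFDerivAt φ (innerSL ℝ g) x) (hY : DifferentiableAt ℝ Y x) :
    divergence (fderiv ℝ (fun y => φ y • Y y) x) =
      φ x * divergence (fderiv ℝ Y x) + inner ℝ g (Y x) := by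
  have h : HasFDerivAt (fun y => φ y • Y y) _ x := hφ.smul hY.hasFDerivAt
  rw [h.fderiv]
  simp [divergence, PiLp.inner_apply, Fin.sum_univ_two]
  ring

theorem gradientWithin_apply (u : Plane → ℝ) (s : Set Plane) (x : Plane) (i : Fin 2) :
    gradientWithin u s x i = fderivWithin ℝ u s x (EuclideanSpace.single i 1) := by
  rw [← inner_gradientWithin_left, EuclideanSpace.inner_single_right]
  simp

theorem divergence_fderiv_apply {Y : Plane → Plane} {x : Plane} (h : DifferentiableAt ℝ Y x) :
    divergence (fderiv ℝ Y x) = ∑ i, fderiv ℝ (fun y => Y y i) x (EuclideanSpace.single i 1) := by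
  have : ∀ i, fderiv ℝ (fun y => Y y i) x =
      (EuclideanSpace.proj i : Plane →L[ℝ] ℝ).comp (fderiv ℝ Y x) := fun i =>
    ((EuclideanSpace.proj i : Plane →L[ℝ] ℝ).hasFDerivAt.comp x h.hasFDerivAt).fderiv
  simp [this, divergence, Fin.sum_univ_two]

/-- In the interior of `s` the gradient within `s` agrees locally with the full gradient, and the
trace of the second derivative is the Laplacian. -/
theorem divergence_gradientWithin {u : Plane → ℝ} {s : Set Plane} {x : Plane} (hx : x ∈ interior s)
    (hu : ContDiffOn ℝ 2 u (interior s)) :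
    DifferentiableAt ℝ (gradientWithin u s) x ∧
      divergence (fderiv ℝ (gradientWithin u s) x) = Laplacian.laplacian u x := by
  have hux : ContDiffAt ℝ 2 u x := hu.contDiffAt (isOpen_interior.mem_nhds hx)
  have hd : DifferentiableAt ℝ (fderiv ℝ u) x :=
    (hux.fderiv_right (m := 1) (by norm_num)).differentiableAt (by norm_num)
  have hev : ∀ i, (fun y => gradientWithin u s y i) =ᶠ[𝓝 x]
      fun y => fderiv ℝ u y (EuclideanSpace.single i 1) := fun i => by
    filter_upwards [isOpen_interior.mem_nhds hx] with y hy
    rw [gradientWithin_apply, fderivWithin_of_mem_nhds (mem_interior_iff_mem_nhds.1 hy)]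
  have hc : ∀ i, HasFDerivAt (fun y => fderiv ℝ u y (EuclideanSpace.single i 1))
      ((fderiv ℝ (fderiv ℝ u) x).flip (EuclideanSpace.single i 1)) x := fun i => by
    refine (hd.hasFDerivAt.clm_apply (hasFDerivAt_const _ _)).congr_fderiv ?_
    ext; simp
  have hdiff : DifferentiableAt ℝ (gradientWithin u s) x := by
    rw [differentiableAt_euclidean]
    exact fun i => (hc i).differentiableAt.congr_of_eventuallyEq (hev i)
  refine ⟨hdiff, ?_⟩
  rw [divergence_fderiv_apply hdiff, InnerProductSpace.laplacian_eq_iteratedFDeriv_orthonormalBasis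
    u (EuclideanSpace.basisFun (Fin 2) ℝ)]
  refine Finset.sum_congr rfl fun i _ => ?_
  rw [(hev i).fderiv_eq, (hc i).fderiv, iteratedFDeriv_two_apply]
  simp

namespace TriMesh

variable {M : TriMesh} {P : ℕ} {u v w : Plane → ℝ}

theorem ae_mem_interior_elem (K : Fin M.numCells) :
    ∀ᵐ x ∂(volume.restrict (M.elem K)), x ∈ interior (M.elem K) := by
  rw [ae_restrict_iff' (measurableSet_elem K)]
  have h : volume (frontier (M.elem K)) = 0 := (convex_elem K).addHaar_frontier volume
  filter_upwards [measure_eq_zero_iff_ae_notMem.1 h] with x hx hxK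
  by_contra hc
  exact hx ⟨subset_closure hxK, hc⟩

theorem hasFDerivAt_of_mem_interior (hv : v ∈ M.feSpace P) {K : Fin M.numCells} {x : Plane}
    (hx : x ∈ interior (M.elem K)) : HasFDerivAt v (innerSL ℝ (M.grad K v x)) x := by
  obtain ⟨p, -, h1, h2⟩ := exists_polynomial hv K
  rw [h2 x (interior_subset hx)]
  refine (p.hasFDerivAt_planeEval x).congr_of_eventuallyEq ?_
  filter_upwards [mem_interior_iff_mem_nhds.1 hx] with y hy using h1 y hy

theorem sum_setIntegral_mul (hv : v ∈ M.feSpace P) {g : Plane → ℝ} (hg : IntegrableOn g M.region) :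
    M.innerDomain g v = ∑ K, ∫ x in M.elem K, g x * v x :=
  setIntegral_region fun K => (integrableOn_region_mul hg hv).mono_set (elem_subset_region K)

/-- For a function `C¹` on the closed region the gradients taken from the cells glue to one field,
which is continuous across interior sides as `divergence_region` requires. -/
theorem grad_eq_gradientWithin_region (hu : ContDiffOn ℝ 1 u M.region) {K : Fin M.numCells}
    {x : Plane} (hx : x ∈ M.elem K) : M.grad K u x = gradientWithin u M.region x := by
  rw [grad, gradientWithin, gradientWithin, fderivWithin_subset (elem_subset_region K)
    (uniqueDiffOn_elem K x hx) (hu.differentiableOn (by norm_num) x (elem_subset_region K hx))]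

theorem continuousOn_gradientWithin_region (hu : ContDiffOn ℝ 1 u M.region) :
    ContinuousOn (gradientWithin u M.region) M.region :=
  (LinearIsometryEquiv.continuous _).comp_continuousOn
    (hu.continuousOn_fderivWithin uniqueDiffOn_region (by norm_num))

/-- Green's formula for a function `u ∈ C²(Ω) ∩ C¹(Ω̄)` and a finite element function `v`. -/
theorem green_formula (hu : ContDiffOn ℝ 1 u M.region) (hu2 : ContDiffOn ℝ 2 u (interior M.region))
    {g : Plane → ℝ} (hg : IntegrableOn g M.region)
    (hgu : ∀ x ∈ interior M.region, Laplacian.laplacian u x = g x) (hv : v ∈ M.feSpace P) :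
    M.innerDomain g v + M.innerGrad u v = M.innerBdry (M.normalDeriv u) v := by
  set G := gradientWithin u M.region with hG
  have hGc := continuousOn_gradientWithin_region hu
  have hint : ∀ K, interior (M.elem K) ⊆ interior M.region := fun K =>
    interior_mono (elem_subset_region K)
  have hdiv : ∀ K, ∀ x ∈ interior (M.elem K), divergence (fderiv ℝ (fun y => v y • G y) x) =
      g x * v x + inner ℝ (M.grad K u x) (M.grad K v x) := by
    intro K x hx
    obtain ⟨h1, h2⟩ := divergence_gradientWithin (hint K hx) hu2
    rw [divergence_fderiv_smul (hasFDerivAt_of_mem_interior hv hx) h1, h2, hgu x (hint K hx),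
      grad_eq_gradientWithin_region hu (interior_subset hx), real_inner_comm, mul_comm]
  have hgradc : ∀ K, ContinuousOn (M.grad K u) (M.elem K) := fun K =>
    (hGc.mono (elem_subset_region K)).congr fun x hx => grad_eq_gradientWithin_region hu hx
  have hi1 : ∀ K, IntegrableOn (fun x => g x * v x) (M.elem K) := fun K =>
    (integrableOn_region_mul hg hv).mono_set (elem_subset_region K)
  have hi2 : ∀ K, IntegrableOn (fun x => inner ℝ (M.grad K u x) (M.grad K v x)) (M.elem K) :=
    fun K => ((hgradc K).inner (continuousOn_grad hv K)).integrableOn_compact (isCompact_elem K)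
  -- The second derivatives of `u` may blow up at the boundary; integrability of the divergence of
  -- `v ∇u` is read off the equation `Δu = g`.
  have hae : ∀ K, (fun x => divergence (fderiv ℝ (fun y => v y • G y) x)) =ᵐ[
      volume.restrict (M.elem K)] fun x => g x * v x + inner ℝ (M.grad K u x) (M.grad K v x) :=
    fun K => (ae_mem_interior_elem K).mono fun x hx => hdiv K x hx
  have key := divergence_region (M := M) (X := fun y => v y • G y) (hv.1.smul hGc)
    (fun K x hx => (hasFDerivAt_of_mem_interior hv hx).differentiableAt.smul
      (divergence_gradientWithin (hint K hx) hu2).1)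
    (fun K => ((hi1 K).add (hi2 K)).congr (hae K).symm)
  rw [sum_setIntegral_mul hv hg, innerGrad, ← Finset.sum_add_distrib, innerBdry]
  refine Eq.trans (Finset.sum_congr rfl fun K _ => ?_) (key.trans
    (Finset.sum_congr rfl fun F _ => integral_congr_ae ?_))
  · rw [integral_congr_ae (hae K), ← integral_add (hi1 K) (hi2 K)]
  · filter_upwards [ae_arc_mem_segment F] with x hx
    rw [normalDeriv, grad_eq_gradientWithin_region hu (mem_elem_of_mem_segment hx),
      real_inner_smul_left, mul_comm]

/-- A Friedrichs inequality, from the divergence theorem for `v² (x - x₀)` with any `x₀` in the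
region. Its divergence is `2 v² + 2 v ∇v · (x - x₀)`, and `|x - x₀| ≤ D` on the region and on its
boundary. -/
theorem innerDomain_self_le (hv : v ∈ M.feSpace P) {D : ℝ} (hD : Metric.diam M.region ≤ D) :
    M.innerDomain v v ≤ D * M.bdryNormSq v + D ^ 2 * M.innerGrad v v := by
  have hD0 : 0 ≤ D := Metric.diam_nonneg.trans hD
  obtain hE | ⟨x₀, hx₀⟩ := M.region.eq_empty_or_nonempty
  · have : M.innerDomain v v = 0 := by simp [innerDomain, hE]
    rw [this]
    exact add_nonneg (mul_nonneg hD0 (bdryNormSq_nonneg v))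
      (mul_nonneg (sq_nonneg D) (innerGrad_self_nonneg v))
  have hdist : ∀ x ∈ M.region, ‖x - x₀‖ ≤ D := fun x hx => by
    rw [← dist_eq_norm]
    exact (Metric.dist_le_diam_of_mem isCompact_region.isBounded hx hx₀).trans hD
  have hv2 : ∀ K, ∀ x ∈ interior (M.elem K),
      HasFDerivAt (fun y => v y * v y) (innerSL ℝ ((2 * v x) • M.grad K v x)) x := by
    intro K x hx
    have h := hasFDerivAt_of_mem_interior hv hx
    refine (h.mul h).congr_fderiv ?_
    rw [map_smul, ← add_smul, two_mul]
  have hid : ∀ x, HasFDerivAt (fun y : Plane => y - x₀) (ContinuousLinearMap.id ℝ Plane) x :=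
    fun x => (hasFDerivAt_id x).sub_const x₀
  have hdiv : ∀ K, ∀ x ∈ interior (M.elem K),
      divergence (fderiv ℝ (fun y => (v y * v y) • (y - x₀)) x) =
        2 * (v x * v x) + 2 * v x * inner ℝ (M.grad K v x) (x - x₀) := by
    intro K x hx
    rw [divergence_fderiv_smul (hv2 K x hx) (hid x).differentiableAt, (hid x).fderiv,
      real_inner_smul_left]
    simp [divergence]
    ring
  have hid' : Continuous fun y : Plane => y - x₀ := by fun_prop
  have hc : ∀ K, ContinuousOn (fun x => 2 * (v x * v x) +
      2 * v x * inner ℝ (M.grad K v x) (x - x₀)) (M.elem K) := fun K =>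
    have h1 := continuousOn_elem hv K
    (continuousOn_const.mul (h1.mul h1)).add ((continuousOn_const.mul h1).mul
      ((continuousOn_grad hv K).inner hid'.continuousOn))
  have hi := fun K => (hc K).integrableOn_compact (μ := volume) (isCompact_elem K)
  have hae : ∀ K, (fun x => divergence (fderiv ℝ (fun y => (v y * v y) • (y - x₀)) x)) =ᵐ[
      volume.restrict (M.elem K)] fun x => 2 * (v x * v x) +
        2 * v x * inner ℝ (M.grad K v x) (x - x₀) :=
    fun K => (ae_mem_interior_elem K).mono fun x hx => hdiv K x hx
  have key := divergence_region (M := M) (X := fun y => (v y * v y) • (y - x₀))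
    ((hv.1.mul hv.1).smul hid'.continuousOn)
    (fun K x hx => (hv2 K x hx).differentiableAt.smul (hid x).differentiableAt)
    (fun K => (hi K).congr (hae K).symm)
  have hleft : M.innerDomain v v - D ^ 2 * M.innerGrad v v ≤
      ∑ K, ∫ x in M.elem K, divergence (fderiv ℝ (fun y => (v y * v y) • (y - x₀)) x) := by
    rw [sum_setIntegral_mul hv (integrableOn_region hv), innerGrad, Finset.mul_sum,
      ← Finset.sum_sub_distrib]
    refine Finset.sum_le_sum fun K _ => ?_
    have hi1 : IntegrableOn (fun x => v x * v x) (M.elem K) :=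
      ((continuousOn_elem hv K).mul (continuousOn_elem hv K)).integrableOn_compact
        (isCompact_elem K)
    have hi2 := (integrableOn_inner_grad hv hv K).const_mul (D ^ 2)
    rw [integral_congr_ae (hae K), ← integral_const_mul, ← integral_sub hi1 hi2]
    refine setIntegral_mono_on (hi1.sub hi2) (hi K) (measurableSet_elem K) fun x hx => ?_
    have h1 : |inner ℝ (M.grad K v x) (x - x₀)| ≤ ‖M.grad K v x‖ * D :=
      (abs_real_inner_le_norm _ _).trans
        (mul_le_mul_of_nonneg_left (hdist x (elem_subset_region K hx)) (norm_nonneg _))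
    have h2 : inner ℝ (M.grad K v x) (x - x₀) ^ 2 ≤ (‖M.grad K v x‖ * D) ^ 2 :=
      sq_le_sq' (abs_le.1 h1).1 (abs_le.1 h1).2
    rw [real_inner_self_eq_norm_sq]
    -- With `s = ∇v · (x - x₀)`: `2 v² + 2 v s ≥ v² - s²` and `s² ≤ D² |∇v|²`.
    nlinarith [sq_nonneg (v x + inner ℝ (M.grad K v x) (x - x₀))]
  have hright : ∑ F ∈ M.bdry, ∫ x, inner ℝ ((v x * v x) • (x - x₀)) (M.normal F) ∂(M.arc F) ≤
      D * M.bdryNormSq v := by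
    rw [bdryNormSq, innerBdry, Finset.mul_sum]
    refine Finset.sum_le_sum fun F _ => ?_
    rw [← integral_const_mul]
    have hs := continuousOn_side hv F
    refine integral_mono_ae
      (integrable_arc_of_continuousOn
        (((hs.mul hs).smul hid'.continuousOn).inner continuousOn_const))
      ((integrable_arc_of_continuousOn (hs.mul hs)).const_mul D) ?_
    filter_upwards [ae_arc_mem_segment F] with x hx
    rw [real_inner_smul_left, mul_comm]
    refine mul_le_mul_of_nonneg_right ?_ (mul_self_nonneg _)
    refine (real_inner_le_norm _ _).trans ?_
    rw [norm_normal, mul_one]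
    exact hdist x (elem_subset_region _ (mem_elem_of_mem_segment hx))
  linarith

/-! ### Coercivity -/

/-- Young's inequality with weight `γ`: the difference of the integrands is `γ⁻¹ (γ ∇v · n - v)²`.
-/
theorem innerBdry_normalDeriv_le (hv : v ∈ M.feSpace P) {γ : ℝ} (hγ : 0 < γ) :
    2 * M.innerBdry (M.normalDeriv v) v ≤
      (∑ F ∈ M.bdry, γ * ∫ x, M.normalDeriv v F x * M.normalDeriv v F x ∂(M.arc F)) +
        γ⁻¹ * M.bdryNormSq v := by
  rw [bdryNormSq, innerBdry, innerBdry, Finset.mul_sum, Finset.mul_sum, ← Finset.sum_add_distrib]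
  refine Finset.sum_le_sum fun F _ => ?_
  have hs := continuousOn_side hv F
  have hn := continuousOn_normalDeriv hv F
  have h1 : Integrable (fun x => M.normalDeriv v F x * v x) (M.arc F) :=
    integrable_arc_of_continuousOn (hn.mul hs)
  have h2 : Integrable (fun x => γ * (M.normalDeriv v F x * M.normalDeriv v F x)) (M.arc F) :=
    (integrable_arc_of_continuousOn (hn.mul hn)).const_mul γ
  have h3 : Integrable (fun x => γ⁻¹ * (v x * v x)) (M.arc F) :=
    (integrable_arc_of_continuousOn (hs.mul hs)).const_mul γ⁻¹
  rw [← integral_const_mul, ← integral_const_mul, ← integral_const_mul, ← integral_add h2 h3]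
  refine integral_mono (h1.const_mul 2) (h2.add h3) fun x => ?_
  simp only
  have h4 : γ * (M.normalDeriv v F x * M.normalDeriv v F x) + γ⁻¹ * (v x * v x) -
      2 * (M.normalDeriv v F x * v x) = γ⁻¹ * (γ * M.normalDeriv v F x - v x) ^ 2 := by
    field_simp
    ring
  have h5 : 0 ≤ γ⁻¹ * (γ * M.normalDeriv v F x - v x) ^ 2 := by positivity
  linarith

theorem exists_coercive (P : ℕ) {σ : ℝ} (hσ : 0 < σ) :
    ∃ Cγ : ℝ, 0 < Cγ ∧ ∃ c : ℝ, 0 < c ∧ ∀ D : ℝ, 0 < D → ∃ κ : ℝ, 0 < κ ∧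
      ∀ (M : TriMesh) (α γ : ℝ), M.ShapeRegular σ → Metric.diam M.region ≤ D → 0 ≤ α → 0 < γ →
        (∀ F ∈ M.bdry, γ ≤ Cγ * M.size F.1) →
        ∀ v ∈ M.feSpace P,
          c * (M.innerGrad v v + α * M.innerDomain v v + γ⁻¹ * M.bdryNormSq v)
              ≤ M.dirichletForm α γ v v ∧
            κ * M.h1Norm v ^ 2 ≤ M.dirichletForm α γ v v := by
  obtain ⟨C, hC, hT⟩ := exists_normalDeriv_le P
  -- The `3` counts the sides of a triangle: each boundary side uses at most a third of the energy
  -- of its triangle, so `γ ‖∇v · n‖²_Γ ≤ ‖∇v‖²_Ω`. The flux term then costs at most half of the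
  -- gradient and penalty terms, whence `c = 1 / 2`.
  set Cγ := 1 / (3 * (C * σ ^ 2)) with hCγ
  have hCγ0 : 0 < Cγ := by positivity
  refine ⟨Cγ, hCγ0, 1 / 2, by norm_num, fun D hD => ?_⟩
  refine ⟨1 / (2 * (1 + D ^ 2 + Cγ * D ^ 2)), by positivity,
    fun M α γ hM hMD hα hγ hγF v hv => ?_⟩
  have hdom := innerDomain_self_nonneg (M := M) v
  have hgrad := innerGrad_self_nonneg (M := M) v
  have hb := bdryNormSq_nonneg (M := M) v
  have hflux : ∑ F ∈ M.bdry, γ * ∫ x, M.normalDeriv v F x * M.normalDeriv v F x ∂(M.arc F) ≤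
      M.innerGrad v v := by
    have h1 : ∀ F ∈ M.bdry,
        γ * ∫ x, M.normalDeriv v F x * M.normalDeriv v F x ∂(M.arc F) ≤
          1 / 3 * ∫ x in M.elem F.1, inner ℝ (M.grad F.1 v x) (M.grad F.1 v x) := by
      intro F hF
      have hs := size_pos F.1
      have hI : 0 ≤ ∫ x in M.elem F.1, inner ℝ (M.grad F.1 v x) (M.grad F.1 v x) :=
        integral_nonneg fun _ => real_inner_self_nonneg
      calc _ ≤ γ * (C * σ ^ 2 / M.size F.1 *
            ∫ x in M.elem F.1, inner ℝ (M.grad F.1 v x) (M.grad F.1 v x)) :=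
            mul_le_mul_of_nonneg_left (hT M σ hσ hM F v hv) hγ.le
        _ ≤ (Cγ * M.size F.1) * (C * σ ^ 2 / M.size F.1 *
            ∫ x in M.elem F.1, inner ℝ (M.grad F.1 v x) (M.grad F.1 v x)) :=
            mul_le_mul_of_nonneg_right (hγF F hF) (by positivity)
        _ = _ := by rw [hCγ]; field_simp
    refine (Finset.sum_le_sum h1).trans ?_
    refine (Finset.sum_le_univ_sum_of_nonneg fun F => by
      have : 0 ≤ ∫ x in M.elem F.1, inner ℝ (M.grad F.1 v x) (M.grad F.1 v x) :=
        integral_nonneg fun _ => real_inner_self_nonneg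
      positivity).trans (le_of_eq ?_)
    rw [Fintype.sum_prod_type, innerGrad]
    refine Finset.sum_congr rfl fun K _ => ?_
    simp only [Finset.sum_const, Finset.card_univ, Fintype.card_fin, nsmul_eq_mul]
    push_cast
    ring
  have h2 := innerBdry_normalDeriv_le hv hγ
  have hform : M.dirichletForm α γ v v = M.innerGrad v v + α * M.innerDomain v v -
      M.innerBdry (M.normalDeriv v) v + γ⁻¹ * M.bdryNormSq v := by
    rw [dirichletForm, formI, penalty_eq]; rfl
  have hαd := mul_nonneg hα hdom
  have hcoer : 1 / 2 * (M.innerGrad v v + α * M.innerDomain v v + γ⁻¹ * M.bdryNormSq v) ≤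
      M.dirichletForm α γ v v := by
    rw [hform]
    linarith
  refine ⟨hcoer, le_trans ?_ hcoer⟩
  -- Makes `κ` independent of `γ`. If there is a boundary side, the bound on `γ` and `h ≤ D` give `γ
  -- ≤ Cγ D`; otherwise the boundary norm is zero.
  have hbd : M.bdryNormSq v ≤ Cγ * D * (γ⁻¹ * M.bdryNormSq v) := by
    obtain hE | ⟨F, hF⟩ := M.bdry.eq_empty_or_nonempty
    · simp [bdryNormSq, innerBdry, hE]
    · have hsz : M.size F.1 ≤ D :=
        (Metric.diam_mono (elem_subset_region _) isCompact_region.isBounded).trans hMD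
      have h3 : γ ≤ Cγ * D := (hγF F hF).trans (mul_le_mul_of_nonneg_left hsz hCγ0.le)
      calc M.bdryNormSq v = γ * (γ⁻¹ * M.bdryNormSq v) := by field_simp
        _ ≤ _ := mul_le_mul_of_nonneg_right h3 (by positivity)
  have hfr := innerDomain_self_le hv hMD
  rw [h1Norm_sq, div_mul_eq_mul_div, div_le_iff₀ (by positivity)]
  have hb' : 0 ≤ γ⁻¹ * M.bdryNormSq v := by positivity
  have h6 : D * M.bdryNormSq v ≤ D * (Cγ * D * (γ⁻¹ * M.bdryNormSq v)) := by gcongr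
  have h7 : 0 ≤ Cγ * D ^ 2 := by positivity
  have h8 : 0 ≤ D ^ 2 := sq_nonneg D
  nlinarith [mul_nonneg h7 hgrad, mul_nonneg h8 hb', mul_nonneg h7 hαd, mul_nonneg h8 hαd]

end TriMesh

/-! ### Linear algebra -/

/-- Definiteness makes `B` injective into the dual, and equality of dimensions makes it surjective.
-/
theorem existsUnique_of_posDef {V : Type*} [AddCommGroup V] [Module ℝ V] [FiniteDimensional ℝ V]
    (B : V →ₗ[ℝ] V →ₗ[ℝ] ℝ) (hB : ∀ v, v ≠ 0 → 0 < B v v) (ℓ : V →ₗ[ℝ] ℝ) :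
    ∃! w, ∀ v, B w v = ℓ v := by
  have hinj : Function.Injective B := by
    rw [← LinearMap.ker_eq_bot, LinearMap.ker_eq_bot']
    intro w hw
    by_contra hne
    have := hB w hne
    simp [hw] at this
  have hfr : Module.finrank ℝ V = Module.finrank ℝ (V →ₗ[ℝ] ℝ) :=
    (Subspace.dual_finrank_eq (K := ℝ) (V := V)).symm
  have hsurj := (LinearMap.injective_iff_surjective_of_finrank_eq_finrank hfr).1 hinj
  obtain ⟨w, hw⟩ := hsurj ℓ
  exact ⟨w, fun v => by rw [hw], fun w' h' => hinj (by rw [hw]; ext v; exact h' v)⟩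

/-! ### Formal power series in `ε` -/

/-- The bounded factor `γ + ε` removes the denominator. By strong induction the bound at order `m`
reduces to `ε ^ m * z m = O(ε ^ (m + 1))`, so the constant `z m` is `O(ε)` and vanishes. Conversely
only the remainder is left, and it has the right order. -/
theorem isBigO_expansion_iff {γ : ℝ} (hγ : 0 < γ) (z r : ℕ → ℝ) :
    (∀ N, (fun ε : ℝ => (∑ m ∈ Finset.range (N + 1), ε ^ m * z m + ε ^ (N + 1) * r N) / (γ + ε))
      =O[𝓝[>] 0] fun ε : ℝ => ε ^ (N + 1)) ↔ ∀ m, z m = 0 := by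
  constructor
  · intro h m
    induction m using Nat.strong_induction_on with
    | _ m ih =>
      have h1 := h m
      have hb : (fun ε : ℝ => γ + ε) =O[𝓝[>] 0] fun _ => (1 : ℝ) := by
        have : Tendsto (fun ε : ℝ => γ + ε) (𝓝[>] 0) (𝓝 (γ + 0)) :=
          (tendsto_const_nhds.add tendsto_id).mono_left nhdsWithin_le_nhds
        exact this.isBigO_one ℝ
      have h2 := (h1.mul hb).congr' (g₁ := fun ε : ℝ => ε ^ (m + 1) * 1)
        (f₂ := fun ε => ε ^ m * z m + ε ^ (m + 1) * r m) (g₂ := fun ε => ε ^ (m + 1))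
        (by
          filter_upwards [self_mem_nhdsWithin] with ε hε
          have : γ + ε ≠ 0 := (add_pos hγ hε).ne'
          rw [Finset.sum_range_succ, Finset.sum_eq_zero fun k hk => by
            rw [ih k (Finset.mem_range.1 hk), mul_zero]]
          field_simp
          ring) (by simp)
      have h3 : (fun ε : ℝ => ε ^ m * z m) =O[𝓝[>] 0] fun ε => ε ^ (m + 1) := by
        have h4 : (fun ε : ℝ => ε ^ (m + 1) * r m) =O[𝓝[>] 0] fun ε => ε ^ (m + 1) := by
          simpa [mul_comm] using (isBigO_refl (fun ε : ℝ => ε ^ (m + 1)) (𝓝[>] 0)).const_mul_left (r m)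
        simpa using h2.sub h4
      have h5 : (fun _ : ℝ => z m) =O[𝓝[>] 0] fun ε : ℝ => ε := by
        obtain ⟨C, hC⟩ := h3.bound
        refine IsBigO.of_bound C ?_
        filter_upwards [hC, self_mem_nhdsWithin] with ε h hε
        have hε' : (0 : ℝ) < ε := hε
        rw [norm_mul, pow_succ, norm_mul, mul_left_comm] at h
        exact le_of_mul_le_mul_left h (norm_pos_iff.2 (pow_pos hε' m).ne')
      have h6 : Tendsto (fun _ : ℝ => z m) (𝓝[>] (0 : ℝ)) (𝓝 0) :=
        h5.trans_tendsto (tendsto_id.mono_left nhdsWithin_le_nhds)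
      exact tendsto_nhds_unique tendsto_const_nhds h6
  · intro h N
    refine IsBigO.of_bound (|r N| / γ) ?_
    filter_upwards [self_mem_nhdsWithin] with ε hε
    have hε' : (0 : ℝ) < ε := hε
    have hp : 0 < ε ^ (N + 1) := pow_pos hε' _
    simp only [h, mul_zero, Finset.sum_const_zero, zero_add, norm_div, norm_mul, Real.norm_eq_abs,
      abs_of_pos hp, abs_of_pos (add_pos hγ hε')]
    rw [div_mul_eq_mul_div, mul_comm]
    gcongr
    linarith

/-! ### The Aubin forms -/

namespace TriMesh

variable {M : TriMesh} {P : ℕ}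

/-- The bilinear form `𝓘_Ω(u) - a (∇u · n, v)_Γ + b (u, v)_Γ`. -/
def aubinForm (M : TriMesh) (P : ℕ) (α a b : ℝ) : M.feSpace P →ₗ[ℝ] M.feSpace P →ₗ[ℝ] ℝ :=
  gradForm M P + α • domainForm M P - a • fluxForm M P + b • traceForm M P

theorem aubinForm_apply (α a b : ℝ) (u v : M.feSpace P) :
    aubinForm M P α a b u v = M.formI α u v - a * M.innerBdry (M.normalDeriv u) v +
      b * M.innerBdry (fun _ => u) v := rfl

theorem dirichletForm_eq (α γ : ℝ) (u v : M.feSpace P) :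
    M.dirichletForm α γ u v = aubinForm M P α 1 γ⁻¹ u v := by
  rw [aubinForm_apply, dirichletForm, penalty_eq, one_mul]

/-- Boundedness of the Robin forms, uniformly in `ε`, for a fixed test function. -/
theorem exists_abs_aubinForm_le (α A B : ℝ) (v : M.feSpace P) :
    ∃ C : ℝ, 0 < C ∧ ∀ a b : ℝ, |a| ≤ A → |b| ≤ B → ∀ u : M.feSpace P,
      |aubinForm M P α a b u v| ≤ C * M.h1Norm u := by
  obtain ⟨C₁, h₁, h₁'⟩ := exists_abs_le_h1Norm ((aubinForm M P α 0 0).flip v)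
  obtain ⟨C₂, h₂, h₂'⟩ := exists_abs_le_h1Norm ((fluxForm M P).flip v)
  obtain ⟨C₃, h₃, h₃'⟩ := exists_abs_le_h1Norm ((traceForm M P).flip v)
  refine ⟨C₁ + |A| * C₂ + |B| * C₃, by positivity, fun a b ha hb u => ?_⟩
  have h1 := h₁' u
  have h2 := h₂' u
  have h3 := h₃' u
  have e : aubinForm M P α a b u v = (aubinForm M P α 0 0).flip v u -
      a * (fluxForm M P).flip v u + b * (traceForm M P).flip v u := by
    simp [aubinForm]
  have ha' : |a * (fluxForm M P).flip v u| ≤ |A| * (C₂ * M.h1Norm u) := by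
    rw [abs_mul]; exact mul_le_mul (ha.trans (le_abs_self A)) h2 (abs_nonneg _) (abs_nonneg _)
  have hb' : |b * (traceForm M P).flip v u| ≤ |B| * (C₃ * M.h1Norm u) := by
    rw [abs_mul]; exact mul_le_mul (hb.trans (le_abs_self B)) h3 (abs_nonneg _) (abs_nonneg _)
  rw [e]
  refine (abs_add_le _ _).trans ?_
  have := abs_sub ((aubinForm M P α 0 0).flip v u) (a * (fluxForm M P).flip v u)
  linarith

/-- The Robin form is a convex combination of the Dirichlet and the Neumann form. -/
theorem robinForm_ge {α γ ε κ : ℝ} (hα : 0 ≤ α) (hγ : 0 < γ) (hε : 0 < ε) (u : M.feSpace P)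
    (h : κ * M.h1Norm u ^ 2 ≤ M.dirichletForm α γ u u) :
    γ / (γ + ε) * (κ * M.h1Norm u ^ 2) ≤
      aubinForm M P α (γ / (γ + ε)) (1 / (γ + ε)) u u := by
  have hs : 0 < γ + ε := add_pos hγ hε
  have e : aubinForm M P α (γ / (γ + ε)) (1 / (γ + ε)) u u =
      γ / (γ + ε) * M.dirichletForm α γ u u + ε / (γ + ε) * M.formI α u u := by
    rw [aubinForm_apply, dirichletForm_eq, aubinForm_apply]
    field_simp
    ring
  have h1 : 0 ≤ M.formI α u u := add_nonneg (innerGrad_self_nonneg _)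
    (mul_nonneg hα (innerDomain_self_nonneg _))
  rw [e]
  have h2 : 0 ≤ ε / (γ + ε) * M.formI α u u := by positivity
  have h3 : γ / (γ + ε) * (κ * M.h1Norm u ^ 2) ≤ γ / (γ + ε) * M.dirichletForm α γ u u := by gcongr
  linarith

end TriMesh

/-! ### The cascade -/

namespace RobinData

open TriMesh

variable {d : RobinData} {M : TriMesh} {P : ℕ} {γ ε : ℝ} {u : ℕ → Plane → ℝ}

theorem SquareIntegrable.integrableOn (h : d.SquareIntegrable M) : IntegrableOn d.f M.region := by
  have : IsFiniteMeasure (volume.restrict M.region) :=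
    ⟨by simpa using isCompact_region.measure_lt_top⟩
  exact h.1.integrable (by norm_num)

theorem SquareIntegrable.uRD (h : d.SquareIntegrable M) : M.BdryIntegrable fun _ => d.uRD :=
  fun F hF => (h.2 F hF).1.integrable (by norm_num)

theorem SquareIntegrable.qRN (h : d.SquareIntegrable M) : M.BdryIntegrable fun _ => d.qRN :=
  fun F hF => (h.2 F hF).2.integrable (by norm_num)

theorem SquareIntegrable.source (h : d.SquareIntegrable M) (m : ℕ) :
    IntegrableOn (d.source m) M.region := by
  unfold RobinData.source
  by_cases hm : m = 0
  · simpa [hm] using h.integrableOn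
  · simp [hm]

theorem SquareIntegrable.modeData (h : d.SquareIntegrable M) (hu : ∀ m, u m ∈ M.feSpace P) :
    ∀ m, M.BdryIntegrable (d.modeData M u m)
  | 0 => h.uRD
  | 1 => h.qRN.sub (bdryIntegrable_normalDeriv (hu 0))
  | m + 2 => fun F hF => (bdryIntegrable_normalDeriv (hu (m + 1)) F hF).neg

/-- The data of order `m` involve only earlier modes, so the problem for `u_m` is affine in `u_m`
with the classical Dirichlet form as linear part. -/
theorem modeData_congr {u' : ℕ → Plane → ℝ} :
    ∀ {m : ℕ}, (∀ k < m, u k = u' k) → d.modeData M u m = d.modeData M u' m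
  | 0, _ => rfl
  | 1, h => by ext F x; simp only [RobinData.modeData, h 0 one_pos]
  | m + 2, h => by ext F x; simp only [RobinData.modeData, h (m + 1) (by omega)]

/-- The part `𝓘_Ω(u_m) - (f_m, v)_Ω - (∇u_m · n, v)_Γ` of the residual of the mode of order `m`. -/
def bulkFunctional (h : d.SquareIntegrable M) (hu : ∀ m, u m ∈ M.feSpace P) (m : ℕ) :
    M.feSpace P →ₗ[ℝ] ℝ :=
  aubinForm M P d.α 1 0 ⟨u m, hu m⟩ - sourceFunctional P (h.source m)

/-- The penalty of the Dirichlet data of order `m`. -/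
def dataFunctional (γ : ℝ) (h : d.SquareIntegrable M) (hu : ∀ m, u m ∈ M.feSpace P) (m : ℕ) :
    M.feSpace P →ₗ[ℝ] ℝ :=
  γ⁻¹ • bdryFunctional P (h.modeData hu m)

/-- The penalty `𝓐_Γ(u_m - u_{D,m})` as a functional. -/
def penaltyFunctional (γ : ℝ) (h : d.SquareIntegrable M) (hu : ∀ m, u m ∈ M.feSpace P) (m : ℕ) :
    M.feSpace P →ₗ[ℝ] ℝ :=
  γ⁻¹ • traceForm M P ⟨u m, hu m⟩ - dataFunctional γ h hu m

theorem bulkFunctional_apply (h : d.SquareIntegrable M) (hu : ∀ m, u m ∈ M.feSpace P) (m : ℕ)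
    (v : M.feSpace P) : bulkFunctional h hu m v = M.formI d.α (u m) v -
      M.innerDomain (d.source m) v - M.innerBdry (M.normalDeriv (u m)) v := by
  have e : bulkFunctional h hu m v = aubinForm M P d.α 1 0 ⟨u m, hu m⟩ v -
    M.innerDomain (d.source m) v := rfl
  rw [e, aubinForm_apply]
  ring

theorem penaltyFunctional_apply (h : d.SquareIntegrable M) (hu : ∀ m, u m ∈ M.feSpace P) (m : ℕ)
    (v : M.feSpace P) : penaltyFunctional γ h hu m v = d.modePenalty M γ u m v := by
  rw [modePenalty, penalty_eq, innerBdry_sub_left (bdryIntegrable_trace (hu m))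
    (h.modeData hu m) v.2, mul_sub]
  rfl

/-- The functional in the bilinear formulation of the Robin problem. -/
def robinLoad (γ ε : ℝ) (P : ℕ) (h : d.SquareIntegrable M) : M.feSpace P →ₗ[ℝ] ℝ :=
  sourceFunctional P h.integrableOn + (1 / (γ + ε)) • bdryFunctional P h.uRD +
    (ε / (γ + ε)) • bdryFunctional P h.qRN

/-- Consistency and Robin flux terms combine, since `1 - ε / (γ + ε) = γ / (γ + ε)`, and the factor
`γ⁻¹` of the penalty turns its weight into `1 / (γ + ε)`. -/
theorem robinResidual_eq (h : d.SquareIntegrable M) (hγ : 0 < γ) (hε : 0 < ε)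
    (w v : M.feSpace P) : d.robinResidual M γ ε w v =
      aubinForm M P d.α (γ / (γ + ε)) (1 / (γ + ε)) w v - robinLoad γ ε P h v := by
  have e : robinLoad γ ε P h v = M.innerDomain d.f v + 1 / (γ + ε) * M.innerBdry (fun _ => d.uRD) v +
    ε / (γ + ε) * M.innerBdry (fun _ => d.qRN) v := rfl
  have hs : γ + ε ≠ 0 := (add_pos hγ hε).ne'
  rw [e, aubinForm_apply, robinResidual, penalty_eq, penalty_eq,
    innerBdry_sub_left (g := fun _ => (w : Plane → ℝ)) (g' := fun _ => d.uRD)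
      (bdryIntegrable_trace w.2) h.uRD v.2,
    innerBdry_sub_left (g := M.normalDeriv w) (g' := fun _ => d.qRN)
      (bdryIntegrable_normalDeriv w.2) h.qRN v.2]
  field_simp
  ring

/-! ### The residual of the truncated expansion -/

theorem partialExpansion_succ (u : ℕ → Plane → ℝ) (N : ℕ) (ε : ℝ) :
    partialExpansion u (N + 1) ε = partialExpansion u N ε + ε ^ (N + 1) • u (N + 1) := by
  ext x
  simp [partialExpansion, Finset.sum_range_succ]

theorem partialExpansion_zero (u : ℕ → Plane → ℝ) (ε : ℝ) : partialExpansion u 0 ε = u 0 := by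
  ext x
  simp [partialExpansion]

theorem partialExpansion_mem (hu : ∀ m, u m ∈ M.feSpace P) (N : ℕ) (ε : ℝ) :
    partialExpansion u N ε ∈ M.feSpace P := by
  induction N with
  | zero => rw [partialExpansion_zero]; exact hu 0
  | succ N ih =>
    rw [partialExpansion_succ]
    exact (M.feSpace P).add_mem ih ((M.feSpace P).smul_mem _ (hu _))

theorem dataFunctional_zero_apply (h : d.SquareIntegrable M) (hu : ∀ m, u m ∈ M.feSpace P)
    (v : M.feSpace P) : dataFunctional γ h hu 0 v = γ⁻¹ * M.innerBdry (fun _ => d.uRD) v := rfl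

theorem dataFunctional_one_apply (h : d.SquareIntegrable M) (hu : ∀ m, u m ∈ M.feSpace P)
    (v : M.feSpace P) : dataFunctional γ h hu 1 v = γ⁻¹ * (M.innerBdry (fun _ => d.qRN) v -
      M.innerBdry (M.normalDeriv (u 0)) v) := by
  rw [← innerBdry_sub_left h.qRN (bdryIntegrable_normalDeriv (hu 0)) v.2]
  rfl

theorem dataFunctional_add_two_apply (h : d.SquareIntegrable M) (hu : ∀ m, u m ∈ M.feSpace P)
    (m : ℕ) (v : M.feSpace P) : dataFunctional γ h hu (m + 2) v =
      - (γ⁻¹ * M.innerBdry (M.normalDeriv (u (m + 1))) v) := by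
  have e : dataFunctional γ h hu (m + 2) v =
    γ⁻¹ * M.innerBdry (fun F x => - M.normalDeriv (u (m + 1)) F x) v := rfl
  have e2 := innerBdry_smul_left (M := M) (-1) (M.normalDeriv (u (m + 1))) v
  simp only [neg_mul, one_mul] at e2
  rw [e, e2]
  ring

/-- Multiplied by `ε`, the Robin flux term of `u_m` is minus the Dirichlet datum of order `m + 1`
and joins the penalty of that order. Only the datum of order `N + 1` finds no partner in the
truncated sum. -/
theorem robinResidual_partialExpansion (h : d.SquareIntegrable M) (hγ : 0 < γ) (hε : 0 < ε)
    (hu : ∀ m, u m ∈ M.feSpace P) (N : ℕ) (v : M.feSpace P) :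
    d.robinResidual M γ ε (partialExpansion u N ε) v =
      ∑ m ∈ Finset.range (N + 1), ε ^ m * bulkFunctional h hu m v + γ / (γ + ε) *
        (∑ m ∈ Finset.range (N + 1), ε ^ m * penaltyFunctional γ h hu m v -
          ε ^ (N + 1) * dataFunctional γ h hu (N + 1) v) := by
  have hs : γ + ε ≠ 0 := (add_pos hγ hε).ne'
  have hb0 : ∀ m, bulkFunctional h hu m v = M.formI d.α (u m) v -
      M.innerDomain (d.source m) v - M.innerBdry (M.normalDeriv (u m)) v :=
    fun m => bulkFunctional_apply h hu m v
  have hp : ∀ m, penaltyFunctional γ h hu m v =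
      γ⁻¹ * M.innerBdry (fun _ => u m) v - dataFunctional γ h hu m v := fun m => rfl
  have hload : robinLoad γ ε P h v = M.innerDomain d.f v +
    1 / (γ + ε) * M.innerBdry (fun _ => d.uRD) v +
    ε / (γ + ε) * M.innerBdry (fun _ => d.qRN) v := rfl
  induction N with
  | zero =>
    rw [partialExpansion_zero, robinResidual_eq h hγ hε ⟨u 0, hu 0⟩ v, aubinForm_apply, hload]
    have hsrc : d.source 0 = d.f := by ext x; simp [source]
    simp only [zero_add, Finset.sum_range_one, pow_zero, one_mul, pow_one, hb0, hp,
      dataFunctional_zero_apply, dataFunctional_one_apply, hsrc]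
    field_simp
    ring
  | succ N ih =>
    have hlin : d.robinResidual M γ ε (partialExpansion u (N + 1) ε) v =
        d.robinResidual M γ ε (partialExpansion u N ε) v +
          ε ^ (N + 1) * aubinForm M P d.α (γ / (γ + ε)) (1 / (γ + ε))
            ⟨u (N + 1), hu (N + 1)⟩ v := by
      rw [robinResidual_eq h hγ hε ⟨_, partialExpansion_mem hu N ε⟩ v,
        robinResidual_eq h hγ hε ⟨_, partialExpansion_mem hu (N + 1) ε⟩ v]
      have : (⟨_, partialExpansion_mem hu (N + 1) ε⟩ : M.feSpace P) =
          ⟨_, partialExpansion_mem hu N ε⟩ + ε ^ (N + 1) • ⟨u (N + 1), hu (N + 1)⟩ :=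
        Subtype.ext (partialExpansion_succ u N ε)
      rw [this, map_add, map_smul, LinearMap.add_apply, LinearMap.smul_apply, smul_eq_mul]
      ring
    have hsrc : M.innerDomain (d.source (N + 1)) v = 0 := by simp [source, innerDomain]
    rw [hlin, ih, Finset.sum_range_succ _ (N + 1), Finset.sum_range_succ _ (N + 1), hb0 (N + 1),
      hp (N + 1), dataFunctional_add_two_apply, aubinForm_apply, hsrc]
    generalize dataFunctional γ h hu (N + 1) v = D
    generalize M.innerBdry (M.normalDeriv (u (N + 1))) v = q
    generalize M.innerBdry (fun _ => u (N + 1)) v = t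
    generalize M.formI d.α (u (N + 1)) v = i
    generalize ∑ m ∈ Finset.range (N + 1), ε ^ m * bulkFunctional h hu m v = s
    generalize ∑ m ∈ Finset.range (N + 1), ε ^ m * penaltyFunctional γ h hu m v = s'
    have hγ' := hγ.ne'
    field_simp
    ring

/-- The coefficient of `ε^m` in the residual of the ansatz, multiplied by `γ + ε`. -/
def coefficient (γ : ℝ) (h : d.SquareIntegrable M) (hu : ∀ m, u m ∈ M.feSpace P)
    (v : M.feSpace P) : ℕ → ℝ
  | 0 => γ * (bulkFunctional h hu 0 v + penaltyFunctional γ h hu 0 v)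
  | m + 1 => γ * (bulkFunctional h hu (m + 1) v + penaltyFunctional γ h hu (m + 1) v) +
      bulkFunctional h hu m v

/-- The coefficient of `ε^{N+1}` in the residual of the truncated ansatz, multiplied by `γ + ε`. -/
def remainder (γ : ℝ) (h : d.SquareIntegrable M) (hu : ∀ m, u m ∈ M.feSpace P) (N : ℕ) :
    M.feSpace P →ₗ[ℝ] ℝ :=
  bulkFunctional h hu N - γ • dataFunctional γ h hu (N + 1)

/-- Multiplied by `γ + ε`, the bulk term of order `m` contributes to orders `m` and `m + 1`; the
contribution of the last one goes into the remainder. -/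
theorem robinResidual_eq_coefficient (h : d.SquareIntegrable M) (hγ : 0 < γ) (hε : 0 < ε)
    (hu : ∀ m, u m ∈ M.feSpace P) (N : ℕ) (v : M.feSpace P) :
    d.robinResidual M γ ε (partialExpansion u N ε) v =
      (∑ m ∈ Finset.range (N + 1), ε ^ m * coefficient γ h hu v m +
        ε ^ (N + 1) * remainder γ h hu N v) / (γ + ε) := by
  have hs : γ + ε ≠ 0 := (add_pos hγ hε).ne'
  rw [robinResidual_partialExpansion h hγ hε hu N v]
  have hsum : ∑ m ∈ Finset.range (N + 1), ε ^ m * coefficient γ h hu v m +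
      ε ^ (N + 1) * bulkFunctional h hu N v =
      (γ + ε) * ∑ m ∈ Finset.range (N + 1), ε ^ m * bulkFunctional h hu m v +
        γ * ∑ m ∈ Finset.range (N + 1), ε ^ m * penaltyFunctional γ h hu m v := by
    induction N with
    | zero => simp [coefficient]; ring
    | succ N ih =>
      rw [Finset.sum_range_succ _ (N + 1), Finset.sum_range_succ _ (N + 1),
        Finset.sum_range_succ _ (N + 1), mul_add, mul_add, eq_sub_of_add_eq ih]
      simp only [coefficient]
      ring
  have hr : remainder γ h hu N v = bulkFunctional h hu N v -
    γ * dataFunctional γ h hu (N + 1) v := rfl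
  rw [hr, mul_sub (ε ^ (N + 1)), ← add_sub_assoc, hsum]
  field_simp
  ring

/-! ### The recursion of the error terms -/

theorem errorTerm_zero (v : Plane → ℝ) : d.errorTerm M γ u 0 v = 0 := by simp [errorTerm]

/-- Raising the order multiplies every old term by `(-γ)⁻¹` and adds the term `ℓ = m` with that same
factor. -/
theorem errorTerm_succ (hγ : 0 < γ) (m : ℕ) (v : Plane → ℝ) :
    d.errorTerm M γ u (m + 1) v =
      - γ⁻¹ * (d.errorTerm M γ u m v - d.modePenalty M γ u m v) := by
  have hne : -γ ≠ 0 := neg_ne_zero.2 hγ.ne'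
  have h1 : ∀ l : ℕ, (-γ) ^ (-(((m + 1 : ℕ) : ℤ) - (l : ℤ))) =
      - γ⁻¹ * (-γ) ^ (-((m : ℤ) - (l : ℤ))) := by
    intro l
    have : -(((m + 1 : ℕ) : ℤ) - (l : ℤ)) = -1 + -((m : ℤ) - (l : ℤ)) := by push_cast; ring
    rw [this, zpow_add₀ hne, zpow_neg_one, inv_neg]
  simp only [errorTerm, Finset.sum_range_succ, h1, sub_self, neg_zero, zpow_zero, mul_assoc,
    ← Finset.mul_sum]
  ring

theorem modeEquation_iff (h : d.SquareIntegrable M) (hu : ∀ m, u m ∈ M.feSpace P) (m : ℕ)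
    (v : M.feSpace P) : d.ModeEquation M γ u m v ↔
      bulkFunctional h hu m v + penaltyFunctional γ h hu m v = d.errorTerm M γ u m v := by
  rw [bulkFunctional_apply, penaltyFunctional_apply]
  rfl

/-- Once the equation of order `m` holds, the recursion turns the next error term into `-γ⁻¹` times
the bulk term of order `m`, so the equation of order `m + 1` is the vanishing of the coefficient of
that order. -/
theorem forall_coefficient_eq_zero_iff (h : d.SquareIntegrable M) (hγ : 0 < γ)
    (hu : ∀ m, u m ∈ M.feSpace P) (v : M.feSpace P) :
    (∀ m, coefficient γ h hu v m = 0) ↔ ∀ m, d.ModeEquation M γ u m v := by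
  simp only [modeEquation_iff h hu]
  have hstep : ∀ m, bulkFunctional h hu m v + penaltyFunctional γ h hu m v =
      d.errorTerm M γ u m v →
      d.errorTerm M γ u (m + 1) v = - γ⁻¹ * bulkFunctional h hu m v := by
    intro m hm
    rw [errorTerm_succ hγ, ← hm, penaltyFunctional_apply, add_sub_cancel_right]
  constructor
  · intro hc m
    induction m with
    | zero =>
      rw [errorTerm_zero]
      exact (mul_eq_zero.1 (hc 0)).resolve_left hγ.ne'
    | succ m ih =>
      rw [hstep m ih]
      have := hc (m + 1)
      simp only [coefficient] at this
      field_simp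
      linarith
  · intro hm m
    cases m with
    | zero =>
      have := hm 0
      rw [errorTerm_zero] at this
      simp [coefficient, this]
    | succ m =>
      simp only [coefficient]
      rw [hm (m + 1), hstep m (hm m)]
      field_simp
      ring

theorem isFormalSolution_iff (h : d.SquareIntegrable M) (hγ : 0 < γ)
    (hu : ∀ m, u m ∈ M.feSpace P) :
    d.IsFormalSolution M P γ u ↔ d.SolvesCascade M P γ u := by
  have key : ∀ v : M.feSpace P, (∀ N : ℕ,
      (fun ε : ℝ => d.robinResidual M γ ε (partialExpansion u N ε) v)
        =O[𝓝[>] 0] (fun ε : ℝ => ε ^ (N + 1))) ↔ ∀ m, d.ModeEquation M γ u m v := by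
    intro v
    rw [← forall_coefficient_eq_zero_iff h hγ hu v,
      ← isBigO_expansion_iff hγ _ fun N => remainder γ h hu N v]
    refine forall_congr' fun N => isBigO_congr ?_ EventuallyEq.rfl
    filter_upwards [self_mem_nhdsWithin] with ε hε
    exact robinResidual_eq_coefficient h hγ hε hu N v
  constructor
  · exact fun hF m v hv => (key ⟨v, hv⟩).1 (hF v hv) m
  · exact fun hC v hv => (key ⟨v, hv⟩).2 fun m => hC m v hv

/-- The residual of the partial sum is minus the Robin form at `U ε` minus that sum. For fixed `v`
it is bounded by the norm of `H¹` uniformly in `ε`, because the form's coefficients stay below `1`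
and `1 / γ`. No coercivity is involved. -/
theorem solvesCascade_of_isAsymptoticExpansion (h : d.SquareIntegrable M) (hγ : 0 < γ)
    {U : ℝ → Plane → ℝ} (hu : ∀ m, u m ∈ M.feSpace P)
    (hU : ∀ᶠ ε in 𝓝[>] (0 : ℝ), d.IsRobinSolution M P γ ε (U ε))
    (hUu : IsAsymptoticExpansion M U u) : d.SolvesCascade M P γ u := by
  rw [← isFormalSolution_iff h hγ hu]
  intro v hv N
  obtain ⟨C, hC, hb⟩ := exists_abs_aubinForm_le d.α 1 (1 / γ) (⟨v, hv⟩ : M.feSpace P)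
  refine IsBigO.trans (IsBigO.of_bound C ?_) (hUu N)
  filter_upwards [hU, self_mem_nhdsWithin] with ε hε hpos
  have hpos' : (0 : ℝ) < ε := hpos
  have hs : 0 < γ + ε := add_pos hγ hpos'
  have e1 := robinResidual_eq h hγ hpos' ⟨U ε, hε.1⟩ ⟨v, hv⟩
  rw [hε.2 v hv] at e1
  have e2 := robinResidual_eq h hγ hpos' ⟨_, partialExpansion_mem hu N ε⟩ ⟨v, hv⟩
  have e3 : d.robinResidual M γ ε (partialExpansion u N ε) v =
      - aubinForm M P d.α (γ / (γ + ε)) (1 / (γ + ε))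
        (⟨U ε, hε.1⟩ - ⟨_, partialExpansion_mem hu N ε⟩) ⟨v, hv⟩ := by
    rw [map_sub, LinearMap.sub_apply]
    linarith
  rw [e3, norm_neg, Real.norm_eq_abs, Real.norm_of_nonneg (h1Norm_nonneg _)]
  refine hb _ _ ?_ ?_ _
  · rw [abs_of_pos (div_pos hγ hs), div_le_one hs]; linarith
  · rw [abs_of_pos (div_pos one_pos hs)]
    exact one_div_le_one_div_of_le hγ (by linarith)

theorem IsExactModes.modePenalty_eq_zero (hu : d.IsExactModes M u) (m : ℕ) (v : Plane → ℝ) :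
    d.modePenalty M γ u m v = 0 := by
  rw [modePenalty, penalty_eq, innerBdry_congr_left (g' := fun _ _ => 0) (fun F hF => ?_)]
  · simp [innerBdry]
  · filter_upwards [(hu m).2.2.2 F hF] with x hx
    rw [hx, sub_self]

theorem IsExactModes.errorTerm_eq_zero (hu : d.IsExactModes M u) (m : ℕ) (v : Plane → ℝ) :
    d.errorTerm M γ u m v = 0 := by
  simp [errorTerm, hu.modePenalty_eq_zero]

/-- Penalty and error terms vanish, and what remains is Green's formula with `Δu_m = α u_m - f_m`.
-/
theorem IsExactModes.solvesCascade (h : d.SquareIntegrable M) (hu : d.IsExactModes M u) :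
    d.SolvesCascade M P γ u := by
  intro m v hv
  obtain ⟨h1, h2, h3, -⟩ := hu m
  have hum : IntegrableOn (u m) M.region := h1.continuousOn.integrableOn_compact isCompact_region
  have hg : IntegrableOn (fun x => d.α * u m x - d.source m x) M.region :=
    (hum.const_mul d.α).sub (h.source m)
  have key := green_formula h1 h2 hg (fun x hx => by linarith [h3 x hx]) hv
  have e : M.innerDomain (fun x => d.α * u m x - d.source m x) v =
      d.α * M.innerDomain (u m) v - M.innerDomain (d.source m) v := by
    simp only [innerDomain, ← integral_const_mul]
    rw [← integral_sub ((integrableOn_region_mul hum hv).const_mul d.α)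
      (integrableOn_region_mul (h.source m) hv)]
    congr 1; ext x; ring
  rw [ModeEquation, hu.modePenalty_eq_zero, hu.errorTerm_eq_zero, formI]
  linarith

/-! ### Solvability -/

theorem existsUnique_mode (h : d.SquareIntegrable M)
    (hcoer : ∀ v : M.feSpace P, v ≠ 0 → 0 < M.dirichletForm d.α γ v v)
    (hu : ∀ m, u m ∈ M.feSpace P) (m : ℕ) : ∃! w : Plane → ℝ, w ∈ M.feSpace P ∧
      ∀ v ∈ M.feSpace P, d.ModeEquation M γ (Function.update u m w) m v := by
  -- Collects all that depends on the earlier modes and the data; replacing the entry `m` of the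
  -- sequence does not change it.
  let ℓ : M.feSpace P →ₗ[ℝ] ℝ := sourceFunctional P (h.source m) + dataFunctional γ h hu m -
    ∑ l ∈ Finset.range m, (-γ) ^ (-((m : ℤ) - (l : ℤ))) • penaltyFunctional γ h hu l
  have hiff : ∀ w v : M.feSpace P, d.ModeEquation M γ (Function.update u m w) m v ↔
      aubinForm M P d.α 1 γ⁻¹ w v = ℓ v := by
    intro w v
    have hdata : ∀ l ≤ m, d.modeData M (Function.update u m w) l = d.modeData M u l :=
      fun l hl => modeData_congr fun k hk => Function.update_of_ne (by omega) _ _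
    have hpen : ∀ l ∈ Finset.range m, d.modePenalty M γ (Function.update u m w) l v =
        penaltyFunctional γ h hu l v := by
      intro l hl
      have hl' := Finset.mem_range.1 hl
      rw [penaltyFunctional_apply, modePenalty, modePenalty, hdata l hl'.le,
        Function.update_of_ne hl'.ne]
    have herr : d.errorTerm M γ (Function.update u m w) m v =
        - ∑ l ∈ Finset.range m, (-γ) ^ (-((m : ℤ) - (l : ℤ))) * penaltyFunctional γ h hu l v := by
      rw [errorTerm, Finset.sum_congr rfl fun l hl => by rw [hpen l hl]]
    have hm : d.modePenalty M γ (Function.update u m w) m v =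
        γ⁻¹ * M.innerBdry (fun _ => w) v - dataFunctional γ h hu m v := by
      rw [modePenalty, hdata m le_rfl, Function.update_self, penalty_eq, innerBdry_sub_left
        (bdryIntegrable_trace w.2) (h.modeData hu m) v.2, mul_sub]
      rfl
    have hℓ : ℓ v = M.innerDomain (d.source m) v + dataFunctional γ h hu m v -
        ∑ l ∈ Finset.range m, (-γ) ^ (-((m : ℤ) - (l : ℤ))) * penaltyFunctional γ h hu l v := by
      simp only [ℓ, LinearMap.sub_apply, LinearMap.add_apply, LinearMap.sum_apply,
        LinearMap.smul_apply, smul_eq_mul]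
      rfl
    rw [ModeEquation, herr, hm, hℓ, Function.update_self, aubinForm_apply]
    constructor <;> intro hh <;> linarith
  obtain ⟨w, hw, huniq⟩ := existsUnique_of_posDef (aubinForm M P d.α 1 γ⁻¹)
    (fun v hv => by rw [← dirichletForm_eq]; exact hcoer v hv) ℓ
  refine ⟨w, ⟨w.2, fun v hv => (hiff w ⟨v, hv⟩).2 (hw _)⟩, fun w' hw' => ?_⟩
  exact congrArg Subtype.val (huniq ⟨w', hw'.1⟩ fun v =>
    (hiff ⟨w', hw'.1⟩ v).1 (hw'.2 v v.2))

theorem existsUnique_robinSolution (h : d.SquareIntegrable M) (hγ : 0 < γ) (hε : 0 < ε)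
    (hcoer : ∀ v : M.feSpace P, v ≠ 0 →
      0 < aubinForm M P d.α (γ / (γ + ε)) (1 / (γ + ε)) v v) :
    ∃! w : Plane → ℝ, d.IsRobinSolution M P γ ε w := by
  obtain ⟨w, hw, huniq⟩ := existsUnique_of_posDef _ hcoer (robinLoad γ ε P h)
  refine ⟨w, ⟨w.2, fun v hv => ?_⟩, fun w' hw' => ?_⟩
  · rw [robinResidual_eq h hγ hε w ⟨v, hv⟩, hw, sub_self]
  · refine congrArg Subtype.val (huniq ⟨w', hw'.1⟩ fun v => ?_)
    rw [← sub_eq_zero, ← robinResidual_eq h hγ hε]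
    exact hw'.2 v v.2

/-- Test the equation of the error with the error `e` itself. The cascade annihilates every
coefficient for this test function, leaving `ε ^ (N + 1)` times the remainder over `γ + ε`. The
coercivity constant of the Robin form is `γ κ / (γ + ε)`, so the denominators cancel and the final
constant does not depend on `ε`. -/
theorem isAsymptoticExpansion_of_solvesCascade {κ : ℝ} (h : d.SquareIntegrable M) (hγ : 0 < γ)
    (hα : 0 ≤ d.α) (hκ : 0 < κ)
    (hcoer : ∀ v ∈ M.feSpace P, κ * M.h1Norm v ^ 2 ≤ M.dirichletForm d.α γ v v)
    {U : ℝ → Plane → ℝ} (hu : ∀ m, u m ∈ M.feSpace P)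
    (hU : ∀ ε : ℝ, 0 < ε → d.IsRobinSolution M P γ ε (U ε))
    (hC : d.SolvesCascade M P γ u) : IsAsymptoticExpansion M U u := by
  intro N
  obtain ⟨C, hC0, hb⟩ := exists_abs_le_h1Norm (remainder γ h hu N)
  refine IsBigO.of_bound (C / (γ * κ)) ?_
  filter_upwards [self_mem_nhdsWithin] with ε hε
  have hε' : (0 : ℝ) < ε := hε
  have hs : 0 < γ + ε := add_pos hγ hε'
  let e : M.feSpace P := ⟨U ε, (hU ε hε').1⟩ - ⟨_, partialExpansion_mem hu N ε⟩
  have hce : ∀ m, coefficient γ h hu e m = 0 :=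
    (forall_coefficient_eq_zero_iff h hγ hu e).2 fun m => hC m e e.2
  have e1 := robinResidual_eq h hγ hε' ⟨U ε, (hU ε hε').1⟩ e
  rw [(hU ε hε').2 e e.2] at e1
  have e2 := robinResidual_eq h hγ hε' ⟨_, partialExpansion_mem hu N ε⟩ e
  rw [robinResidual_eq_coefficient h hγ hε' hu N e] at e2
  simp only [hce, mul_zero, Finset.sum_const_zero, zero_add] at e2
  have e3 : aubinForm M P d.α (γ / (γ + ε)) (1 / (γ + ε)) e e =
      - (ε ^ (N + 1) * remainder γ h hu N e / (γ + ε)) := by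
    rw [e2]
    conv_lhs => rw [show aubinForm M P d.α (γ / (γ + ε)) (1 / (γ + ε)) e =
      aubinForm M P d.α (γ / (γ + ε)) (1 / (γ + ε)) ⟨U ε, (hU ε hε').1⟩ -
      aubinForm M P d.α (γ / (γ + ε)) (1 / (γ + ε)) ⟨_, partialExpansion_mem hu N ε⟩ from
      map_sub _ _ _, LinearMap.sub_apply]
    linarith
  have e4 := robinForm_ge hα hγ hε' e (hcoer e e.2)
  have hp : 0 < ε ^ (N + 1) := pow_pos hε' _
  have hn := h1Norm_nonneg (M := M) e
  have e5 : γ * κ * M.h1Norm e ^ 2 ≤ ε ^ (N + 1) * (C * M.h1Norm e) := by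
    rw [e3, ← neg_div, div_mul_eq_mul_div, div_le_div_iff_of_pos_right hs] at e4
    have h1 := (neg_le_abs _).trans (hb e)
    have h2 := mul_le_mul_of_nonneg_left h1 hp.le
    linarith
  have hgk : 0 < γ * κ := mul_pos hγ hκ
  have e6 : M.h1Norm e ≤ C / (γ * κ) * ε ^ (N + 1) := by
    rw [div_mul_eq_mul_div, le_div_iff₀ hgk]
    -- The quadratic bound is divided by the norm of the error, which may be zero.
    rcases hn.eq_or_lt with h0 | h0
    · rw [← h0, zero_mul]; positivity
    · refine le_of_mul_le_mul_right ?_ h0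
      linarith
  rw [Real.norm_of_nonneg (h1Norm_nonneg _), Real.norm_of_nonneg hp.le]
  exact e6

end RobinData

end

/-! ### Cascade, consistency and coercivity together -/

theorem proposition4p3 (P : ℕ) :
    -- the modes of the expansion solve the cascade, which is consistent with the exact one
    (∀ (M : TriMesh) (d : RobinData) (γ : ℝ), d.SquareIntegrable M → 0 < γ →
      (∀ u : ℕ → Plane → ℝ, (∀ m, u m ∈ M.feSpace P) →
        (d.IsFormalSolution M P γ u ↔ d.SolvesCascade M P γ u)) ∧
      (∀ (U : ℝ → Plane → ℝ) (u : ℕ → Plane → ℝ), (∀ m, u m ∈ M.feSpace P) →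
        (∀ᶠ ε in 𝓝[>] (0 : ℝ), d.IsRobinSolution M P γ ε (U ε)) →
        IsAsymptoticExpansion M U u → d.SolvesCascade M P γ u) ∧
      (∀ u : ℕ → Plane → ℝ, d.IsExactModes M u →
        d.SolvesCascade M P γ u ∧ ∀ m, ∀ v ∈ M.feSpace P, d.errorTerm M γ u m v = 0)) ∧
    -- the problems of the cascade are coercive, hence they determine the modes one by one
    (∀ σ : ℝ, 0 < σ → ∃ Cγ : ℝ, 0 < Cγ ∧ ∃ c : ℝ, 0 < c ∧ ∀ D : ℝ, 0 < D → ∃ κ : ℝ, 0 < κ ∧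
      ∀ (M : TriMesh) (α γ : ℝ), M.ShapeRegular σ → Metric.diam M.region ≤ D → 0 ≤ α → 0 < γ →
        (∀ F ∈ M.bdry, γ ≤ Cγ * M.size F.1) →
        (∀ v ∈ M.feSpace P,
          c * (M.innerGrad v v + α * M.innerDomain v v + γ⁻¹ * M.bdryNormSq v)
              ≤ M.dirichletForm α γ v v ∧
            κ * M.h1Norm v ^ 2 ≤ M.dirichletForm α γ v v) ∧
        (∀ d : RobinData, d.α = α → d.SquareIntegrable M →
          (∀ u : ℕ → Plane → ℝ, (∀ m, u m ∈ M.feSpace P) → ∀ m, ∃! w : Plane → ℝ,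
            w ∈ M.feSpace P ∧
              ∀ v ∈ M.feSpace P, d.ModeEquation M γ (Function.update u m w) m v) ∧
          (∀ ε : ℝ, 0 < ε → ∃! w : Plane → ℝ, d.IsRobinSolution M P γ ε w) ∧
          (∀ (U : ℝ → Plane → ℝ) (u : ℕ → Plane → ℝ), (∀ m, u m ∈ M.feSpace P) →
            (∀ ε : ℝ, 0 < ε → d.IsRobinSolution M P γ ε (U ε)) →
            d.SolvesCascade M P γ u → IsAsymptoticExpansion M U u))) := by
  refine ⟨fun M d γ hd hγ => ⟨fun u hu => RobinData.isFormalSolution_iff hd hγ hu,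
    fun U u hu hU hUu => RobinData.solvesCascade_of_isAsymptoticExpansion hd hγ hu hU hUu,
    fun u hu => ⟨RobinData.IsExactModes.solvesCascade hd hu,
      fun m v _ => RobinData.IsExactModes.errorTerm_eq_zero hu m v⟩⟩, fun σ hσ => ?_⟩
  obtain ⟨Cγ, hCγ, c, hc, hcoer⟩ := TriMesh.exists_coercive P hσ
  refine ⟨Cγ, hCγ, c, hc, fun D hD => ?_⟩
  obtain ⟨κ, hκ, hcoer⟩ := hcoer D hD
  refine ⟨κ, hκ, fun M α γ hM hMD hα hγ hγF => ?_⟩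
  have hcoer := hcoer M α γ hM hMD hα hγ hγF
  refine ⟨hcoer, ?_⟩
  rintro d rfl hd
  have hpos : ∀ v : M.feSpace P, v ≠ 0 → 0 < M.h1Norm v ^ 2 := fun v hv =>
    TriMesh.h1Norm_sq_pos v.2 fun h => hv (Subtype.ext h)
  refine ⟨fun u hu m => RobinData.existsUnique_mode hd (fun v hv =>
      (mul_pos hκ (hpos v hv)).trans_le (hcoer v v.2).2) hu m,
    fun ε hε => RobinData.existsUnique_robinSolution hd hγ hε fun v hv =>
      (mul_pos (div_pos hγ (add_pos hγ hε)) (mul_pos hκ (hpos v hv))).trans_le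
        (TriMesh.robinForm_ge hα hγ hε v (hcoer v v.2).2),
    fun U u hu hU hC => RobinData.isAsymptoticExpansion_of_solvesCascade hd hγ hα hκ
      (fun v hv => (hcoer v hv).2) hu hU hC⟩
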